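/- **Setting.** Let $G$ be a real Lie group with Lie algebra $\mathfrak g$ and $p\colon P\to M$ a smooth principal $G$-bundle (right action $R_g$, fundamental vector fields $Y_z$). Consider $TP\oplus T^*P$ with $\langle X+\alpha,Y+\beta\rangle=\frac12(\alpha(Y)+\beta(X))$ and the Dorfman bracket $[X+\alpha,Y+\beta]=[X,Y]+L_X\beta-i_Yd\alpha+i_Yi_X\hat H$, where $\hat H\in\Omega^3(P)^G$ is closed, together with a lifted action $\rho(z)=Y_z+\xi_z$ ($z\in\mathfrak g$, $\xi_z\in\Omega^1(P)$ linear in $z$) such that $d\xi_z=i_{Y_z}\hat H$ and $R_g^*\xi_z=\xi_{\mathrm{Ad}(g)z}$; that is, an exact Courant algebroid over $P$ with an equivariant lifted $G$-action, written in an equivariant isotropic splitting. Assume that $c(z,w)=-\langle\rho(z),\rho(w)\rangle$ is a (constant) non-degenerate form on $\mathfrak g$. Put $K=\rho(\mathfrak g)$ and let $E=K^\perp/G$ be the reduced Courant algebroid over $M$: its sections are the smooth $G$-invariant sections of $K^\perp$, with the induced pairing, Dorfman bracket and anchor $\pi\colon E\to T=TM$. One has $T^*=T^*M\subset E$ via $\zeta\mapsto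 p^*\zeta$, and $E/T^*=TP/G$. Write $\operatorname{ad}P=VP/G\subset TP/G$, with the metric $c$ and the bracket $[\cdot,\cdot]$ of invariant vertical vector fields on $P$, and $[[e_1,e_2]]=\frac12([e_1,e_2]-[e_2,e_1])$. A generalized connection on $E$ is an operator $D\colon\Gamma(E)\to\Gamma(E^*\otimes E)$ with $D_e(fs)=fD_es+\pi(e)(f)s$ and $\pi(e)\langle s_1,s_2\rangle=\langle D_es_1,s_2\rangle+\langle s_1,D_es_2\rangle$. Its torsion is $$T_D(e_1,e_2,e_3)=\langle D_{e_1}e_2-D_{e_2}e_1-[[e_1,e_2]],e_3\rangle+\tfrac12\big(\langle D_{e_3}e_1,e_2\rangle-\langle D_{e_3}e_2,e_1\rangle\big).$$ An admissible metric is a smooth subbundle $V_+\subset E$ on which the pairing is non-degenerate, with $V_+\cap T^*=0$ and $\operatorname{rk}V_+=\operatorname{rk}E-\dim M$. Let $V_-=V_+^\perp$, let $\Pi_\pm$ be the orthogonal projections onto $V_\pm$ and $\mathbf G=\Pi_+-\Pi_-$. A generalized connection is compatible with $V_+$ if $D\mathbf G=0$. The map $\pi$ restricts to an isomorphism $\pi_\perp$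 from the orthogonal complement of $V_+\cap\operatorname{Ker}\pi$ in $V_+$ onto $T$. This gives a metric $g(X,Y)=\langle\pi_\perp^{-1}X,\pi_\perp^{-1}Y\rangle$ on $M$ and an isotropic splitting $\lambda(X)=\pi_\perp^{-1}(X)-g(X,\cdot)$ of $\pi$. The image of $\lambda(X)$ in $TP/G$ is the horizontal lift $A^\perp X$ of a connection $A$ on $P$. Put $\nabla^A_Xr=[A^\perp X,r]$, $F(X,Y)=-A[A^\perp X,A^\perp Y]$ and $H(X,Y,Z)=2\langle[\lambda X,\lambda Y],\lambda Z\rangle$. Using $\lambda$ and the isomorphism $V_+\cap\operatorname{Ker}\pi\cong\operatorname{ad}P$, identify $E\cong T\oplus\operatorname{ad}P\oplus T^*$. Let $D'_e=(\nabla^g\oplus\nabla^A\oplus\nabla^{g*})_{\pi(e)}$ with $\nabla^g$ the Levi-Civita connection of $g$ and, for $e=X+r+\xi$ and $s=Y+t+\eta$, let $$\chi^0_es=\big(-F(X,Y)+[r,t]\big)+\big(H(X,Y,\cdot)-2c(F(Y,\cdot),r)+2c(F(X,\cdot),t)\big)\in\operatorname{ad}P\oplus T^*.$$ For a tensor $\chi$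 and signs $a,b,d$ put $\chi^{abd}_es=\Pi_a\chi_{\Pi_be}(\Pi_ds)$. **Proposition.** For every admissible metric $V_+$ on $E$, $$D^0=D'+\tfrac13\chi^{+++}+\tfrac13\chi^{---}+\chi^{+-+}+\chi^{-+-}\qquad(\chi=\chi^0)$$ is a generalized connection that is compatible with $V_+$ and torsion-free. Moreover, for every $\varphi\in\Omega^1(M)$, regarded as the section $\varphi\circ\pi$ of $E^*$, and more generally for every smooth section $\varphi$ of $E^*$, let $\chi^\varphi_es=\varphi(s)e-\langle e,s\rangle\langle\cdot,\cdot\rangle^{-1}\varphi$ be the Weyl term. Then the operator $D^\varphi$ given by the same formula with $\chi=\chi^0+\chi^\varphi$ is also a generalized connection that is compatible with $V_+$ and torsion-free. -/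

import Mathlib

open scoped Manifold ContDiff

noncomputable section

namespace GenGeom

section Calculus

variable {E : Type*} [NormedAddCommGroup E] [NormedSpace ℝ E]
  {M : Type*} [TopologicalSpace M] [ChartedSpace E M] [IsManifold 𝓘(ℝ, E) ∞ M]

/-- A smooth vector field on `M`. -/
def SmoothVF (X : ∀ x : M, TangentSpace 𝓘(ℝ, E) x) : Prop :=
  ContMDiff 𝓘(ℝ, E) (𝓘(ℝ, E)).tangent ∞
    (fun x => (⟨x, X x⟩ : TangentBundle 𝓘(ℝ, E) M))

/-- A smooth `1`-form on `M`: its values on smooth vector fields are smooth functions. -/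
def SmoothOneForm (α : ∀ x : M, Module.Dual ℝ (TangentSpace 𝓘(ℝ, E) x)) : Prop :=
  ∀ X : ∀ x : M, TangentSpace 𝓘(ℝ, E) x, SmoothVF X →
    ContMDiff 𝓘(ℝ, E) 𝓘(ℝ, ℝ) ∞ (fun x => α x (X x))

/-- The derivative `X(f)` of a function along a vector field. -/
def dirDeriv (X : ∀ x : M, TangentSpace 𝓘(ℝ, E) x) (f : M → ℝ) (x : M) : ℝ :=
  mfderiv 𝓘(ℝ, E) 𝓘(ℝ, ℝ) f x (X x)

/-- The Lie bracket of vector fields. -/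
abbrev lie (X Y : ∀ x : M, TangentSpace 𝓘(ℝ, E) x) : ∀ x : M, TangentSpace 𝓘(ℝ, E) x :=
  VectorField.mlieBracket 𝓘(ℝ, E) X Y

/-- `dα(X, Y) = X(α(Y)) - Y(α(X)) - α([X, Y])`. -/
def extDerivOne (α : ∀ x : M, Module.Dual ℝ (TangentSpace 𝓘(ℝ, E) x))
    (X Y : ∀ x : M, TangentSpace 𝓘(ℝ, E) x) (x : M) : ℝ :=
  dirDeriv X (fun y => α y (Y y)) x - dirDeriv Y (fun y => α y (X y)) x - α x (lie X Y x)

/-- `(L_X α)(Y) = X(α(Y)) - α([X, Y])`. -/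
def lieDerivOne (X : ∀ x : M, TangentSpace 𝓘(ℝ, E) x)
    (α : ∀ x : M, Module.Dual ℝ (TangentSpace 𝓘(ℝ, E) x))
    (Y : ∀ x : M, TangentSpace 𝓘(ℝ, E) x) (x : M) : ℝ :=
  dirDeriv X (fun y => α y (Y y)) x - α x (lie X Y x)

/-- The covector `ζ` at `x` with `ζ (Z x) = Φ Z` for all smooth vector fields `Z`. It is only used
for functionals `Φ` that are `C^∞(M)`-linear in `Z` (evaluated at `x`), where it exists and is
unique. -/
def covectorOf (x : M) (Φ : (∀ y : M, TangentSpace 𝓘(ℝ, E) y) → ℝ) :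
    Module.Dual ℝ (TangentSpace 𝓘(ℝ, E) x) :=
  Classical.epsilon fun ζ => ∀ Z : ∀ y : M, TangentSpace 𝓘(ℝ, E) y, SmoothVF Z → ζ (Z x) = Φ Z

/-- `nabla` is a connection on the tangent bundle that is torsion-free and preserves the
(pseudo-Riemannian) metric `g`. -/
structure IsLeviCivita
    (g : ∀ x : M, TangentSpace 𝓘(ℝ, E) x →ₗ[ℝ] TangentSpace 𝓘(ℝ, E) x →ₗ[ℝ] ℝ)
    (nabla : (∀ x : M, TangentSpace 𝓘(ℝ, E) x) → (∀ x : M, TangentSpace 𝓘(ℝ, E) x) →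
      ∀ x : M, TangentSpace 𝓘(ℝ, E) x) : Prop where
  smooth : ∀ X Y, SmoothVF X → SmoothVF Y → SmoothVF (nabla X Y)
  add_left : ∀ X X' Y, SmoothVF X → SmoothVF X' → SmoothVF Y →
    nabla (X + X') Y = nabla X Y + nabla X' Y
  smul_left : ∀ (f : M → ℝ) X Y, ContMDiff 𝓘(ℝ, E) 𝓘(ℝ, ℝ) ∞ f → SmoothVF X → SmoothVF Y →
    nabla (fun x => f x • X x) Y = fun x => f x • nabla X Y x
  add_right : ∀ X Y Y', SmoothVF X → SmoothVF Y → SmoothVF Y' →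
    nabla X (Y + Y') = nabla X Y + nabla X Y'
  leibniz : ∀ (f : M → ℝ) X Y, ContMDiff 𝓘(ℝ, E) 𝓘(ℝ, ℝ) ∞ f → SmoothVF X → SmoothVF Y →
    nabla X (fun x => f x • Y x) = fun x => f x • nabla X Y x + dirDeriv X f x • Y x
  torsion_free : ∀ X Y, SmoothVF X → SmoothVF Y → nabla X Y - nabla Y X = lie X Y
  metric : ∀ X Y Z, SmoothVF X → SmoothVF Y → SmoothVF Z → ∀ x,
    dirDeriv X (fun y => g y (Y y) (Z y)) x = g x (nabla X Y x) (Z x) + g x (Y x) (nabla X Z x)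

/-- The Levi-Civita connection of a pseudo-Riemannian metric `g` (on smooth vector fields it is
determined by `IsLeviCivita`). -/
def leviCivita (g : ∀ x : M, TangentSpace 𝓘(ℝ, E) x →ₗ[ℝ] TangentSpace 𝓘(ℝ, E) x →ₗ[ℝ] ℝ) :
    (∀ x : M, TangentSpace 𝓘(ℝ, E) x) → (∀ x : M, TangentSpace 𝓘(ℝ, E) x) →
      ∀ x : M, TangentSpace 𝓘(ℝ, E) x :=
  Classical.epsilon (IsLeviCivita g)

/-- The dual connection on `1`-forms: `(∇*_X η)(Z) = X(η(Z)) - η(∇_X Z)`. -/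
def dualConnection
    (nabla : (∀ x : M, TangentSpace 𝓘(ℝ, E) x) → (∀ x : M, TangentSpace 𝓘(ℝ, E) x) →
      ∀ x : M, TangentSpace 𝓘(ℝ, E) x)
    (X : ∀ x : M, TangentSpace 𝓘(ℝ, E) x)
    (η : ∀ x : M, Module.Dual ℝ (TangentSpace 𝓘(ℝ, E) x)) (x : M) :
    Module.Dual ℝ (TangentSpace 𝓘(ℝ, E) x) :=
  covectorOf x fun Z => dirDeriv X (fun y => η y (Z y)) x - η x (nabla X Z x)

end Calculus

section Principal

variable {EM : Type*} [NormedAddCommGroup EM] [NormedSpace ℝ EM]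
  {M : Type*} [TopologicalSpace M] [ChartedSpace EM M] [IsManifold 𝓘(ℝ, EM) ∞ M]
  {EG : Type*} [NormedAddCommGroup EG] [NormedSpace ℝ EG]
  {G : Type*} [TopologicalSpace G] [ChartedSpace EG G] [Group G]
  {EP : Type*} [NormedAddCommGroup EP] [NormedSpace ℝ EP]
  {P : Type*} [TopologicalSpace P] [ChartedSpace EP P] [IsManifold 𝓘(ℝ, EP) ∞ P]
  [MulAction Gᵐᵒᵖ P]

variable (EM EG EP) in
/-- `p : P → M` is a smooth principal `G`-bundle; the right action `q · g` is
`MulOpposite.op g • q`. -/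
structure IsPrincipalBundle (G : Type*) [TopologicalSpace G] [ChartedSpace EG G] [Group G]
    [MulAction Gᵐᵒᵖ P] (p : P → M) : Prop where
  smooth_proj : ContMDiff 𝓘(ℝ, EP) 𝓘(ℝ, EM) ∞ p
  smooth_act : ContMDiff ((𝓘(ℝ, EP)).prod 𝓘(ℝ, EG)) 𝓘(ℝ, EP) ∞
    (fun a : P × G => MulOpposite.op a.2 • a.1)
  proj_act : ∀ (g : G) (q : P), p (MulOpposite.op g • q) = p q
  locally_trivial : ∀ x : M, ∃ (U : Set M) (φ : OpenPartialHomeomorph P (M × G)),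
    IsOpen U ∧ x ∈ U ∧ φ.source = p ⁻¹' U ∧ φ.target = U ×ˢ Set.univ ∧
    ContMDiffOn 𝓘(ℝ, EP) ((𝓘(ℝ, EM)).prod 𝓘(ℝ, EG)) ∞ φ φ.source ∧
    ContMDiffOn ((𝓘(ℝ, EM)).prod 𝓘(ℝ, EG)) 𝓘(ℝ, EP) ∞ φ.symm φ.target ∧
    (∀ q ∈ φ.source, (φ q).1 = p q) ∧
    ∀ q ∈ φ.source, ∀ g : G, (φ (MulOpposite.op g • q)).2 = (φ q).2 * g

/-- The adjoint action of `g` on the Lie algebra: the derivative at `1` of `h ↦ g h g⁻¹`. -/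
def adjointAction (g : G) :
    GroupLieAlgebra 𝓘(ℝ, EG) G → GroupLieAlgebra 𝓘(ℝ, EG) G :=
  fun z => (mfderiv 𝓘(ℝ, EG) 𝓘(ℝ, EG) (fun h : G => g * h * g⁻¹) 1 z : EG)

/-- The fundamental vector field `Y_z` of `z` in the Lie algebra: at `q` it is the derivative of
`h ↦ q · h` at `h = 1` in the direction `z` (a tangent vector at `q · 1 = q`). -/
def fundamentalVF (z : GroupLieAlgebra 𝓘(ℝ, EG) G) (q : P) : TangentSpace 𝓘(ℝ, EP) q :=
  (mfderiv 𝓘(ℝ, EG) 𝓘(ℝ, EP) (fun h : G => MulOpposite.op h • q) 1 z : EP)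

/-- The differential of the right translation `R_g : q ↦ q · g`. -/
def dR (g : G) (q : P) :
    TangentSpace 𝓘(ℝ, EP) q →L[ℝ] TangentSpace 𝓘(ℝ, EP) (MulOpposite.op g • q) :=
  mfderiv 𝓘(ℝ, EP) 𝓘(ℝ, EP) (fun q' : P => MulOpposite.op g • q') q

/-- The fibre of `TP ⊕ T*P` at `q`. -/
abbrev GT (EP : Type*) [NormedAddCommGroup EP] [NormedSpace ℝ EP]
    {P : Type*} [TopologicalSpace P] [ChartedSpace EP P] (q : P) : Type _ :=
  TangentSpace 𝓘(ℝ, EP) q × Module.Dual ℝ (TangentSpace 𝓘(ℝ, EP) q)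

/-- The pairing `⟨X + α, Y + β⟩ = (α(Y) + β(X)) / 2` on `TP ⊕ T*P`. -/
def pairing (q : P) : GT EP q →ₗ[ℝ] GT EP q →ₗ[ℝ] ℝ :=
  LinearMap.mk₂ ℝ (fun a b => (1 / 2 : ℝ) * (a.2 b.1 + b.2 a.1))
    (by intro a a' b; simp; ring) (by intro c a b; simp; ring)
    (by intro a b b'; simp; ring) (by intro c a b; simp; ring)

/-- `b = R_g a`: the element `b` of `TP ⊕ T*P` at `q · g` is the translate of `a` at `q`. -/
def IsTranslate (g : G) (q : P) (a : GT EP q) (b : GT EP (MulOpposite.op g • q)) : Prop :=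
  b.1 = dR g q a.1 ∧ ∀ v, b.2 (dR g q v) = a.2 v

variable (EM M EG G EP P) in
/-- The data from which the reduced Courant algebroid is built: a principal `G`-bundle `p : P → M`
and an exact Courant algebroid over `P` with an equivariant lifted action of `G`, written in an
equivariant isotropic splitting. The exact Courant algebroid is `TP ⊕ T*P` with the Dorfman
bracket twisted by a closed invariant `3`-form `Hhat`, and the lifted action is
`ρ(z) = Y_z + ξ_z`. Equivariance of the splitting and of the lift are the conditions
`dξ_z = i_{Y_z} Hhat` and `R_g^* ξ_z = ξ_{Ad(g) z}`; they imply that `ρ` is a homomorphism. The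
quadratic form `c(z) = -⟨ρ(z), ρ(z)⟩` is assumed to be non-degenerate. -/
structure CourantReduction where
  p : P → M
  principal : IsPrincipalBundle EM EG EP G p
  Hhat : ∀ q : P, (TangentSpace 𝓘(ℝ, EP) q) [⋀^Fin 3]→ₗ[ℝ] ℝ
  Hhat_smooth : ∀ X Y Z : ∀ q : P, TangentSpace 𝓘(ℝ, EP) q,
    SmoothVF X → SmoothVF Y → SmoothVF Z →
      ContMDiff 𝓘(ℝ, EP) 𝓘(ℝ, ℝ) ∞ (fun q => Hhat q ![X q, Y q, Z q])
  Hhat_closed : ∀ X Y Z W : ∀ q : P, TangentSpace 𝓘(ℝ, EP) q,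
    SmoothVF X → SmoothVF Y → SmoothVF Z → SmoothVF W → ∀ q,
      dirDeriv X (fun q => Hhat q ![Y q, Z q, W q]) q
        - dirDeriv Y (fun q => Hhat q ![X q, Z q, W q]) q
        + dirDeriv Z (fun q => Hhat q ![X q, Y q, W q]) q
        - dirDeriv W (fun q => Hhat q ![X q, Y q, Z q]) q
        - Hhat q ![lie X Y q, Z q, W q] + Hhat q ![lie X Z q, Y q, W q]
        - Hhat q ![lie X W q, Y q, Z q] - Hhat q ![lie Y Z q, X q, W q]
        + Hhat q ![lie Y W q, X q, Z q] - Hhat q ![lie Z W q, X q, Y q] = 0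
  Hhat_invariant : ∀ (g : G) (q : P) (u v w : TangentSpace 𝓘(ℝ, EP) q),
    Hhat (MulOpposite.op g • q) ![dR g q u, dR g q v, dR g q w] = Hhat q ![u, v, w]
  xi : GroupLieAlgebra 𝓘(ℝ, EG) G →ₗ[ℝ] ∀ q : P, Module.Dual ℝ (TangentSpace 𝓘(ℝ, EP) q)
  xi_smooth : ∀ z, SmoothOneForm (xi z)
  xi_equivariant : ∀ (g : G) z (q : P) (v : TangentSpace 𝓘(ℝ, EP) q),
    xi z (MulOpposite.op g • q) (dR g q v) = xi (adjointAction g z) q v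
  d_xi : ∀ z (X Y : ∀ q : P, TangentSpace 𝓘(ℝ, EP) q), SmoothVF X → SmoothVF Y → ∀ q,
    extDerivOne (xi z) X Y q = Hhat q ![fundamentalVF z q, X q, Y q]
  c : GroupLieAlgebra 𝓘(ℝ, EG) G →ₗ[ℝ] GroupLieAlgebra 𝓘(ℝ, EG) G →ₗ[ℝ] ℝ
  c_eq : ∀ z w (q : P),
    c z w = - pairing q (fundamentalVF z q, xi z q) (fundamentalVF w q, xi w q)
  c_nondegenerate : ∀ z, (∀ w, c z w = 0) → z = 0

namespace CourantReduction

variable (R : CourantReduction EM M EG G EP P)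

/-- The differential of the bundle projection. -/
def dp (q : P) : TangentSpace 𝓘(ℝ, EP) q →ₗ[ℝ] TangentSpace 𝓘(ℝ, EM) (R.p q) :=
  (mfderiv 𝓘(ℝ, EP) 𝓘(ℝ, EM) R.p q).toLinearMap

/-- The lifted action `ρ(z) = Y_z + ξ_z`; its image is the subbundle `K`. -/
def rho (z : GroupLieAlgebra 𝓘(ℝ, EG) G) (q : P) : GT EP q :=
  (fundamentalVF z q, R.xi z q)

/-- The fibre at `q` of the orthogonal complement `K^⊥` of the image `K` of the lifted action. As
`c` is non-degenerate, `K ∩ K^⊥ = 0`, so the reduced Courant algebroid is `E = K^⊥ / G` and the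
fibre of `K^⊥` at `q` is the fibre of `E` at `p(q)`. -/
def Kperp (q : P) : Submodule ℝ (GT EP q) where
  carrier := {a | ∀ z, pairing q a (R.rho z q) = 0}
  add_mem' := by intro a b ha hb z; simp [ha z, hb z]
  zero_mem' := by intro z; simp
  smul_mem' := by intro t a ha z; simp [ha z]

/-- Sections of `E` over `M`: the smooth `G`-invariant sections of `K^⊥` over `P`. -/
structure IsSection (e : ∀ q : P, GT EP q) : Prop where
  smooth_vector : SmoothVF (fun q => (e q).1)
  smooth_form : SmoothOneForm (fun q => (e q).2)
  invariant : ∀ (g : G) (q : P), IsTranslate g q (e q) (e (MulOpposite.op g • q))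
  mem_Kperp : ∀ q, e q ∈ R.Kperp q

/-- The Dorfman bracket of `E`, which is the restriction of the one of `TP ⊕ T*P`:
`[X + α, Y + β] = [X, Y] + L_X β - i_Y dα + i_Y i_X Hhat`. -/
def dorfman (e₁ e₂ : ∀ q : P, GT EP q) (q : P) : GT EP q :=
  (lie (fun q => (e₁ q).1) (fun q => (e₂ q).1) q,
    covectorOf q fun W =>
      lieDerivOne (fun q => (e₁ q).1) (fun q => (e₂ q).2) W q
        - extDerivOne (fun q => (e₁ q).2) (fun q => (e₂ q).1) W q
        + R.Hhat q ![(e₁ q).1, (e₂ q).1, W q])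

/-- The skew-symmetrization `[[e₁, e₂]]` of the Dorfman bracket. -/
def courant (e₁ e₂ : ∀ q : P, GT EP q) (q : P) : GT EP q :=
  (1 / 2 : ℝ) • (R.dorfman e₁ e₂ q - R.dorfman e₂ e₁ q)

open Classical in
/-- The field on `M` induced by a field along `p` that is constant on the fibres of `p`. -/
def descend {B : M → Type*} [∀ x, Zero (B x)] (f : ∀ q : P, B (R.p q)) (x : M) : B x :=
  if h : ∃ q, R.p q = x then h.choose_spec ▸ f h.choose else 0

/-- The anchor `π : E → TM` on sections. -/
def anchor (e : ∀ q : P, GT EP q) : ∀ x : M, TangentSpace 𝓘(ℝ, EM) x :=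
  R.descend (B := fun x => TangentSpace 𝓘(ℝ, EM) x) fun q => R.dp q (e q).1

/-- The inclusion `T*M → E`, `ζ ↦ p^* ζ`; it satisfies `⟨p^* ζ, e⟩ = ζ(π e) / 2`. -/
def cotIncl (q : P) : Module.Dual ℝ (TangentSpace 𝓘(ℝ, EM) (R.p q)) →ₗ[ℝ] GT EP q :=
  LinearMap.inr ℝ _ _ ∘ₗ (R.dp q).dualMap

/-- A generalized metric: a smooth subbundle `V₊ ⊆ E`, given as a `G`-invariant family of subspaces
of the fibres of `K^⊥`, on which the pairing is non-degenerate. Smoothness says that the rank is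
constant and each fibre consists of the values of smooth sections with values in `V₊`. -/
structure IsGeneralizedMetric (V : ∀ q : P, Submodule ℝ (GT EP q)) : Prop where
  le_Kperp : ∀ q, V q ≤ R.Kperp q
  invariant : ∀ (g : G) (q : P) (a : GT EP q) (b : GT EP (MulOpposite.op g • q)),
    IsTranslate g q a b → (a ∈ V q ↔ b ∈ V (MulOpposite.op g • q))
  const_rank : ∀ q q', Module.finrank ℝ (V q) = Module.finrank ℝ (V q')
  smooth : ∀ q, ∀ a ∈ V q, ∃ e, R.IsSection e ∧ (∀ q', e q' ∈ V q') ∧ e q = a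
  nondegenerate : ∀ q, ∀ a ∈ V q, (∀ b ∈ V q, pairing q a b = 0) → a = 0

/-- A generalized metric is admissible if `V₊ ∩ T* = 0` and `rk V₊ = rk E - dim M`. -/
structure IsAdmissible (V : ∀ q : P, Submodule ℝ (GT EP q)) : Prop where
  isGeneralizedMetric : R.IsGeneralizedMetric V
  inf_cotangent : ∀ q, V q ⊓ LinearMap.range (R.cotIncl q) = ⊥
  rank_eq : ∀ q, Module.finrank ℝ (V q) + Module.finrank ℝ EM = Module.finrank ℝ (R.Kperp q)

variable (V : ∀ q : P, Submodule ℝ (GT EP q))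

/-- The orthogonal projection onto `V₊`. -/
def projPlus (e : ∀ q : P, GT EP q) (q : P) : GT EP q :=
  Classical.epsilon fun a => a ∈ V q ∧ ∀ b ∈ V q, pairing q (e q - a) b = 0

/-- The orthogonal projection onto `V₋ = V₊^⊥`. -/
def projMinus (e : ∀ q : P, GT EP q) (q : P) : GT EP q := e q - projPlus V e q

/-- The endomorphism `G` of `E` with eigenbundles `V₊` and `V₋` for the eigenvalues `1`, `-1`. -/
def genG (e : ∀ q : P, GT EP q) (q : P) : GT EP q := projPlus V e q - projMinus V e q

/-- The inverse of the isomorphism from the orthogonal complement of `V₊ ∩ Ker π` in `V₊` onto `T`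
induced by `π`. -/
def piPerpInv (q : P) : TangentSpace 𝓘(ℝ, EM) (R.p q) →ₗ[ℝ] GT EP q :=
  Classical.epsilon fun μ => ∀ v, μ v ∈ V q ∧
    (∀ a ∈ V q, R.dp q a.1 = 0 → pairing q (μ v) a = 0) ∧ R.dp q (μ v).1 = v

/-- The metric on `T` induced by `V₊`, at the point `p(q)`. -/
def metricAt (q : P) : TangentSpace 𝓘(ℝ, EM) (R.p q) →ₗ[ℝ]
    TangentSpace 𝓘(ℝ, EM) (R.p q) →ₗ[ℝ] ℝ :=
  (pairing q).compl₁₂ (R.piPerpInv V q) (R.piPerpInv V q)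

/-- The metric `g` on `M` induced by `V₊`. -/
def metric : ∀ x : M, TangentSpace 𝓘(ℝ, EM) x →ₗ[ℝ] TangentSpace 𝓘(ℝ, EM) x →ₗ[ℝ] ℝ :=
  R.descend (B := fun x => TangentSpace 𝓘(ℝ, EM) x →ₗ[ℝ] TangentSpace 𝓘(ℝ, EM) x →ₗ[ℝ] ℝ)
    (R.metricAt V)

/-- The isotropic splitting `λ : T → E` induced by `V₊`: the lift to `V₊` orthogonal to `Ker π`,
minus `g`. -/
def splitting (q : P) : TangentSpace 𝓘(ℝ, EM) (R.p q) →ₗ[ℝ] GT EP q :=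
  R.piPerpInv V q - R.cotIncl q ∘ₗ R.metricAt V q

/-- The section `λ(X)` for a vector field `X` on `M`. -/
def lam (X : ∀ x : M, TangentSpace 𝓘(ℝ, EM) x) (q : P) : GT EP q :=
  R.splitting V q (X (R.p q))

/-- The horizontal lift `A^⊥ X` for the connection `A` on `P` induced by `V₊`, namely the image of
`λ(X)` under `E → E / T* = TP / G`. -/
def horLift (X : ∀ x : M, TangentSpace 𝓘(ℝ, EM) x) (q : P) : TangentSpace 𝓘(ℝ, EP) q :=
  (R.lam V X q).1

/-- The connection `A : TP → VP` on `P` induced by `V₊`, as a projection onto the vertical bundle. -/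
def connA (q : P) : TangentSpace 𝓘(ℝ, EP) q →ₗ[ℝ] TangentSpace 𝓘(ℝ, EP) q :=
  LinearMap.id - LinearMap.fst ℝ _ _ ∘ₗ R.splitting V q ∘ₗ R.dp q

/-- The identification of `ad P` (vertical vectors) with `V₊ ∩ Ker π`: the inverse of the
restriction to `V₊` of `E → TP / G`. -/
def adLift (q : P) (r : TangentSpace 𝓘(ℝ, EP) q) : GT EP q :=
  Classical.epsilon fun a => a ∈ V q ∧ a.1 = r

/-- The component in `ad P` of a section of `E ≅ T ⊕ ad P ⊕ T*`, as a vertical vector field. -/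
def adPart (e : ∀ q : P, GT EP q) (q : P) : TangentSpace 𝓘(ℝ, EP) q := R.connA V q (e q).1

/-- The component in `T*` of a section of `E ≅ T ⊕ ad P ⊕ T*`: `η(v) = 2⟨e, λ(v)⟩`. -/
def cotPart (e : ∀ q : P, GT EP q) : ∀ x : M, Module.Dual ℝ (TangentSpace 𝓘(ℝ, EM) x) :=
  R.descend (B := fun x => Module.Dual ℝ (TangentSpace 𝓘(ℝ, EM) x))
    fun q => (2 : ℝ) • (pairing q (e q) ∘ₗ R.splitting V q)

/-- The isomorphism `T ⊕ ad P ⊕ T* ≅ E` induced by `V₊`. -/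
def assemble (X : ∀ x : M, TangentSpace 𝓘(ℝ, EM) x) (r : ∀ q : P, TangentSpace 𝓘(ℝ, EP) q)
    (η : ∀ x : M, Module.Dual ℝ (TangentSpace 𝓘(ℝ, EM) x)) (q : P) : GT EP q :=
  R.lam V X q + adLift V q (r q) + R.cotIncl q (η (R.p q))

/-- The generalized connection `D'_e s = (∇^g ⊕ ∇^A ⊕ ∇^{g*})_{π(e)} s` in the splitting
`E ≅ T ⊕ ad P ⊕ T*` induced by `V₊`, with `∇^g` the Levi-Civita connection of `g` and
`∇^A_X r = [A^⊥ X, r]`. -/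
def Dprime (e s : ∀ q : P, GT EP q) : ∀ q : P, GT EP q :=
  R.assemble V
    (leviCivita (R.metric V) (R.anchor e) (R.anchor s))
    (lie (R.horLift V (R.anchor e)) (R.adPart V s))
    (dualConnection (leviCivita (R.metric V)) (R.anchor e) (R.cotPart V s))

/-- The curvature `F(X, Y) = -A[A^⊥ X, A^⊥ Y]` of `A`. -/
def curvF (X Y : ∀ x : M, TangentSpace 𝓘(ℝ, EM) x) (q : P) : TangentSpace 𝓘(ℝ, EP) q :=
  - R.connA V q (lie (R.horLift V X) (R.horLift V Y) q)

/-- The `3`-form `H` on `M` induced by `V₊` (pulled back to `P`): `i_Y i_X H` is the component in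
`T*` of `[λ(X), λ(Y)]`, that is, `H(X, Y, Z) = 2⟨[λ(X), λ(Y)], λ(Z)⟩`. -/
def threeH (X Y Z : ∀ x : M, TangentSpace 𝓘(ℝ, EM) x) (q : P) : ℝ :=
  2 * pairing q (R.dorfman (R.lam V X) (R.lam V Y) q) (R.lam V Z q)

/-- The metric `c` on `ad P`: vertical vectors at `q` are of the form `Y_z(q)` for a unique `z`. -/
def cAd (q : P) (r t : TangentSpace 𝓘(ℝ, EP) q) : ℝ :=
  R.c (Classical.epsilon fun z => fundamentalVF z q = r)
    (Classical.epsilon fun z => fundamentalVF z q = t)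

/-- The tensor `χ⁰`. For `e = X + r + ξ` and `s = Y + t + η`, the component of `χ⁰_e s` in `T` is
zero, the one in `ad P` is `-F(X, Y) + [r, t]`, and the one in `T*` is
`H(X, Y, ·) - 2c(F(Y, ·), r) + 2c(F(X, ·), t)`. Here `[r, t]` is the bracket of invariant vertical
vector fields on `P`; as `c` is invariant, it is the element `u` with `c(u, ·) = c(r, [t, ·])`. -/
def chi0 (e s : ∀ q : P, GT EP q) (q : P) : GT EP q :=
  adLift V q
      (- R.curvF V (R.anchor e) (R.anchor s) q + lie (R.adPart V e) (R.adPart V s) q)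
    + R.cotIncl q (covectorOf (R.p q) fun Z =>
        R.threeH V (R.anchor e) (R.anchor s) Z q
          - 2 * R.cAd q (R.curvF V (R.anchor s) Z q) (R.adPart V e q)
          + 2 * R.cAd q (R.curvF V (R.anchor e) Z q) (R.adPart V s q))

/-- `D' + (1/3) χ⁺⁺⁺ + (1/3) χ⁻⁻⁻ + χ⁺⁻⁺ + χ⁻⁺⁻`, where the three signs refer, in this order, to
the outer projection, to the first and to the second argument:
`χ^{abc}_{e} s = Π_a χ_{Π_b e} (Π_c s)`. -/
def correct (χ : (∀ q : P, GT EP q) → (∀ q : P, GT EP q) → ∀ q : P, GT EP q)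
    (e s : ∀ q : P, GT EP q) : ∀ q : P, GT EP q :=
  R.Dprime V e s
    + (1 / 3 : ℝ) • projPlus V (χ (projPlus V e) (projPlus V s))
    + (1 / 3 : ℝ) • projMinus V (χ (projMinus V e) (projMinus V s))
    + projPlus V (χ (projMinus V e) (projPlus V s))
    + projMinus V (χ (projPlus V e) (projMinus V s))

/-- The operator `D⁰`. -/
def Dzero : (∀ q : P, GT EP q) → (∀ q : P, GT EP q) → ∀ q : P, GT EP q :=
  R.correct V (R.chi0 V)

/-- A smooth section of `E*`: a family of functionals on the fibres of `E` (only the values on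
`K^⊥` matter) whose values on sections of `E` are smooth functions on `M`. -/
def IsDualSection (φ : ∀ q : P, Module.Dual ℝ (GT EP q)) : Prop :=
  ∀ e, R.IsSection e → ∃ f : M → ℝ, ContMDiff 𝓘(ℝ, EM) 𝓘(ℝ, ℝ) ∞ f ∧
    ∀ q, φ q (e q) = f (R.p q)

/-- A `1`-form on `M` regarded as a section of `E*` by means of the anchor. -/
def oneFormDual (φ : ∀ x : M, Module.Dual ℝ (TangentSpace 𝓘(ℝ, EM) x)) (q : P) :
    Module.Dual ℝ (GT EP q) :=
  φ (R.p q) ∘ₗ R.dp q ∘ₗ LinearMap.fst ℝ _ _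

/-- `⟨·,·⟩⁻¹ φ`: the element of `E` which represents `φ`. -/
def sharp (φ : ∀ q : P, Module.Dual ℝ (GT EP q)) (q : P) : GT EP q :=
  Classical.epsilon fun u => u ∈ R.Kperp q ∧ ∀ a ∈ R.Kperp q, pairing q u a = φ q a

/-- The Weyl term `χ^φ_e s = φ(s) e - ⟨e, s⟩ ⟨·,·⟩⁻¹ φ`. -/
def weyl (φ : ∀ q : P, Module.Dual ℝ (GT EP q)) (e s : ∀ q : P, GT EP q) (q : P) : GT EP q :=
  φ q (s q) • e q - pairing q (e q) (s q) • R.sharp φ q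

/-- The operator `D^φ`, obtained from the formula of `D⁰` by changing `χ⁰` to `χ⁰ + χ^φ`. -/
def Dphi (φ : ∀ q : P, Module.Dual ℝ (GT EP q)) :
    (∀ q : P, GT EP q) → (∀ q : P, GT EP q) → ∀ q : P, GT EP q :=
  R.correct V fun e s => R.chi0 V e s + R.weyl φ e s

/-- A generalized connection on `E` that is compatible with the pairing. The function `⟨s₁, s₂⟩` on
`M` is written as an invariant function on `P`, and `π(e)` acts on it through the invariant vector
field on `P` underlying `e`. -/
structure IsGeneralizedConnection
    (D : (∀ q : P, GT EP q) → (∀ q : P, GT EP q) → ∀ q : P, GT EP q) : Prop where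
  isSection : ∀ e s, R.IsSection e → R.IsSection s → R.IsSection (D e s)
  add_left : ∀ e e' s, R.IsSection e → R.IsSection e' → R.IsSection s →
    D (e + e') s = D e s + D e' s
  smul_left : ∀ (f : M → ℝ) e s, ContMDiff 𝓘(ℝ, EM) 𝓘(ℝ, ℝ) ∞ f →
    R.IsSection e → R.IsSection s →
      D (fun q => f (R.p q) • e q) s = fun q => f (R.p q) • D e s q
  add_right : ∀ e s s', R.IsSection e → R.IsSection s → R.IsSection s' →
    D e (s + s') = D e s + D e s'
  leibniz : ∀ (f : M → ℝ) e s, ContMDiff 𝓘(ℝ, EM) 𝓘(ℝ, ℝ) ∞ f →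
    R.IsSection e → R.IsSection s →
      D e (fun q => f (R.p q) • s q)
        = fun q => f (R.p q) • D e s q + dirDeriv (R.anchor e) f (R.p q) • s q
  metric : ∀ e s₁ s₂, R.IsSection e → R.IsSection s₁ → R.IsSection s₂ → ∀ q,
    dirDeriv (fun q => (e q).1) (fun q => pairing q (s₁ q) (s₂ q)) q
      = pairing q (D e s₁ q) (s₂ q) + pairing q (s₁ q) (D e s₂ q)

/-- Compatibility with `V₊`: `D G = 0`. -/
def IsCompatible (D : (∀ q : P, GT EP q) → (∀ q : P, GT EP q) → ∀ q : P, GT EP q) : Prop :=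
  ∀ e s, R.IsSection e → R.IsSection s → D e (genG V s) = genG V (D e s)

/-- The generalized torsion (Gualtieri):
`⟨D_{e₁}e₂ - D_{e₂}e₁ - [[e₁, e₂]], e₃⟩ + (⟨D_{e₃}e₁, e₂⟩ - ⟨D_{e₃}e₂, e₁⟩) / 2`. -/
def torsion (D : (∀ q : P, GT EP q) → (∀ q : P, GT EP q) → ∀ q : P, GT EP q)
    (e₁ e₂ e₃ : ∀ q : P, GT EP q) (q : P) : ℝ :=
  pairing q (D e₁ e₂ q - D e₂ e₁ q - R.courant e₁ e₂ q) (e₃ q)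
    + (1 / 2 : ℝ) * (pairing q (D e₃ e₁ q) (e₂ q) - pairing q (D e₃ e₂ q) (e₁ q))

/-- The generalized torsion of `D` vanishes. -/
def IsTorsionFree (D : (∀ q : P, GT EP q) → (∀ q : P, GT EP q) → ∀ q : P, GT EP q) : Prop :=
  ∀ e₁ e₂ e₃, R.IsSection e₁ → R.IsSection e₂ → R.IsSection e₃ → ∀ q,
    R.torsion D e₁ e₂ e₃ q = 0

end CourantReduction

end Principal

end GenGeom

end

open scoped Manifold ContDiff

noncomputable section

set_option linter.unusedSectionVars false

namespace GenGeom

/-! ### Smooth vector fields: brackets and directional derivatives. -/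

section Calculus

variable {E : Type*} [NormedAddCommGroup E] [NormedSpace ℝ E]
  {M : Type*} [TopologicalSpace M] [ChartedSpace E M] [IsManifold 𝓘(ℝ, E) ∞ M]

/-! Write `T(a, b, c)` for the torsion of `D'`, in the form `torsionForm`. The torsion of a
generalized connection is tensorial and totally skew (`torsionForm_swap_left`,
`torsionForm_swap_right`); this rests on two identities of the Dorfman bracket,
`pairing_dorfman_add_swap` and `pairing_dorfman_add_pairing`. The operator `D'` is a generalized
connection, and it preserves `V₊`, because `V₊` consists of the elements `X + r + g(X, ·)` and the
Levi-Civita connection preserves `g` (`IsAdmissible.Dprime_mem`).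

The crux is `IsAdmissible.pairing_chi0`: `⟨χ⁰_a b, c⟩ = -T(a, b, c)`. Indeed `T` vanishes as soon as
one argument lies in `T*`, since `∇^g` is torsion-free, and it vanishes on one `λ(X)` and two
elements of `ad P`, by the definition of `∇^A`. What is left are pairings of `[λX, λY]` and of `[r,
t]`, that is, `H`, `F` and the bracket of `ad P`, which are the ingredients of `χ⁰`.

Adding to a connection a tensor whose trilinear form `S(a, b, c)` is skew in `b, c` keeps it metric
and changes the torsion by `S(a, b, c) - S(b, a, c) + S(c, a, b)`. Split the three arguments into
their parts in `V₊` and `V₋`. On the types `+++` and `---` the three terms of `χ⁰ / 3` add up to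
`-T`. On a mixed type one argument has a sign different from the other two, and of the three terms
only the one with this argument in first place survives, with coefficient 1; it again equals `-T`.
So all eight components of the torsion are cancelled. Every correction has the same sign outside as
in its second argument, so `V₊` and `V₋` stay preserved. The Weyl term is skew in the last two
arguments, its alternating sum over the three positions is zero, and on the mixed types it vanishes
because each summand contains a pairing of `V₊` with `V₋` (`IsAdmissible.chiForm_cycle`,
`chiForm_of_orthogonal`).

The remaining work is analytic. The fields on `P` are specified pointwise, often by choice, and are
recognised as smooth invariant sections through their pairings (`isSection_of_pairing`). Since the
pairing of `E` is non-degenerate (`Kperp_nondegenerate`), identities in `E` become scalar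
identities. That the Dorfman bracket stays in `K^⊥` is `pairing_dorfman_rho`, which uses that
invariant vector fields commute with fundamental ones
(`IsPrincipalBundle.lie_fundamentalVF_eq_zero`). -/

theorem SmoothVF.add {X Y : ∀ x : M, TangentSpace 𝓘(ℝ, E) x} (hX : SmoothVF X)
    (hY : SmoothVF Y) : SmoothVF (X + Y) :=
  ContMDiff.add_section hX hY

theorem SmoothVF.smul {f : M → ℝ} (hf : ContMDiff 𝓘(ℝ, E) 𝓘(ℝ, ℝ) ∞ f)
    {X : ∀ x : M, TangentSpace 𝓘(ℝ, E) x} (hX : SmoothVF X) :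
    SmoothVF (fun x => f x • X x) :=
  ContMDiff.smul_section hf hX

theorem SmoothVF.const_smul (c : ℝ) {X : ∀ x : M, TangentSpace 𝓘(ℝ, E) x} (hX : SmoothVF X) :
    SmoothVF (c • X) :=
  ContMDiff.const_smul_section hX

theorem SmoothVF.sum {ι : Type*} {s : Finset ι} {X : ι → ∀ x : M, TangentSpace 𝓘(ℝ, E) x}
    (hX : ∀ i ∈ s, SmoothVF (X i)) : SmoothVF (fun x => ∑ i ∈ s, X i x) :=
  ContMDiff.sum_section hX

theorem SmoothVF.zero : SmoothVF (0 : ∀ x : M, TangentSpace 𝓘(ℝ, E) x) :=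
  Bundle.contMDiff_zeroSection ℝ (TangentSpace 𝓘(ℝ, E) : M → Type _)

theorem SmoothVF.mdifferentiableAt {X : ∀ x : M, TangentSpace 𝓘(ℝ, E) x} (hX : SmoothVF X)
    (x : M) : MDifferentiableAt 𝓘(ℝ, E) (𝓘(ℝ, E)).tangent
      (fun x => (⟨x, X x⟩ : TangentBundle 𝓘(ℝ, E) M)) x :=
  ContMDiff.mdifferentiable hX (by simp) x

theorem isManifold_minSmoothness_two : IsManifold 𝓘(ℝ, E) (minSmoothness ℝ 2) M :=
  IsManifold.of_le (n := ∞) (by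
    rw [minSmoothness_of_isRCLikeNormedField]; exact WithTop.coe_le_coe.2 (le_top : (2 : ℕ∞) ≤ ⊤))

theorem SmoothVF.lie [CompleteSpace E] {X Y : ∀ x : M, TangentSpace 𝓘(ℝ, E) x} (hX : SmoothVF X)
    (hY : SmoothVF Y) : SmoothVF (lie X Y) := by
  have : IsManifold 𝓘(ℝ, E) (((⊤ : ℕ∞) : WithTop ℕ∞) + 1) M := by simpa using ‹IsManifold 𝓘(ℝ, E) ∞ M›
  have : IsManifold 𝓘(ℝ, E) (minSmoothness ℝ 2) M := isManifold_minSmoothness_two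
  exact ContDiff.mlieBracket_vectorField (n := (⊤ : ℕ∞)) (m := (⊤ : ℕ∞)) hX hY (by simp)

theorem lie_swap (X Y : ∀ x : M, TangentSpace 𝓘(ℝ, E) x) (x : M) : lie X Y x = - lie Y X x :=
  VectorField.mlieBracket_swap_apply

section lieBracketRules
variable [CompleteSpace E]

theorem lie_add_left {X X' : ∀ x : M, TangentSpace 𝓘(ℝ, E) x} (Y : ∀ x : M, TangentSpace 𝓘(ℝ, E) x)
    (hX : SmoothVF X) (hX' : SmoothVF X') : lie (X + X') Y = lie X Y + lie X' Y := by
  have : IsManifold 𝓘(ℝ, E) (minSmoothness ℝ 2) M := isManifold_minSmoothness_two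
  funext x
  exact VectorField.mlieBracket_add_left (hX.mdifferentiableAt x) (hX'.mdifferentiableAt x)

theorem lie_add_right (X : ∀ x : M, TangentSpace 𝓘(ℝ, E) x) {Y Y' : ∀ x : M, TangentSpace 𝓘(ℝ, E) x}
    (hY : SmoothVF Y) (hY' : SmoothVF Y') : lie X (Y + Y') = lie X Y + lie X Y' := by
  funext x
  exact VectorField.mlieBracket_add_right (hY.mdifferentiableAt x) (hY'.mdifferentiableAt x)

theorem lie_smul_right {f : M → ℝ} (hf : ContMDiff 𝓘(ℝ, E) 𝓘(ℝ, ℝ) ∞ f)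
    (X : ∀ x : M, TangentSpace 𝓘(ℝ, E) x) {Y : ∀ x : M, TangentSpace 𝓘(ℝ, E) x}
    (hY : SmoothVF Y) (x : M) :
    lie X (fun x => f x • Y x) x = dirDeriv X f x • Y x + f x • lie X Y x :=
  VectorField.mlieBracket_smul_right (hf.mdifferentiable (by simp) x) (hY.mdifferentiableAt x)

theorem lie_smul_left {f : M → ℝ} (hf : ContMDiff 𝓘(ℝ, E) 𝓘(ℝ, ℝ) ∞ f)
    {X : ∀ x : M, TangentSpace 𝓘(ℝ, E) x} (Y : ∀ x : M, TangentSpace 𝓘(ℝ, E) x)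
    (hX : SmoothVF X) (x : M) :
    lie (fun x => f x • X x) Y x = - dirDeriv Y f x • X x + f x • lie X Y x :=
  VectorField.mlieBracket_smul_left (hf.mdifferentiable (by simp) x) (hX.mdifferentiableAt x)

end lieBracketRules

/-- The derivative is the fibre component of the tangent map of `f` applied to `X`, a composite of
smooth maps. -/
theorem SmoothVF.dirDeriv {X : ∀ x : M, TangentSpace 𝓘(ℝ, E) x} (hX : SmoothVF X) {f : M → ℝ}
    (hf : ContMDiff 𝓘(ℝ, E) 𝓘(ℝ, ℝ) ∞ f) :
    ContMDiff 𝓘(ℝ, E) 𝓘(ℝ, ℝ) ∞ (dirDeriv X f) := by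
  have h1 : ContMDiff (𝓘(ℝ, E)).tangent (𝓘(ℝ, ℝ)).tangent ∞ (tangentMap 𝓘(ℝ, E) 𝓘(ℝ, ℝ) f) :=
    hf.contMDiff_tangentMap (by simp)
  have h2 := h1.comp hX
  have h3 : ContMDiff (𝓘(ℝ, ℝ)).tangent 𝓘(ℝ, ℝ) ∞
      (fun v : TangentBundle 𝓘(ℝ, ℝ) ℝ => (v.2 : ℝ)) := by
    have := contMDiff_snd_tangentBundle_modelSpace ℝ 𝓘(ℝ, ℝ) (n := ∞)
    exact this
  exact h3.comp h2

theorem dirDeriv_add (X : ∀ x : M, TangentSpace 𝓘(ℝ, E) x) {f g : M → ℝ}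
    (hf : ContMDiff 𝓘(ℝ, E) 𝓘(ℝ, ℝ) ∞ f) (hg : ContMDiff 𝓘(ℝ, E) 𝓘(ℝ, ℝ) ∞ g) (x : M) :
    dirDeriv X (fun y => f y + g y) x = dirDeriv X f x + dirDeriv X g x := by
  unfold dirDeriv
  have := mfderiv_add (hf.mdifferentiable (by simp) x) (hg.mdifferentiable (by simp) x)
  exact congrArg (fun L => L (X x)) this

theorem dirDeriv_mul (X : ∀ x : M, TangentSpace 𝓘(ℝ, E) x) {f g : M → ℝ}
    (hf : ContMDiff 𝓘(ℝ, E) 𝓘(ℝ, ℝ) ∞ f) (hg : ContMDiff 𝓘(ℝ, E) 𝓘(ℝ, ℝ) ∞ g) (x : M) :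
    dirDeriv X (fun y => f y * g y) x = dirDeriv X f x * g x + f x * dirDeriv X g x := by
  unfold dirDeriv
  have := ((hf.mdifferentiable (by simp) x).hasMFDerivAt.mul
    (hg.mdifferentiable (by simp) x).hasMFDerivAt).mfderiv
  refine (congrArg (fun L => L (X x)) this).trans ?_
  change f x * _ + g x * _ = _
  rw [add_comm, mul_comm (g x)]
  rfl

theorem dirDeriv_const (X : ∀ x : M, TangentSpace 𝓘(ℝ, E) x) (c : ℝ) (x : M) :
    dirDeriv X (fun _ => c) x = 0 := by
  unfold dirDeriv
  rw [mfderiv_const]; rfl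

theorem dirDeriv_const_mul (X : ∀ x : M, TangentSpace 𝓘(ℝ, E) x) (c : ℝ) {f : M → ℝ}
    (hf : ContMDiff 𝓘(ℝ, E) 𝓘(ℝ, ℝ) ∞ f) (x : M) :
    dirDeriv X (fun y => c * f y) x = c * dirDeriv X f x := by
  rw [dirDeriv_mul X contMDiff_const hf, dirDeriv_const]; simp

theorem dirDeriv_add_field (X Y : ∀ x : M, TangentSpace 𝓘(ℝ, E) x) (f : M → ℝ) (x : M) :
    dirDeriv (X + Y) f x = dirDeriv X f x + dirDeriv Y f x := by
  exact map_add (mfderiv 𝓘(ℝ, E) 𝓘(ℝ, ℝ) f x) (X x) (Y x)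

theorem dirDeriv_smul_field (h : M → ℝ) (X : ∀ x : M, TangentSpace 𝓘(ℝ, E) x) (f : M → ℝ) (x : M) :
    dirDeriv (fun x => h x • X x) f x = h x * dirDeriv X f x := by
  exact map_smul (mfderiv 𝓘(ℝ, E) 𝓘(ℝ, ℝ) f x) (h x) (X x)

end Calculus

/-! ### Frames cut off to global fields, and tensoriality. -/

section Frames

variable {E : Type*} [NormedAddCommGroup E] [NormedSpace ℝ E] [FiniteDimensional ℝ E]
  {M : Type*} [TopologicalSpace M] [T2Space M] [ChartedSpace E M] [IsManifold 𝓘(ℝ, E) ∞ M]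

/-- Near `x`, the identity of the tangent bundle is a finite sum of global smooth tensors `θ ⊗ e`. -/
theorem exists_frame (x : M) :
    ∃ (e : Fin (Module.finrank ℝ E) → ∀ y : M, TangentSpace 𝓘(ℝ, E) y)
      (θ : Fin (Module.finrank ℝ E) → ∀ y : M, Module.Dual ℝ (TangentSpace 𝓘(ℝ, E) y))
      (b : M → ℝ), (∀ i, SmoothVF (e i)) ∧ (∀ i, SmoothOneForm (θ i)) ∧
      ContMDiff 𝓘(ℝ, E) 𝓘(ℝ, ℝ) ∞ b ∧ b x = 1 ∧
      ∀ y (v : TangentSpace 𝓘(ℝ, E) y), b y • v = ∑ i, θ i y v • e i y := by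
  classical
  have : IsManifold 𝓘(ℝ, E) (∞ + 1) M := by simpa using ‹IsManifold 𝓘(ℝ, E) ∞ M›
  have : IsManifold 𝓘(ℝ, E) (1 + 1) M := IsManifold.of_le (n := ∞) (by
    exact WithTop.coe_le_coe.2 (le_top : (2 : ℕ∞) ≤ ⊤))
  let t := trivializationAt E (TangentSpace 𝓘(ℝ, E) : M → Type _) x
  let B := Module.finBasis ℝ E
  let ψ : SmoothBumpFunction 𝓘(ℝ, E) x := Classical.arbitrary _
  have ht : t.baseSet = (chartAt E x).source := rfl
  -- The frame and the coframe are each multiplied by the bump function, so that both extend by zero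
  -- to all of `M`; their contraction then carries the factor `ψ ^ 2`.
  refine ⟨fun i y => ψ y • t.localFrame B i y,
    fun i y => ψ y • t.localFrameCoeff 𝓘(ℝ, E) B i y, fun y => ψ y * ψ y, fun i => ?_, fun i => ?_,
    ?_, ?_, ?_⟩
  · exact ContMDiffOn.smul_section_of_tsupport (u := (chartAt E x).source)
      ψ.contMDiff.contMDiffOn (chartAt E x).open_source ψ.tsupport_subset_chartAt_source
      (ht ▸ t.contMDiffOn_localFrame_baseSet ∞ B i)
  · intro X hX
    have := ψ.contMDiff_smul (g := fun y => t.localFrameCoeff 𝓘(ℝ, E) B i y (X y))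
      (ht ▸ contMDiffOn_baseSet_localFrameCoeff (e := t) (k := ∞) B (ContMDiff.contMDiffOn hX) i)
    exact this
  · exact ψ.contMDiff.mul ψ.contMDiff
  · simp
  · intro y v
    by_cases hy : y ∈ t.baseSet
    -- The expansion is available for sections, so `v` is extended by zero; no regularity of this
    -- extension is needed.
    · have h := t.eq_sum_localFrameCoeff_smul (I := 𝓘(ℝ, E)) (b := B) hy
        (s := Function.update (fun z => (0 : TangentSpace 𝓘(ℝ, E) z)) y v)
      simp only [Function.update_self] at h
      conv_lhs => rw [h, Finset.smul_sum]
      refine Finset.sum_congr rfl fun i _ => ?_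
      simp only [LinearMap.smul_apply, smul_smul, smul_eq_mul]
      congr 1; ring
    · have : ψ y = 0 := by
        by_contra h
        exact hy (ψ.support_subset_source h)
      simp [this]

theorem exists_smoothVF (x : M) (v : TangentSpace 𝓘(ℝ, E) x) :
    ∃ X : ∀ y : M, TangentSpace 𝓘(ℝ, E) y, SmoothVF X ∧ X x = v := by
  obtain ⟨e, θ, b, he, hθ, hb, hbx, h⟩ := exists_frame (E := E) x
  refine ⟨fun y => ∑ i, θ i x v • e i y, SmoothVF.sum fun i _ => (he i).const_smul _, ?_⟩
  exact (h x v).symm.trans (by rw [hbx, one_smul])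

theorem SmoothOneForm.sum_smul {ι : Type*} [Fintype ι]
    {f : ι → M → ℝ} (hf : ∀ i, ContMDiff 𝓘(ℝ, E) 𝓘(ℝ, ℝ) ∞ (f i))
    {θ : ι → ∀ y : M, Module.Dual ℝ (TangentSpace 𝓘(ℝ, E) y)} (hθ : ∀ i, SmoothOneForm (θ i)) :
    SmoothOneForm (fun y => ∑ i, f i y • θ i y) := by
  intro X hX
  have : ContMDiff 𝓘(ℝ, E) 𝓘(ℝ, ℝ) ∞ (fun y => ∑ i, f i y * θ i y (X y)) :=
    contMDiff_finsetSum fun i _ => (hf i).mul (hθ i X hX)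
  convert this using 2 with y
  simp [LinearMap.sum_apply]

theorem exists_smoothOneForm (x : M) (ζ : Module.Dual ℝ (TangentSpace 𝓘(ℝ, E) x)) :
    ∃ α : ∀ y : M, Module.Dual ℝ (TangentSpace 𝓘(ℝ, E) y), SmoothOneForm α ∧ α x = ζ := by
  obtain ⟨e, θ, b, he, hθ, hb, hbx, h⟩ := exists_frame (E := E) x
  refine ⟨fun y => ∑ i, ζ (e i x) • θ i y,
    SmoothOneForm.sum_smul (f := fun i _ => ζ (e i x)) (fun i => contMDiff_const) hθ, ?_⟩
  ext v
  have : ζ v = ζ (∑ i, θ i x v • e i x) := by rw [← h, hbx, one_smul]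
  rw [this, map_sum]
  simp [LinearMap.sum_apply, mul_comm]

/-- A functional on vector fields that is `C^∞`-linear at `x` is given by a covector at `x`. -/
theorem exists_covector (x : M) (Φ : (∀ y : M, TangentSpace 𝓘(ℝ, E) y) → ℝ)
    (hadd : ∀ X Y, SmoothVF X → SmoothVF Y → Φ (X + Y) = Φ X + Φ Y)
    (hsmul : ∀ (f : M → ℝ) X, ContMDiff 𝓘(ℝ, E) 𝓘(ℝ, ℝ) ∞ f → SmoothVF X →
      Φ (fun y => f y • X y) = f x * Φ X) :
    ∃ ζ : Module.Dual ℝ (TangentSpace 𝓘(ℝ, E) x), ∀ Z, SmoothVF Z → ζ (Z x) = Φ Z := by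
  obtain ⟨e, θ, b, he, hθ, hb, hbx, h⟩ := exists_frame (E := E) x
  have hzero : Φ 0 = 0 := by simpa using hadd 0 0 SmoothVF.zero SmoothVF.zero
  have hsum : ∀ (s : Finset (Fin (Module.finrank ℝ E)))
      (X : Fin (Module.finrank ℝ E) → ∀ y : M, TangentSpace 𝓘(ℝ, E) y),
      (∀ i, SmoothVF (X i)) → Φ (fun y => ∑ i ∈ s, X i y) = ∑ i ∈ s, Φ (X i) := by
    intro s X hX
    induction s using Finset.induction_on with
    | empty => simpa using! hzero
    | insert a s ha ih =>
      simp only [Finset.sum_insert ha]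
      rw [← ih]
      exact hadd _ _ (hX a) (SmoothVF.sum fun i _ => hX i)
  -- As `b x = 1`, linearity gives `Φ Z = Φ (b Z)`, and `b Z` is a global combination of the fields
  -- `e i` with smooth coefficients. This forces the covector.
  refine ⟨∑ i, Φ (e i) • θ i x, fun Z hZ => ?_⟩
  have h1 : Φ (fun y => b y • Z y) = Φ Z := by rw [hsmul b Z hb hZ, hbx, one_mul]
  have h2 : (fun y => b y • Z y) = fun y => ∑ i, θ i y (Z y) • e i y := funext fun y => h y (Z y)
  rw [← h1, h2, hsum _ (fun i y => θ i y (Z y) • e i y) fun i => (he i).smul (hθ i Z hZ)]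
  rw [LinearMap.sum_apply]
  refine Finset.sum_congr rfl fun i _ => ?_
  rw [hsmul _ _ (hθ i Z hZ) (he i)]
  simp [mul_comm]

/-- `covectorOf` is a choice operator, without content until a representing covector is known to
exist; `exists_covector` supplies one from a check of tensoriality. -/
theorem covectorOf_apply (x : M) {Φ : (∀ y : M, TangentSpace 𝓘(ℝ, E) y) → ℝ}
    (h : ∃ ζ : Module.Dual ℝ (TangentSpace 𝓘(ℝ, E) x), ∀ Z, SmoothVF Z → ζ (Z x) = Φ Z)
    {Z : ∀ y : M, TangentSpace 𝓘(ℝ, E) y} (hZ : SmoothVF Z) : covectorOf x Φ (Z x) = Φ Z :=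
  Classical.epsilon_spec h Z hZ

end Frames

/-! ### The Lie bracket as the commutator of derivations. -/

section LieDerivation

variable {E : Type*} [NormedAddCommGroup E] [NormedSpace ℝ E] [FiniteDimensional ℝ E]
  {M : Type*} [TopologicalSpace M] [ChartedSpace E M] [IsManifold 𝓘(ℝ, E) ∞ M]

theorem mfderiv_eq_fderiv_extChartAt {f : M → ℝ} {x : M}
    (hf : MDifferentiableAt 𝓘(ℝ, E) 𝓘(ℝ, ℝ) f x) (v : TangentSpace 𝓘(ℝ, E) x) :
    mfderiv 𝓘(ℝ, E) 𝓘(ℝ, ℝ) f x v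
      = fderiv ℝ (f ∘ (extChartAt 𝓘(ℝ, E) x).symm) (extChartAt 𝓘(ℝ, E) x x) v := by
  rw [hf.mfderiv]
  simp [writtenInExtChartAt, fderivWithin_univ]
  rfl

/-- The pulled-back field contains the inverse of the derivative of the inverse chart, which cancels
the factor produced by the chain rule. The identity is needed on the whole chart target, not only at
its centre, because it is differentiated once more in `dirDeriv_lie`. -/
theorem fderiv_comp_extChartAt_symm {f : M → ℝ} (hf : ContMDiff 𝓘(ℝ, E) 𝓘(ℝ, ℝ) ∞ f)
    (X : ∀ x : M, TangentSpace 𝓘(ℝ, E) x) (x : M) {y : E}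
    (hy : y ∈ (extChartAt 𝓘(ℝ, E) x).target) :
    fderiv ℝ (f ∘ (extChartAt 𝓘(ℝ, E) x).symm) y
      (VectorField.mpullbackWithin 𝓘(ℝ, E) 𝓘(ℝ, E) (extChartAt 𝓘(ℝ, E) x).symm X
        (Set.range 𝓘(ℝ, E)) y)
      = dirDeriv X f ((extChartAt 𝓘(ℝ, E) x).symm y) := by
  have : IsManifold 𝓘(ℝ, E) 1 M := IsManifold.of_le (n := ∞) (by simp)
  have h1 := isInvertible_mfderivWithin_extChartAt_symm (I := 𝓘(ℝ, E)) hy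
  have h2 := mdifferentiableWithinAt_extChartAt_symm (I := 𝓘(ℝ, E)) hy
  rw [← mfderiv_eq_fderiv]
  simp only [modelWithCornersSelf_coe, Set.range_id, mdifferentiableWithinAt_univ,
    mfderivWithin_univ] at h1 h2
  rw [mfderiv_comp y (hf.mdifferentiable (by simp) _) h2]
  simp only [VectorField.mpullbackWithin_apply, modelWithCornersSelf_coe, Set.range_id,
    mfderivWithin_univ, dirDeriv]
  change mfderiv 𝓘(ℝ, E) 𝓘(ℝ, ℝ) f _ (mfderiv 𝓘(ℝ, E) 𝓘(ℝ, E) _ y _) = _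
  congr 1
  obtain ⟨L, hL⟩ := h1
  rw [← hL]
  exact (congrArg L (DFunLike.congr_fun (ContinuousLinearMap.inverse_equiv L) _)).trans
    (L.apply_symm_apply _)

/-- The bracket at `x` is computed from the coordinate fields in the chart at `x`, so this is the
statement in the model space, where it comes from the symmetry of the second derivative. -/
theorem dirDeriv_lie {X Y : ∀ x : M, TangentSpace 𝓘(ℝ, E) x} (hX : SmoothVF X) (hY : SmoothVF Y)
    {f : M → ℝ} (hf : ContMDiff 𝓘(ℝ, E) 𝓘(ℝ, ℝ) ∞ f) (x : M) :
    dirDeriv (lie X Y) f x = dirDeriv X (dirDeriv Y f) x - dirDeriv Y (dirDeriv X f) x := by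
  have : IsManifold 𝓘(ℝ, E) 1 M := IsManifold.of_le (n := ∞) (by simp)
  have : IsManifold 𝓘(ℝ, E) 2 M := IsManifold.of_le (n := ∞) (by
    exact WithTop.coe_le_coe.2 (le_top : (2 : ℕ∞) ≤ ⊤))
  have hd : ∀ {Z : ∀ x : M, TangentSpace 𝓘(ℝ, E) x}, SmoothVF Z → DifferentiableAt ℝ
      (VectorField.mpullbackWithin 𝓘(ℝ, E) 𝓘(ℝ, E) (extChartAt 𝓘(ℝ, E) x).symm Z
        (Set.range 𝓘(ℝ, E))) (extChartAt 𝓘(ℝ, E) x x) := by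
    intro Z hZ
    have := ((hZ.mdifferentiableAt x).mdifferentiableWithinAt
      (s := Set.univ)).differentiableWithinAt_mpullbackWithin_vectorField
    rw [Set.preimage_univ, Set.univ_inter, modelWithCornersSelf_coe, Set.range_id] at this
    rw [modelWithCornersSelf_coe, Set.range_id]
    exact differentiableWithinAt_univ.1 this
  have hmem : (extChartAt 𝓘(ℝ, E) x).target ∈ nhds (extChartAt 𝓘(ℝ, E) x x) :=
    extChartAt_target_mem_nhds x
  have hf' : ContDiffAt ℝ ∞ (f ∘ (extChartAt 𝓘(ℝ, E) x).symm) (extChartAt 𝓘(ℝ, E) x x) := by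
    rw [← contMDiffAt_iff_contDiffAt]
    refine ContMDiffAt.comp _ (hf _) ?_
    exact (contMDiffOn_extChartAt_symm x).contMDiffAt hmem
  have key := VectorField.fderiv_apply_lieBracket hf' (by
    rw [minSmoothness_of_isRCLikeNormedField]
    exact WithTop.coe_le_coe.2 (le_top : (2 : ℕ∞) ≤ ⊤)) (hd hY) (hd hX)
  have hev : ∀ {Z W : ∀ x : M, TangentSpace 𝓘(ℝ, E) x}, SmoothVF Z → 
      fderiv ℝ (fun y => fderiv ℝ (f ∘ (extChartAt 𝓘(ℝ, E) x).symm) y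
        (VectorField.mpullbackWithin 𝓘(ℝ, E) 𝓘(ℝ, E) (extChartAt 𝓘(ℝ, E) x).symm Z
          (Set.range 𝓘(ℝ, E)) y)) (extChartAt 𝓘(ℝ, E) x x)
        (VectorField.mpullbackWithin 𝓘(ℝ, E) 𝓘(ℝ, E) (extChartAt 𝓘(ℝ, E) x).symm W
          (Set.range 𝓘(ℝ, E)) (extChartAt 𝓘(ℝ, E) x x)) = dirDeriv W (dirDeriv Z f) x := by
    intro Z W hZ
    have h1 := fderiv_comp_extChartAt_symm (hZ.dirDeriv hf) W x (mem_extChartAt_target x)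
    rw [extChartAt_to_inv] at h1
    rw [← h1]
    congr 1
    apply Filter.EventuallyEq.fderiv_eq
    filter_upwards [hmem] with y hy
    exact fderiv_comp_extChartAt_symm hf Z x hy
  rw [hev hY, hev hX] at key
  rw [← key]
  unfold dirDeriv
  rw [mfderiv_eq_fderiv_extChartAt (hf.mdifferentiable (by simp) x)]
  congr 1
  -- At its centre the chart has the identity as derivative, so bringing the coordinate bracket back
  -- to `M` changes nothing.
  simp only [lie, VectorField.mlieBracket, VectorField.mlieBracketWithin_apply,
    mfderiv_extChartAt_self]
  rw [Set.preimage_univ, Set.univ_inter, modelWithCornersSelf_coe, Set.range_id]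
  exact (DFunLike.congr_fun (ContinuousLinearMap.inverse_id (R := ℝ) (M := E)) _).trans
    (congrFun VectorField.lieBracketWithin_univ _)

end LieDerivation

/-! ### Vector fields related by a smooth map. -/

section Related

variable {E : Type*} [NormedAddCommGroup E] [NormedSpace ℝ E] [FiniteDimensional ℝ E]
  {M : Type*} [TopologicalSpace M] [ChartedSpace E M] [IsManifold 𝓘(ℝ, E) ∞ M]
  {E' : Type*} [NormedAddCommGroup E'] [NormedSpace ℝ E'] [FiniteDimensional ℝ E']
  {N : Type*} [TopologicalSpace N] [T2Space N] [ChartedSpace E' N] [IsManifold 𝓘(ℝ, E') ∞ N]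

/-- Tangent vectors are determined by the derivatives of smooth functions along them. -/
theorem eq_of_forall_mfderiv_eq {x : N} {v w : TangentSpace 𝓘(ℝ, E') x}
    (h : ∀ f : N → ℝ, ContMDiff 𝓘(ℝ, E') 𝓘(ℝ, ℝ) ∞ f →
      mfderiv 𝓘(ℝ, E') 𝓘(ℝ, ℝ) f x v = mfderiv 𝓘(ℝ, E') 𝓘(ℝ, ℝ) f x w) : v = w := by
  have : IsManifold 𝓘(ℝ, E') 1 N := IsManifold.of_le (n := ∞) (by simp)
  -- The chart cut off by `ψ` is globally smooth with identity derivative at `x`; its composites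
  -- with linear functionals separate tangent vectors.
  let ψ : SmoothBumpFunction 𝓘(ℝ, E') x := Classical.arbitrary _
  have hF : ContMDiff 𝓘(ℝ, E') 𝓘(ℝ, E') ∞ (fun y => ψ y • extChartAt 𝓘(ℝ, E') x y) :=
    ψ.contMDiff_smul contMDiffOn_extChartAt
  have hF' : mfderiv 𝓘(ℝ, E') 𝓘(ℝ, E') (fun y => ψ y • extChartAt 𝓘(ℝ, E') x y) x
      = ContinuousLinearMap.id ℝ E' := by
    have : (fun y => ψ y • extChartAt 𝓘(ℝ, E') x y) =ᶠ[nhds x] extChartAt 𝓘(ℝ, E') x := by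
      filter_upwards [ψ.eventuallyEq_one] with y hy
      simp [hy]
    rw [this.mfderiv_eq, mfderiv_extChartAt_self]
    rfl
  have key : ∀ (ℓ : E' →L[ℝ] ℝ) (u : TangentSpace 𝓘(ℝ, E') x),
      mfderiv 𝓘(ℝ, E') 𝓘(ℝ, ℝ) (ℓ ∘ fun y => ψ y • extChartAt 𝓘(ℝ, E') x y) x u = ℓ u := by
    intro ℓ u
    rw [mfderiv_comp x ℓ.mdifferentiableAt (hF.mdifferentiable (by simp) x), hF',
      ContinuousLinearMap.mfderiv_eq]
    rfl
  by_contra hne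
  obtain ⟨ℓ, hℓ⟩ := SeparatingDual.exists_separating_of_ne (R := ℝ) (V := E') hne
  have := h (ℓ ∘ fun y => ψ y • extChartAt 𝓘(ℝ, E') x y) (ℓ.contMDiff.comp hF)
  rw [key, key] at this
  exact hℓ this

theorem dirDeriv_comp {f : M → N} (hf : ContMDiff 𝓘(ℝ, E) 𝓘(ℝ, E') ∞ f)
    {X : ∀ x : M, TangentSpace 𝓘(ℝ, E) x} {Y : ∀ x : N, TangentSpace 𝓘(ℝ, E') x} {x : M}
    (hXY : mfderiv 𝓘(ℝ, E) 𝓘(ℝ, E') f x (X x) = Y (f x))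
    {h : N → ℝ} (hh : ContMDiff 𝓘(ℝ, E') 𝓘(ℝ, ℝ) ∞ h) :
    dirDeriv X (fun x => h (f x)) x = dirDeriv Y h (f x) := by
  unfold dirDeriv
  rw [← hXY]
  exact mfderiv_comp_apply x (hh.mdifferentiable (by simp) _) (hf.mdifferentiable (by simp) x) _

/-- The Lie brackets of `f`-related vector fields are `f`-related. -/
theorem mfderiv_lie {f : M → N} (hf : ContMDiff 𝓘(ℝ, E) 𝓘(ℝ, E') ∞ f)
    {X₁ X₂ : ∀ x : M, TangentSpace 𝓘(ℝ, E) x} {Y₁ Y₂ : ∀ x : N, TangentSpace 𝓘(ℝ, E') x}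
    (hX₁ : SmoothVF X₁) (hX₂ : SmoothVF X₂) (hY₁ : SmoothVF Y₁) (hY₂ : SmoothVF Y₂)
    (h₁ : ∀ x, mfderiv 𝓘(ℝ, E) 𝓘(ℝ, E') f x (X₁ x) = Y₁ (f x))
    (h₂ : ∀ x, mfderiv 𝓘(ℝ, E) 𝓘(ℝ, E') f x (X₂ x) = Y₂ (f x)) (x : M) :
    mfderiv 𝓘(ℝ, E) 𝓘(ℝ, E') f x (lie X₁ X₂ x) = lie Y₁ Y₂ (f x) := by
  -- Tested on a function, both brackets become commutators of iterated derivatives, and relatedness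
  -- turns each derivative of `h ∘ f` into a derivative of `h`.
  refine eq_of_forall_mfderiv_eq fun h hh => ?_
  have e1 : mfderiv 𝓘(ℝ, E') 𝓘(ℝ, ℝ) h (f x) (mfderiv 𝓘(ℝ, E) 𝓘(ℝ, E') f x (lie X₁ X₂ x))
      = dirDeriv (lie X₁ X₂) (fun x => h (f x)) x :=
    (mfderiv_comp_apply x (hh.mdifferentiable (by simp) _)
      (hf.mdifferentiable (by simp) x) _).symm
  have e2 : mfderiv 𝓘(ℝ, E') 𝓘(ℝ, ℝ) h (f x) (lie Y₁ Y₂ (f x)) = dirDeriv (lie Y₁ Y₂) h (f x) := rfl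
  have e3 : dirDeriv X₁ (fun x => h (f x)) = fun x => dirDeriv Y₁ h (f x) :=
    funext fun y => dirDeriv_comp hf (h₁ y) hh
  have e4 : dirDeriv X₂ (fun x => h (f x)) = fun x => dirDeriv Y₂ h (f x) :=
    funext fun y => dirDeriv_comp hf (h₂ y) hh
  rw [e1, e2, dirDeriv_lie (f := fun x => h (f x)) hX₁ hX₂ (hh.comp hf), dirDeriv_lie hY₁ hY₂ hh, e3, e4,
    dirDeriv_comp hf (h₁ x) (hY₂.dirDeriv hh), dirDeriv_comp hf (h₂ x) (hY₁.dirDeriv hh)]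

end Related

/-! ### Linear systems with smooth coefficients. -/

section LinearSystem

variable {E : Type*} [NormedAddCommGroup E] [NormedSpace ℝ E]
  {M : Type*} [TopologicalSpace M] [ChartedSpace E M]
  {ι : Type*} [Fintype ι] [DecidableEq ι]

theorem contMDiffAt_det {A : M → Matrix ι ι ℝ} {x : M}
    (hA : ∀ i j, ContMDiffAt 𝓘(ℝ, E) 𝓘(ℝ, ℝ) ∞ (fun y => A y i j) x) :
    ContMDiffAt 𝓘(ℝ, E) 𝓘(ℝ, ℝ) ∞ (fun y => (A y).det) x := by
  simp only [Matrix.det_apply']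
  refine contMDiffAt_finsetSum fun σ _ => contMDiffAt_const.mul ?_
  exact contMDiffAt_finsetProd fun i _ => hA _ _

/-- The solution of a linear system with smooth coefficients is smooth. -/
theorem contMDiffAt_of_linear_system {A : M → Matrix ι ι ℝ} {f b : ι → M → ℝ} {x : M}
    (hA : ∀ i j, ContMDiffAt 𝓘(ℝ, E) 𝓘(ℝ, ℝ) ∞ (fun y => A y i j) x)
    (hb : ∀ i, ContMDiffAt 𝓘(ℝ, E) 𝓘(ℝ, ℝ) ∞ (b i) x) (hdet : (A x).det ≠ 0)
    (h : ∀ᶠ y in nhds x, ∀ i, ∑ j, A y i j * f j y = b i y) (j : ι) :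
    ContMDiffAt 𝓘(ℝ, E) 𝓘(ℝ, ℝ) ∞ (f j) x := by
  have hD := contMDiffAt_det hA
  have hadj : ∀ i k, ContMDiffAt 𝓘(ℝ, E) 𝓘(ℝ, ℝ) ∞ (fun y => (A y).adjugate i k) x := by
    intro i k
    simp only [Matrix.adjugate_apply]
    refine contMDiffAt_det fun a c => ?_
    by_cases hak : a = k
    · subst hak
      simp only [Matrix.updateRow_self]
      exact contMDiffAt_const
    · simp only [Matrix.updateRow_ne hak]
      exact hA a c
  -- Cramer's rule: near `x` any pointwise solution coincides with this smooth function, so no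
  -- regularity of `f` is assumed beforehand.
  have hg : ContMDiffAt 𝓘(ℝ, E) 𝓘(ℝ, ℝ) ∞
      (fun y => (∑ k, (A y).adjugate j k * b k y) * ((A y).det)⁻¹) x := by
    refine (contMDiffAt_finsetSum fun k _ => (hadj j k).mul (hb k)).mul ?_
    exact hD.inv₀ hdet
  refine hg.congr_of_eventuallyEq ?_
  filter_upwards [h, hD.continuousAt.eventually_ne hdet] with y hy hy'
  have h1 : (A y).mulVec (fun j => f j y) = fun i => b i y := funext hy
  have h2 := congrArg (fun v => (A y).adjugate.mulVec v j) h1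
  simp only [Matrix.mulVec_mulVec, Matrix.adjugate_mul, Matrix.smul_mulVec, Matrix.one_mulVec,
    Pi.smul_apply, smul_eq_mul] at h2
  rw [eq_mul_inv_iff_mul_eq₀ hy', mul_comm, h2]
  rfl

end LinearSystem

/-! ### Curves with prescribed velocity, and mixed partial derivatives. -/

section Curves

variable {E : Type*} [NormedAddCommGroup E] [NormedSpace ℝ E]
  {M : Type*} [TopologicalSpace M] [ChartedSpace E M] [IsManifold 𝓘(ℝ, E) ∞ M]

/-- A straight line in the chart at `x`, whose inverse has identity derivative at the centre. Only
the germ at `0` is meaningful, since the line may leave the chart. Such curves replace flows and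
one-parameter subgroups below. -/
theorem exists_curve (x : M) (v : E) :
    ∃ γ : ℝ → M, γ 0 = x ∧ ContMDiffAt 𝓘(ℝ, ℝ) 𝓘(ℝ, E) ∞ γ 0 ∧
      (mfderiv 𝓘(ℝ, ℝ) 𝓘(ℝ, E) γ 0 (1 : ℝ) : E) = v := by
  have : IsManifold 𝓘(ℝ, E) 1 M := IsManifold.of_le (n := ∞) (by simp)
  let c : ℝ → E := fun t => extChartAt 𝓘(ℝ, E) x x + t • v
  have hc0 : c 0 = extChartAt 𝓘(ℝ, E) x x := by simp [c]
  have hc : ContDiff ℝ ∞ c := by fun_prop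
  have hc' : HasDerivAt c v 0 := by
    have := ((hasDerivAt_id (0 : ℝ)).smul_const v).const_add (extChartAt 𝓘(ℝ, E) x x)
    exact this.congr_deriv (one_smul ℝ v)
  have hs : ContMDiffAt 𝓘(ℝ, E) 𝓘(ℝ, E) ∞ (extChartAt 𝓘(ℝ, E) x).symm (c 0) := by
    rw [hc0]
    exact (contMDiffOn_extChartAt_symm x).contMDiffAt (extChartAt_target_mem_nhds x)
  refine ⟨(extChartAt 𝓘(ℝ, E) x).symm ∘ c, by simp [c],
    hs.comp 0 hc.contMDiff.contMDiffAt, ?_⟩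
  rw [mfderiv_comp 0 (hs.mdifferentiableAt (by simp))
    (hc.contMDiff.contMDiffAt.mdifferentiableAt (by simp))]
  have h1 : ∀ y, y = extChartAt 𝓘(ℝ, E) x x →
      (mfderiv 𝓘(ℝ, E) 𝓘(ℝ, E) (extChartAt 𝓘(ℝ, E) x).symm y : E →L[ℝ] E)
        = ContinuousLinearMap.id ℝ E := by
    rintro _ rfl
    have := mfderivWithin_range_extChartAt_symm (I := 𝓘(ℝ, E)) (x := x)
    rw [modelWithCornersSelf_coe, Set.range_id, mfderivWithin_univ] at this
    exact this
  have h2 : (mfderiv 𝓘(ℝ, ℝ) 𝓘(ℝ, E) c 0 : ℝ →L[ℝ] E) 1 = v := by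
    rw [mfderiv_eq_fderiv]
    exact hc'.deriv
  refine (DFunLike.congr_fun (h1 _ hc0) _).trans ?_
  exact h2

/-- Symmetry of the second derivative, written with one-variable derivatives along the axes; it
plays the role of commuting flows in `IsPrincipalBundle.lie_fundamentalVF_eq_zero`. -/
theorem deriv_deriv_comm {F : ℝ × ℝ → ℝ} (hF : ContDiffAt ℝ 2 F (0, 0)) :
    deriv (fun s => deriv (fun t => F (s, t)) 0) 0
      = deriv (fun t => deriv (fun s => F (s, t)) 0) 0 := by
  have hd : ∀ᶠ y in nhds ((0 : ℝ), (0 : ℝ)), DifferentiableAt ℝ F y := by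
    filter_upwards [hF.eventually (by simp)] with y hy
    exact hy.differentiableAt (by simp)
  have hd2 : DifferentiableAt ℝ (fderiv ℝ F) (0, 0) :=
    (hF.fderiv_right (m := 1) le_rfl).differentiableAt (by simp)
  have hsymm := hF.isSymmSndFDerivAt (by simp)
  have h1 : ∀ᶠ s in nhds (0 : ℝ), deriv (fun t => F (s, t)) 0 = fderiv ℝ F (s, 0) (0, 1) := by
    have hc : ContinuousAt (fun s : ℝ => (s, (0 : ℝ))) 0 := by fun_prop
    filter_upwards [hc.eventually hd] with s hs
    have := hs.hasFDerivAt.comp_hasDerivAt (0 : ℝ)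
      ((hasDerivAt_const (0 : ℝ) s).prodMk (hasDerivAt_id (0 : ℝ)))
    exact this.deriv
  have h2 : ∀ᶠ t in nhds (0 : ℝ), deriv (fun s => F (s, t)) 0 = fderiv ℝ F (0, t) (1, 0) := by
    have hc : ContinuousAt (fun t : ℝ => ((0 : ℝ), t)) 0 := by fun_prop
    filter_upwards [hc.eventually hd] with t ht
    have := ht.hasFDerivAt.comp_hasDerivAt (0 : ℝ)
      ((hasDerivAt_id (0 : ℝ)).prodMk (hasDerivAt_const (0 : ℝ) t))
    exact this.deriv
  rw [Filter.EventuallyEq.deriv_eq h1, Filter.EventuallyEq.deriv_eq h2]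
  have h3 : HasDerivAt (fun s : ℝ => fderiv ℝ F (s, 0) (0, 1))
      (fderiv ℝ (fderiv ℝ F) (0, 0) (1, 0) (0, 1)) 0 := by
    have := HasFDerivAt.comp_hasDerivAt (f := fun s : ℝ => (s, (0 : ℝ))) (0 : ℝ) hd2.hasFDerivAt
      ((hasDerivAt_id (0 : ℝ)).prodMk (hasDerivAt_const (0 : ℝ) (0 : ℝ)))
    exact this.clm_apply (hasDerivAt_const (0 : ℝ) ((0 : ℝ), (1 : ℝ))) |>.congr_deriv (by simp)
  have h4 : HasDerivAt (fun t : ℝ => fderiv ℝ F (0, t) (1, 0))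
      (fderiv ℝ (fderiv ℝ F) (0, 0) (0, 1) (1, 0)) 0 := by
    have := HasFDerivAt.comp_hasDerivAt (f := fun t : ℝ => ((0 : ℝ), t)) (0 : ℝ) hd2.hasFDerivAt
      ((hasDerivAt_const (0 : ℝ) (0 : ℝ)).prodMk (hasDerivAt_id (0 : ℝ)))
    exact this.clm_apply (hasDerivAt_const (0 : ℝ) ((1 : ℝ), (0 : ℝ))) |>.congr_deriv (by simp)
  rw [h3.deriv, h4.deriv, hsymm]

theorem deriv_comp_curve {f : M → ℝ} (hf : ContMDiff 𝓘(ℝ, E) 𝓘(ℝ, ℝ) ∞ f) {γ : ℝ → M}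
    (hγ : ContMDiffAt 𝓘(ℝ, ℝ) 𝓘(ℝ, E) ∞ γ 0) {x : M} (hx : γ 0 = x) {v : TangentSpace 𝓘(ℝ, E) x}
    (hv : (mfderiv 𝓘(ℝ, ℝ) 𝓘(ℝ, E) γ 0 (1 : ℝ) : E) = v) :
    deriv (fun t => f (γ t)) 0 = mfderiv 𝓘(ℝ, E) 𝓘(ℝ, ℝ) f x v := by
  subst hx
  rw [← fderiv_apply_one_eq_deriv, ← mfderiv_eq_fderiv]
  refine (mfderiv_comp_apply (0 : ℝ) (hf.mdifferentiable (by simp) _)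
    (hγ.mdifferentiableAt (by simp)) _).trans ?_
  exact congrArg _ hv

end Curves

/-! ### Local structure of principal bundles. -/

section Principal

variable {EM : Type*} [NormedAddCommGroup EM] [NormedSpace ℝ EM] [FiniteDimensional ℝ EM]
  {M : Type*} [TopologicalSpace M] [T2Space M] [ChartedSpace EM M] [IsManifold 𝓘(ℝ, EM) ∞ M]
  {EG : Type*} [NormedAddCommGroup EG] [NormedSpace ℝ EG] [FiniteDimensional ℝ EG]
  {G : Type*} [TopologicalSpace G] [ChartedSpace EG G] [Group G] [LieGroup 𝓘(ℝ, EG) ∞ G]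
  {EP : Type*} [NormedAddCommGroup EP] [NormedSpace ℝ EP] [FiniteDimensional ℝ EP]
  {P : Type*} [TopologicalSpace P] [T2Space P] [ChartedSpace EP P] [IsManifold 𝓘(ℝ, EP) ∞ P]
  [MulAction Gᵐᵒᵖ P] {p : P → M}

namespace IsPrincipalBundle

/-- In a trivialization, keep the group coordinate of `q` fixed. -/
theorem exists_local_section (hp : IsPrincipalBundle EM EG EP G p) (q : P) :
    ∃ σ : M → P, ContMDiffAt 𝓘(ℝ, EM) 𝓘(ℝ, EP) ∞ σ (p q) ∧ σ (p q) = q ∧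
      ∀ᶠ y in nhds (p q), p (σ y) = y := by
  obtain ⟨U, φ, hU, hxU, hsrc, htgt, hφ, hφs, h1, h2⟩ := hp.locally_trivial (p q)
  have hq : q ∈ φ.source := by rw [hsrc]; exact hxU
  refine ⟨fun y => φ.symm (y, (φ q).2), ?_, ?_, ?_⟩
  · have h3 : ContMDiffAt ((𝓘(ℝ, EM)).prod 𝓘(ℝ, EG)) 𝓘(ℝ, EP) ∞ φ.symm (p q, (φ q).2) := by
      refine hφs.contMDiffAt (φ.open_target.mem_nhds ?_)
      rw [htgt]; exact ⟨hxU, trivial⟩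
    exact h3.comp (p q) (contMDiffAt_id.prodMk contMDiffAt_const)
  · have : (p q, (φ q).2) = φ q := by rw [← h1 q hq]
    simp only [this]
    exact φ.left_inv hq
  · filter_upwards [hU.mem_nhds hxU] with y hy
    have hy' : (y, (φ q).2) ∈ φ.target := by rw [htgt]; exact ⟨hy, trivial⟩
    rw [← h1 _ (φ.map_target hy'), φ.right_inv hy']

theorem surjective (hp : IsPrincipalBundle EM EG EP G p) : Function.Surjective p := by
  intro x
  obtain ⟨U, φ, hU, hxU, hsrc, htgt, hφ, hφs, h1, h2⟩ := hp.locally_trivial x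
  have hy' : (x, (1 : G)) ∈ φ.target := by rw [htgt]; exact ⟨hxU, trivial⟩
  exact ⟨φ.symm (x, 1), by rw [← h1 _ (φ.map_target hy'), φ.right_inv hy']⟩

/-- Inside one trivialization two points of a fibre differ by right multiplication on the group
coordinate, so `(φ q).2⁻¹ * (φ q').2` translates one into the other. -/
theorem exists_act_eq (hp : IsPrincipalBundle EM EG EP G p) {q q' : P} (h : p q = p q') :
    ∃ g : G, MulOpposite.op g • q = q' := by
  obtain ⟨U, φ, hU, hxU, hsrc, htgt, hφ, hφs, h1, h2⟩ := hp.locally_trivial (p q)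
  have hq : q ∈ φ.source := by rw [hsrc]; exact hxU
  have hq' : q' ∈ φ.source := by rw [hsrc, Set.mem_preimage, ← h]; exact hxU
  refine ⟨(φ q).2⁻¹ * (φ q').2, ?_⟩
  have hqg : MulOpposite.op ((φ q).2⁻¹ * (φ q').2) • q ∈ φ.source := by
    rw [hsrc, Set.mem_preimage, hp.proj_act]; exact hxU
  refine φ.injOn hqg hq' (Prod.ext ?_ ?_)
  · rw [h1 _ hqg, h1 _ hq', hp.proj_act, h]
  · rw [h2 q hq]; group

/-- Locally `h` is `(h ∘ p) ∘ σ` for a smooth local section `σ`. Smoothness of objects on `M` is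
checked after pulling back to `P` in this way. -/
theorem contMDiff_of_comp (hp : IsPrincipalBundle EM EG EP G p)
    {E' : Type*} [NormedAddCommGroup E'] [NormedSpace ℝ E'] {H' : Type*} [TopologicalSpace H']
    {I' : ModelWithCorners ℝ E' H'} {N : Type*} [TopologicalSpace N] [ChartedSpace H' N]
    {h : M → N} (hh : ContMDiff 𝓘(ℝ, EP) I' ∞ (fun q => h (p q))) :
    ContMDiff 𝓘(ℝ, EM) I' ∞ h := by
  intro x
  obtain ⟨q, rfl⟩ := hp.surjective x
  obtain ⟨σ, hσ, hσq, hpσ⟩ := hp.exists_local_section q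
  have := (hh (σ (p q))).comp (p q) hσ
  refine this.congr_of_eventuallyEq ?_
  filter_upwards [hpσ] with y hy
  simp [hy]

theorem mfderiv_surjective (hp : IsPrincipalBundle EM EG EP G p) (q : P) :
    Function.Surjective (mfderiv 𝓘(ℝ, EP) 𝓘(ℝ, EM) p q) := by
  obtain ⟨σ, hσ, hσq, hpσ⟩ := hp.exists_local_section q
  intro v
  have h1 : mfderiv 𝓘(ℝ, EM) 𝓘(ℝ, EM) (p ∘ σ) (p q) = ContinuousLinearMap.id ℝ EM := by
    have hpσ' : p ∘ σ =ᶠ[nhds (p q)] id := hpσ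
    rw [hpσ'.mfderiv_eq]
    exact mfderiv_id
  rw [mfderiv_comp (p q) (hp.smooth_proj.mdifferentiable (by simp) _)
    (hσ.mdifferentiableAt (by simp))] at h1
  -- The chain rule differentiates at `σ (p q)`, which equals `q` only propositionally; all tangent
  -- spaces are the model space, and the derivatives are compared there. The same device is used for
  -- `q · 1 = q`.
  have h2 : ∀ q', q' = q → (mfderiv 𝓘(ℝ, EP) 𝓘(ℝ, EM) p q' : EP →L[ℝ] EM)
      = mfderiv 𝓘(ℝ, EP) 𝓘(ℝ, EM) p q := by rintro _ rfl; rfl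
  refine ⟨(mfderiv 𝓘(ℝ, EM) 𝓘(ℝ, EP) σ (p q) v : EP), ?_⟩
  refine (DFunLike.congr_fun (h2 (σ (p q)) hσq) _).symm.trans ?_
  exact DFunLike.congr_fun h1 v

theorem contMDiff_act (hp : IsPrincipalBundle EM EG EP G p) (g : G) :
    ContMDiff 𝓘(ℝ, EP) 𝓘(ℝ, EP) ∞ (fun q : P => MulOpposite.op g • q) :=
  hp.smooth_act.comp (contMDiff_id.prodMk contMDiff_const)

theorem contMDiff_orbit (hp : IsPrincipalBundle EM EG EP G p) (q : P) :
    ContMDiff 𝓘(ℝ, EG) 𝓘(ℝ, EP) ∞ (fun h : G => MulOpposite.op h • q) :=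
  hp.smooth_act.comp (contMDiff_const.prodMk contMDiff_id)

theorem mfderiv_dR (hp : IsPrincipalBundle EM EG EP G p) (g : G) (q : P)
    (v : TangentSpace 𝓘(ℝ, EP) q) :
    (mfderiv 𝓘(ℝ, EP) 𝓘(ℝ, EM) p (MulOpposite.op g • q) (dR g q v) : EM)
      = mfderiv 𝓘(ℝ, EP) 𝓘(ℝ, EM) p q v := by
  have h := mfderiv_comp_apply q (hp.smooth_proj.mdifferentiable (by simp) _)
    ((hp.contMDiff_act g).mdifferentiable (by simp) q) v
  refine h.symm.trans ?_
  have : (p ∘ fun q : P => MulOpposite.op g • q) = p := funext fun q => hp.proj_act g q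
  rw [this]

theorem mfderiv_fundamentalVF (hp : IsPrincipalBundle EM EG EP G p)
    (z : GroupLieAlgebra 𝓘(ℝ, EG) G) (q : P) :
    mfderiv 𝓘(ℝ, EP) 𝓘(ℝ, EM) p q (fundamentalVF z q) = 0 := by
  have h := mfderiv_comp_apply (1 : G) (hp.smooth_proj.mdifferentiable (by simp) _)
    ((hp.contMDiff_orbit q).mdifferentiable (by simp) 1) z
  have h0 : (p ∘ fun h : G => MulOpposite.op h • q) = fun _ => p q :=
    funext fun g => hp.proj_act g q
  rw [h0, mfderiv_const] at h
  have h2 : ∀ q', q' = q → (mfderiv 𝓘(ℝ, EP) 𝓘(ℝ, EM) p q' : EP →L[ℝ] EM)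
      = mfderiv 𝓘(ℝ, EP) 𝓘(ℝ, EM) p q := by rintro _ rfl; rfl
  refine (DFunLike.congr_fun (h2 (MulOpposite.op (1 : G) • q) (one_smul Gᵐᵒᵖ q)) _).symm.trans ?_
  exact h.symm

/-- A local map to `G` that inverts the orbit map of `q`; it identifies the vertical vectors at `q`
with the Lie algebra. -/
theorem exists_retraction (hp : IsPrincipalBundle EM EG EP G p) (q : P) :
    ∃ N : P → G, ContMDiffAt 𝓘(ℝ, EP) 𝓘(ℝ, EG) ∞ N q ∧ (∀ h, N (MulOpposite.op h • q) = h) ∧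
      ∀ v : TangentSpace 𝓘(ℝ, EP) q, mfderiv 𝓘(ℝ, EP) 𝓘(ℝ, EM) p q v = 0 →
        fundamentalVF (G := G) (EG := EG) (mfderiv 𝓘(ℝ, EP) 𝓘(ℝ, EG) N q v : EG) q = v := by
  obtain ⟨U, φ, hU, hxU, hsrc, htgt, hφ, hφs, h1, h2⟩ := hp.locally_trivial (p q)
  have hq : q ∈ φ.source := by rw [hsrc]; exact hxU
  have hφq : ContMDiffAt 𝓘(ℝ, EP) ((𝓘(ℝ, EM)).prod 𝓘(ℝ, EG)) ∞ φ q :=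
    hφ.contMDiffAt (φ.open_source.mem_nhds hq)
  have hφ2 : ContMDiffAt 𝓘(ℝ, EP) 𝓘(ℝ, EG) ∞ (fun q' => (φ q').2) q :=
    contMDiffAt_snd.comp q hφq
  -- The group coordinate, normalised to be `1` at `q`.
  let N : P → G := fun q' => (φ q).2⁻¹ * (φ q').2
  have hN : ContMDiffAt 𝓘(ℝ, EP) 𝓘(ℝ, EG) ∞ N q :=
    (contMDiff_mul_left (I := 𝓘(ℝ, EG)) (n := ∞) (a := (φ q).2⁻¹)).contMDiffAt.comp q hφ2
  have hN1 : N q = 1 := by simp [N]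
  refine ⟨N, hN, fun h => by simp [N, h2 q hq h], fun v hv => ?_⟩
  have hs : ContMDiffAt ((𝓘(ℝ, EM)).prod 𝓘(ℝ, EG)) 𝓘(ℝ, EP) ∞ φ.symm (p q, (φ q).2) := by
    refine hφs.contMDiffAt (φ.open_target.mem_nhds ?_)
    rw [htgt]; exact ⟨hxU, trivial⟩
  -- The point `q · N(q')` has the base coordinate of `q` and the group coordinate of `q'`. It
  -- differs from `q'` only in the base coordinate, whose derivative kills the vertical vector `v`;
  -- so on `v` the map `q' ↦ q · N(q')` has the derivative of the identity.
  have hev : (fun q' => MulOpposite.op (N q') • q) = fun q' => φ.symm (p q, (φ q').2) := by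
    funext q'
    have hm : MulOpposite.op (N q') • q ∈ φ.source := by
      rw [hsrc, Set.mem_preimage, hp.proj_act]; exact hxU
    rw [← φ.left_inv hm]
    congr 1
    refine Prod.ext ?_ ?_
    · rw [h1 _ hm, hp.proj_act]
    · rw [h2 q hq]; simp [N]
  have hid : (fun q' => φ.symm (p q', (φ q').2)) =ᶠ[nhds q] id := by
    filter_upwards [φ.open_source.mem_nhds hq] with q' hq'
    rw [← h1 q' hq']
    exact φ.left_inv hq'
  have e1 := mfderiv_comp_apply (I'' := 𝓘(ℝ, EP)) (g := fun h : G => MulOpposite.op h • q) q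
    ((hp.contMDiff_orbit q).mdifferentiable (by simp) _) (hN.mdifferentiableAt (by simp)) v
  have e2 := mfderiv_comp_apply (I' := (𝓘(ℝ, EM)).prod 𝓘(ℝ, EG)) (g := φ.symm)
    (f := fun q' => (p q, (φ q').2)) q (hs.mdifferentiableAt (by simp))
    ((contMDiffAt_const.prodMk hφ2).mdifferentiableAt (by simp)) v
  have e3 := mfderiv_comp_apply (I' := (𝓘(ℝ, EM)).prod 𝓘(ℝ, EG)) (g := φ.symm)
    (f := fun q' => (p q', (φ q').2)) q (hs.mdifferentiableAt (by simp))
    ((hp.smooth_proj.contMDiffAt.prodMk hφ2).mdifferentiableAt (by simp)) v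
  have e4 : mfderiv 𝓘(ℝ, EP) 𝓘(ℝ, EP) (φ.symm ∘ fun q' => (p q', (φ q').2)) q v = v := by
    have hid' : (φ.symm ∘ fun q' => (p q', (φ q').2)) =ᶠ[nhds q] id := hid
    rw [hid'.mfderiv_eq, mfderiv_id]; rfl
  rw [mfderiv_prodMk (hp.smooth_proj.mdifferentiable (by simp) _)
    (hφ2.mdifferentiableAt (by simp))] at e3
  rw [mfderiv_prodMk mdifferentiableAt_const (hφ2.mdifferentiableAt (by simp)),
    mfderiv_const] at e2
  have e5 : mfderiv 𝓘(ℝ, EP) 𝓘(ℝ, EP) ((fun h : G => MulOpposite.op h • q) ∘ N) q v = v := by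
    have : ((fun h : G => MulOpposite.op h • q) ∘ N) = φ.symm ∘ fun q' => (p q, (φ q').2) := hev
    rw [this]
    refine e2.trans (Eq.trans ?_ (e3.symm.trans e4))
    refine congrArg _ ?_
    exact Prod.ext hv.symm rfl
  have h2 : ∀ g : G, g = 1 → (mfderiv 𝓘(ℝ, EG) 𝓘(ℝ, EP) (fun h : G => MulOpposite.op h • q) g
      : EG →L[ℝ] EP) = mfderiv 𝓘(ℝ, EG) 𝓘(ℝ, EP) (fun h : G => MulOpposite.op h • q) 1 := by
    rintro _ rfl; rfl
  exact (DFunLike.congr_fun (h2 (N q) hN1) _).symm.trans (e1.symm.trans e5)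

/-- The retraction is a left inverse of the orbit map, hence its derivative is a left inverse of `z
↦ Y_z(q)`. -/
theorem fundamentalVF_injective (hp : IsPrincipalBundle EM EG EP G p) (q : P) :
    Function.Injective fun z : GroupLieAlgebra 𝓘(ℝ, EG) G => (fundamentalVF z q : EP) := by
  obtain ⟨N, hN, h1, -⟩ := hp.exists_retraction q
  have hN' : ContMDiffAt 𝓘(ℝ, EP) 𝓘(ℝ, EG) ∞ N (MulOpposite.op (1 : G) • q) := by
    rw [MulOpposite.op_one, one_smul]; exact hN
  have hid : (N ∘ fun h : G => MulOpposite.op h • q) = id := funext h1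
  have h2 : ∀ z : GroupLieAlgebra 𝓘(ℝ, EG) G,
      (mfderiv 𝓘(ℝ, EP) 𝓘(ℝ, EG) N (MulOpposite.op (1 : G) • q) : EP →L[ℝ] EG)
        (fundamentalVF z q) = z := by
    intro z
    have h := mfderiv_comp_apply (1 : G) (hN'.mdifferentiableAt (by simp))
      ((hp.contMDiff_orbit q).mdifferentiable (by simp) 1) z
    rw [hid, mfderiv_id] at h
    exact h.symm
  intro z w hzw
  rw [← h2 z, ← h2 w]
  exact congrArg _ hzw

theorem exists_fundamentalVF_eq (hp : IsPrincipalBundle EM EG EP G p) {q : P}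
    {v : TangentSpace 𝓘(ℝ, EP) q} (hv : mfderiv 𝓘(ℝ, EP) 𝓘(ℝ, EM) p q v = 0) :
    ∃ z : GroupLieAlgebra 𝓘(ℝ, EG) G, fundamentalVF z q = v := by
  obtain ⟨N, -, -, h⟩ := hp.exists_retraction q
  exact ⟨_, h v hv⟩

end IsPrincipalBundle
end Principal

/-! ### Fundamental vector fields. -/

section Principal

variable {EM : Type*} [NormedAddCommGroup EM] [NormedSpace ℝ EM] [FiniteDimensional ℝ EM]
  {M : Type*} [TopologicalSpace M] [T2Space M] [ChartedSpace EM M] [IsManifold 𝓘(ℝ, EM) ∞ M]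
  {EG : Type*} [NormedAddCommGroup EG] [NormedSpace ℝ EG] [FiniteDimensional ℝ EG]
  {G : Type*} [TopologicalSpace G] [ChartedSpace EG G] [Group G] [LieGroup 𝓘(ℝ, EG) ∞ G]
  {EP : Type*} [NormedAddCommGroup EP] [NormedSpace ℝ EP] [FiniteDimensional ℝ EP]
  {P : Type*} [TopologicalSpace P] [T2Space P] [ChartedSpace EP P] [IsManifold 𝓘(ℝ, EP) ∞ P]
  [MulAction Gᵐᵒᵖ P] {p : P → M}

theorem fundamentalVF_add (z w : GroupLieAlgebra 𝓘(ℝ, EG) G) (q : P) :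
    (fundamentalVF (z + w) q : TangentSpace 𝓘(ℝ, EP) q) = fundamentalVF z q + fundamentalVF w q :=
  map_add (mfderiv 𝓘(ℝ, EG) 𝓘(ℝ, EP) (fun h : G => MulOpposite.op h • q) 1 : EG →L[ℝ] EP) z w

theorem fundamentalVF_smul (a : ℝ) (z : GroupLieAlgebra 𝓘(ℝ, EG) G) (q : P) :
    (fundamentalVF (a • z) q : TangentSpace 𝓘(ℝ, EP) q) = a • fundamentalVF z q :=
  map_smul (mfderiv 𝓘(ℝ, EG) 𝓘(ℝ, EP) (fun h : G => MulOpposite.op h • q) 1 : EG →L[ℝ] EP) a z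

namespace IsPrincipalBundle

/-- The field is the tangent map of the action evaluated on the smooth pair of the zero vector at
`q` and the vector `z` at `1`. -/
theorem smoothVF_fundamentalVF (hp : IsPrincipalBundle EM EG EP G p)
    (z : GroupLieAlgebra 𝓘(ℝ, EG) G) :
    SmoothVF (fun q : P => (fundamentalVF z q : TangentSpace 𝓘(ℝ, EP) q)) := by
  have : IsManifold 𝓘(ℝ, EG) ∞ G := LieGroup.toContMDiffMul.toIsManifold
  have sfg : ContMDiff 𝓘(ℝ, EP) (𝓘(ℝ, EP)).tangent ∞
      (fun q : P => (⟨q, 0⟩ : TangentBundle 𝓘(ℝ, EP) P)) :=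
    Bundle.contMDiff_zeroSection ℝ (TangentSpace 𝓘(ℝ, EP) : P → Type _)
  have sfv : ContMDiff 𝓘(ℝ, EP) (𝓘(ℝ, EG)).tangent ∞
      (fun _ : P => (⟨1, z⟩ : TangentBundle 𝓘(ℝ, EG) G)) := contMDiff_const
  have S₂ := contMDiff_equivTangentBundleProd_symm (n := ∞) (I := 𝓘(ℝ, EP)) (M := P)
    (I' := 𝓘(ℝ, EG)) (M' := G)
  have S₃ := hp.smooth_act.contMDiff_tangentMap (m := ∞) (by simp)
  have S := (S₃.comp S₂).comp (sfg.prodMk sfv)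
  have heq : ∀ q : P, (tangentMap ((𝓘(ℝ, EP)).prod 𝓘(ℝ, EG)) 𝓘(ℝ, EP)
      (fun a : P × G => MulOpposite.op a.2 • a.1)
      ((equivTangentBundleProd 𝓘(ℝ, EP) P 𝓘(ℝ, EG) G).symm
        ((⟨q, 0⟩ : TangentBundle 𝓘(ℝ, EP) P), (⟨1, z⟩ : TangentBundle 𝓘(ℝ, EG) G))))
      = (⟨q, fundamentalVF z q⟩ : TangentBundle 𝓘(ℝ, EP) P) := by
    intro q
    have h := mfderiv_prod_eq_add_apply (p := (q, (1 : G)))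
      (v := (((0 : EP), (z : EG)) : EP × EG))
      (hp.smooth_act.mdifferentiable (by simp) (q, (1 : G)))
    have h1 : (mfderiv 𝓘(ℝ, EP) 𝓘(ℝ, EP) (fun z₁ : P => MulOpposite.op (1 : G) • z₁) q)
        (0 : EP) = 0 := map_zero _
    refine Bundle.TotalSpace.ext (by simp [tangentMap]) (heq_of_eq ?_)
    refine h.trans ?_
    refine (congrArg₂ (· + ·) h1 rfl).trans ?_
    exact zero_add _
  refine ContMDiff.congr S fun q => (heq q).symm

/-- Invariant vector fields commute with the fundamental vector fields. -/
theorem lie_fundamentalVF_eq_zero (hp : IsPrincipalBundle EM EG EP G p)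
    (z : GroupLieAlgebra 𝓘(ℝ, EG) G) {X : ∀ q : P, TangentSpace 𝓘(ℝ, EP) q} (hX : SmoothVF X)
    (hinv : ∀ (g : G) (q : P), X (MulOpposite.op g • q) = dR g q (X q)) (q : P) :
    lie (fun q : P => (fundamentalVF z q : TangentSpace 𝓘(ℝ, EP) q)) X q = 0 := by
  have : IsManifold 𝓘(ℝ, EG) ∞ G := LieGroup.toContMDiffMul.toIsManifold
  refine eq_of_forall_mfderiv_eq fun f hf => ?_
  refine Eq.trans ?_ (map_zero (mfderiv 𝓘(ℝ, EP) 𝓘(ℝ, ℝ) f q)).symm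
  refine (dirDeriv_lie (hp.smoothVF_fundamentalVF z) hX hf q).trans ?_
  refine sub_eq_zero.2 ?_
  -- For `F(s, t) = f(δ(s) · γ(t))` the two mixed partial derivatives at the origin are `X(Y_z f)`
  -- and `Y_z(X f)` at `q`. Only the velocities of the two curves at `0` matter.
  obtain ⟨γ, hγ0, hγ, hγ'⟩ := exists_curve (E := EG) (1 : G) z
  obtain ⟨δ, hδ0, hδ, hδ'⟩ := exists_curve (E := EP) q (X q)
  let F : ℝ × ℝ → ℝ := fun s => f (MulOpposite.op (γ s.2) • δ s.1)
  have hF : ContDiffAt ℝ 2 F (0, 0) := by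
    rw [← contMDiffAt_iff_contDiffAt]
    have h1 : ContMDiffAt 𝓘(ℝ, ℝ × ℝ) 𝓘(ℝ, EP) ∞ (fun s : ℝ × ℝ => δ s.1) (0, 0) :=
      ContMDiffAt.comp (I' := 𝓘(ℝ, ℝ)) ((0 : ℝ), (0 : ℝ)) hδ contDiff_fst.contMDiff.contMDiffAt
    have h2 : ContMDiffAt 𝓘(ℝ, ℝ × ℝ) 𝓘(ℝ, EG) ∞ (fun s : ℝ × ℝ => γ s.2) (0, 0) :=
      ContMDiffAt.comp (I' := 𝓘(ℝ, ℝ)) ((0 : ℝ), (0 : ℝ)) hγ contDiff_snd.contMDiff.contMDiffAt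
    have h3 : ContMDiffAt 𝓘(ℝ, ℝ × ℝ) 𝓘(ℝ, ℝ) ∞ F (0, 0) :=
      (hf.comp hp.smooth_act).contMDiffAt.comp ((0 : ℝ), (0 : ℝ)) (h1.prodMk h2)
    exact h3.of_le (WithTop.coe_le_coe.2 (le_top : (2 : ℕ∞) ≤ ⊤))
  have hY : ∀ q', deriv (fun t => f (MulOpposite.op (γ t) • q')) 0
      = dirDeriv (fun q : P => (fundamentalVF z q : TangentSpace 𝓘(ℝ, EP) q)) f q' := by
    intro q'
    have h := deriv_comp_curve (f := fun h : G => f (MulOpposite.op h • q'))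
      (hf.comp (hp.contMDiff_orbit q')) hγ hγ0 hγ'
    refine h.trans ?_
    refine (mfderiv_comp_apply (1 : G) (hf.mdifferentiable (by simp) _)
      ((hp.contMDiff_orbit q').mdifferentiable (by simp) 1) z).trans ?_
    have h2 : ∀ q'', q'' = q' → (mfderiv 𝓘(ℝ, EP) 𝓘(ℝ, ℝ) f q'' : EP →L[ℝ] ℝ)
        = mfderiv 𝓘(ℝ, EP) 𝓘(ℝ, ℝ) f q' := by rintro _ rfl; rfl
    exact DFunLike.congr_fun (h2 (MulOpposite.op (1 : G) • q') (one_smul Gᵐᵒᵖ q')) _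
  -- Here invariance enters: the translate of `δ` by `g` has velocity `X` at `q · g`.
  have hXd : ∀ g : G, deriv (fun s => f (MulOpposite.op g • δ s)) 0
      = dirDeriv X f (MulOpposite.op g • q) := by
    intro g
    have h := deriv_comp_curve (f := fun q : P => f (MulOpposite.op g • q))
      (hf.comp (hp.contMDiff_act g)) hδ hδ0 hδ'
    refine h.trans ?_
    refine (mfderiv_comp_apply q (hf.mdifferentiable (by simp) _)
      ((hp.contMDiff_act g).mdifferentiable (by simp) q) (X q)).trans ?_
    unfold dirDeriv
    rw [hinv g q]
    rfl
  have hcomm := deriv_deriv_comm hF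
  simp only [F, hY, hXd] at hcomm
  have e1 : deriv (fun s => dirDeriv (fun q : P => (fundamentalVF z q : TangentSpace 𝓘(ℝ, EP) q)) f (δ s)) 0
      = dirDeriv X (dirDeriv (fun q : P => (fundamentalVF z q : TangentSpace 𝓘(ℝ, EP) q)) f) q :=
    deriv_comp_curve ((hp.smoothVF_fundamentalVF z).dirDeriv hf) hδ hδ0 hδ'
  have e2 : deriv (fun t => dirDeriv X f (MulOpposite.op (γ t) • q)) 0
      = dirDeriv (fun q : P => (fundamentalVF z q : TangentSpace 𝓘(ℝ, EP) q)) (dirDeriv X f) q := by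
    have h := deriv_comp_curve (f := fun h : G => dirDeriv X f (MulOpposite.op h • q))
      ((hX.dirDeriv hf).comp (hp.contMDiff_orbit q)) hγ hγ0 hγ'
    refine h.trans ?_
    refine (mfderiv_comp_apply (1 : G) ((hX.dirDeriv hf).mdifferentiable (by simp) _)
      ((hp.contMDiff_orbit q).mdifferentiable (by simp) 1) z).trans ?_
    have h2 : ∀ q'', q'' = q → (mfderiv 𝓘(ℝ, EP) 𝓘(ℝ, ℝ) (dirDeriv X f) q'' : EP →L[ℝ] ℝ)
        = mfderiv 𝓘(ℝ, EP) 𝓘(ℝ, ℝ) (dirDeriv X f) q := by rintro _ rfl; rfl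
    exact DFunLike.congr_fun (h2 (MulOpposite.op (1 : G) • q) (one_smul Gᵐᵒᵖ q)) _
  rw [← e1, ← e2, hcomm]

end IsPrincipalBundle
end Principal

/-! ### Sections of `E`, and a smoothness criterion by pairings. -/

section Principal

variable {EM : Type*} [NormedAddCommGroup EM] [NormedSpace ℝ EM] [FiniteDimensional ℝ EM]
  {M : Type*} [TopologicalSpace M] [T2Space M] [ChartedSpace EM M] [IsManifold 𝓘(ℝ, EM) ∞ M]
  {EG : Type*} [NormedAddCommGroup EG] [NormedSpace ℝ EG] [FiniteDimensional ℝ EG]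
  {G : Type*} [TopologicalSpace G] [ChartedSpace EG G] [Group G] [LieGroup 𝓘(ℝ, EG) ∞ G]
  {EP : Type*} [NormedAddCommGroup EP] [NormedSpace ℝ EP] [FiniteDimensional ℝ EP]
  {P : Type*} [TopologicalSpace P] [T2Space P] [ChartedSpace EP P] [IsManifold 𝓘(ℝ, EP) ∞ P]
  [MulAction Gᵐᵒᵖ P]

theorem SmoothOneForm.add {α β : ∀ x : M, Module.Dual ℝ (TangentSpace 𝓘(ℝ, EM) x)}
    (hα : SmoothOneForm α) (hβ : SmoothOneForm β) : SmoothOneForm (fun x => α x + β x) :=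
  fun X hX => (hα X hX).add (hβ X hX)

theorem SmoothOneForm.smul {f : M → ℝ} (hf : ContMDiff 𝓘(ℝ, EM) 𝓘(ℝ, ℝ) ∞ f)
    {α : ∀ x : M, Module.Dual ℝ (TangentSpace 𝓘(ℝ, EM) x)} (hα : SmoothOneForm α) :
    SmoothOneForm (fun x => f x • α x) :=
  fun X hX => hf.mul (hα X hX)

instance finiteDimensional_tangentSpace (q : P) :
    FiniteDimensional ℝ (TangentSpace 𝓘(ℝ, EP) q) :=
  inferInstanceAs (FiniteDimensional ℝ EP)

theorem pairing_apply (q : P) (a b : GT EP q) :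
    pairing q a b = (1 / 2 : ℝ) * (a.2 b.1 + b.2 a.1) := rfl

theorem pairing_comm (q : P) (a b : GT EP q) : pairing q a b = pairing q b a := by
  rw [pairing_apply, pairing_apply, add_comm]

theorem IsTranslate.pairing_eq {g : G} {q : P} {a a' : GT EP q}
    {b b' : GT EP (MulOpposite.op g • q)} (h : IsTranslate g q a b) (h' : IsTranslate g q a' b') :
    pairing _ b b' = pairing q a a' := by
  rw [pairing_apply, pairing_apply, h.1, h'.1, h.2, h'.2]

theorem IsTranslate.add {g : G} {q : P} {a a' : GT EP q}
    {b b' : GT EP (MulOpposite.op g • q)} (h : IsTranslate g q a b) (h' : IsTranslate g q a' b') :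
    IsTranslate g q (a + a') (b + b') := by
  refine ⟨?_, fun v => ?_⟩
  · simp [h.1, h'.1]
  · simp [h.2, h'.2]

theorem IsTranslate.smul {g : G} {q : P} {a : GT EP q} {b : GT EP (MulOpposite.op g • q)}
    (c : ℝ) (h : IsTranslate g q a b) : IsTranslate g q (c • a) (c • b) := by
  refine ⟨?_, fun v => ?_⟩
  · simp [h.1]
  · simp [h.2]

theorem IsTranslate.zero (g : G) (q : P) : IsTranslate g q (0 : GT EP q) 0 :=
  ⟨by simp, fun v => by simp⟩

namespace CourantReduction

variable (R : CourantReduction EM M EG G EP P)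

theorem contMDiff_proj : ContMDiff 𝓘(ℝ, EP) 𝓘(ℝ, EM) ∞ R.p := R.principal.smooth_proj

namespace IsSection

variable {R}

theorem zero : R.IsSection 0 where
  smooth_vector := SmoothVF.zero
  smooth_form := fun X _ => by simpa using! contMDiff_const
  invariant := fun g q => IsTranslate.zero g q
  mem_Kperp := fun q => zero_mem _

theorem add {e s : ∀ q : P, GT EP q} (he : R.IsSection e) (hs : R.IsSection s) :
    R.IsSection (e + s) where
  smooth_vector := he.smooth_vector.add hs.smooth_vector
  smooth_form := he.smooth_form.add hs.smooth_form
  invariant := fun g q => (he.invariant g q).add (hs.invariant g q)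
  mem_Kperp := fun q => add_mem (he.mem_Kperp q) (hs.mem_Kperp q)

theorem smul {f : M → ℝ} (hf : ContMDiff 𝓘(ℝ, EM) 𝓘(ℝ, ℝ) ∞ f) {e : ∀ q : P, GT EP q}
    (he : R.IsSection e) : R.IsSection (fun q => f (R.p q) • e q) where
  smooth_vector := SmoothVF.smul (hf.comp R.contMDiff_proj) he.smooth_vector
  smooth_form := SmoothOneForm.smul (hf.comp R.contMDiff_proj) he.smooth_form
  invariant := fun g q => by
    rw [R.principal.proj_act]
    exact (he.invariant g q).smul _
  mem_Kperp := fun q => Submodule.smul_mem _ _ (he.mem_Kperp q)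

theorem const_smul (c : ℝ) {e : ∀ q : P, GT EP q} (he : R.IsSection e) : R.IsSection (c • e) :=
  he.smul (f := fun _ => c) contMDiff_const

theorem neg {e : ∀ q : P, GT EP q} (he : R.IsSection e) : R.IsSection (-e) := by
  have h : -e = (-1 : ℝ) • e := by funext q; exact (neg_one_smul ℝ (e q)).symm
  rw [h]; exact he.const_smul (-1)

theorem sub {e s : ∀ q : P, GT EP q} (he : R.IsSection e) (hs : R.IsSection s) :
    R.IsSection (e - s) := by
  rw [sub_eq_add_neg]; exact he.add hs.neg

theorem contMDiff_pairing {e s : ∀ q : P, GT EP q} (he : R.IsSection e) (hs : R.IsSection s) :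
    ContMDiff 𝓘(ℝ, EP) 𝓘(ℝ, ℝ) ∞ (fun q => pairing q (e q) (s q)) :=
  contMDiff_const.mul
    ((he.smooth_form _ hs.smooth_vector).add (hs.smooth_form _ he.smooth_vector))

theorem pairing_act {e s : ∀ q : P, GT EP q} (he : R.IsSection e) (hs : R.IsSection s)
    (g : G) (q : P) :
    pairing _ (e (MulOpposite.op g • q)) (s (MulOpposite.op g • q)) = pairing q (e q) (s q) :=
  (he.invariant g q).pairing_eq (hs.invariant g q)

end IsSection

/-- Smooth invariant functions on `P` are the pullbacks of smooth functions on `M`. -/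
theorem exists_eq_comp_proj {f : P → ℝ} (hf : ContMDiff 𝓘(ℝ, EP) 𝓘(ℝ, ℝ) ∞ f)
    (hinv : ∀ (g : G) (q : P), f (MulOpposite.op g • q) = f q) :
    ∃ h : M → ℝ, ContMDiff 𝓘(ℝ, EM) 𝓘(ℝ, ℝ) ∞ h ∧ ∀ q, f q = h (R.p q) := by
  have key : ∀ q, f q = f (Function.surjInv R.principal.surjective (R.p q)) := by
    intro q
    obtain ⟨g, hg⟩ := R.principal.exists_act_eq
      (Function.surjInv_eq R.principal.surjective (R.p q))
    exact (congrArg f hg).symm.trans (hinv g _)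
  refine ⟨fun x => f (Function.surjInv R.principal.surjective x), ?_, key⟩
  refine R.principal.contMDiff_of_comp ?_
  convert hf using 2 with q
  exact (key q).symm

/-- The subspace spanned at `q` by the values of a set of fields. -/
def spanAt (S : Set (∀ q : P, GT EP q)) (q : P) : Submodule ℝ (GT EP q) :=
  Submodule.span ℝ ((fun s : ∀ q : P, GT EP q => s q) '' S)

theorem mem_spanAt {S : Set (∀ q : P, GT EP q)} {s : ∀ q : P, GT EP q} (hs : s ∈ S) (q : P) :
    s q ∈ spanAt S q :=
  Submodule.subset_span ⟨s, hs, rfl⟩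

theorem spanAt_le {S : Set (∀ q : P, GT EP q)} {q : P} {W : Submodule ℝ (GT EP q)}
    (h : ∀ s ∈ S, s q ∈ W) : spanAt S q ≤ W := by
  rw [spanAt, Submodule.span_le]
  rintro _ ⟨s, hs, rfl⟩
  exact h s hs

theorem pairing_eq_zero_of_mem_span {q : P} {T : Set (GT EP q)} {a b : GT EP q}
    (h : ∀ t ∈ T, pairing q a t = 0) (hb : b ∈ Submodule.span ℝ T) : pairing q a b = 0 := by
  have : Submodule.span ℝ T ≤ LinearMap.ker (pairing q a) := Submodule.span_le.2 h
  exact this hb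

/-- Choose members of `S` whose values at `q₀` form a basis of the span. Their Gram matrix is
invertible at `q₀` by non-degeneracy, hence also nearby, so they stay independent, and by constancy
of the rank they stay a basis. The coefficients of `e` solve the Gram system, whose right-hand side
consists of the smooth pairings of `e` with `S`. -/
theorem exists_local_expansion {S : Set (∀ q : P, GT EP q)} (hS : ∀ s ∈ S, R.IsSection s)
    (hnd : ∀ q, ∀ a ∈ spanAt S q, (∀ s ∈ S, pairing q a (s q) = 0) → a = 0)
    (hrank : ∀ q q', Module.finrank ℝ (spanAt S q) = Module.finrank ℝ (spanAt S q'))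
    {e : ∀ q : P, GT EP q} (he : ∀ q, e q ∈ spanAt S q)
    (hsm : ∀ s ∈ S, ContMDiff 𝓘(ℝ, EP) 𝓘(ℝ, ℝ) ∞ (fun q => pairing q (e q) (s q))) (q₀ : P) :
    ∃ (n : ℕ) (s : Fin n → ∀ q : P, GT EP q) (f : Fin n → P → ℝ), (∀ i, s i ∈ S) ∧
      (∀ i, ContMDiffAt 𝓘(ℝ, EP) 𝓘(ℝ, ℝ) ∞ (f i) q₀) ∧
      ∀ᶠ q in nhds q₀, e q = ∑ i, f i q • s i q := by
  obtain ⟨v, hv, hspan, hli⟩ := Submodule.exists_fun_fin_finrank_span_eq ℝ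
    ((fun s : ∀ q : P, GT EP q => s q₀) '' S)
  choose s hsS hsv using hv
  let A : P → Matrix (Fin _) (Fin _) ℝ := fun q =>
    Matrix.of fun i j => pairing q (s i q) (s j q)
  have hA : ∀ i j, ContMDiff 𝓘(ℝ, EP) 𝓘(ℝ, ℝ) ∞ (fun q => A q i j) := fun i j =>
    (hS _ (hsS i)).contMDiff_pairing (hS _ (hsS j))
  have hAc : ∀ q (c : Fin _ → ℝ) i,
      (A q).mulVec c i = pairing q (∑ j, c j • s j q) (s i q) := by
    intro q c i
    simp only [Matrix.mulVec, dotProduct, A, Matrix.of_apply, map_sum, map_smul,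
      LinearMap.sum_apply, LinearMap.smul_apply, smul_eq_mul]
    exact Finset.sum_congr rfl fun j _ => by rw [pairing_comm, mul_comm]
  have hdet : (A q₀).det ≠ 0 := by
    intro h0
    obtain ⟨c, hc, hc0⟩ := Matrix.exists_mulVec_eq_zero_iff.2 h0
    have hz : ∑ j, c j • s j q₀ = 0 := by
      refine hnd q₀ _ (Submodule.sum_mem _ fun j _ =>
        Submodule.smul_mem _ _ (mem_spanAt (hsS j) q₀)) fun t ht => ?_
      refine pairing_eq_zero_of_mem_span (T := Set.range v) ?_ ?_
      · rintro _ ⟨i, rfl⟩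
        rw [← hsv i]
        have := congrFun hc0 i
        rw [hAc] at this
        exact this
      · rw [hspan]; exact mem_spanAt ht q₀
    have : ∑ j, c j • v j = 0 := by simpa only [hsv] using hz
    exact hc (funext (Fintype.linearIndependent_iff.1 hli c this))
  have hev : ∀ᶠ q in nhds q₀, (A q).det ≠ 0 :=
    (contMDiffAt_det fun i j => (hA i j).contMDiffAt).continuousAt.eventually_ne hdet
  have hexp : ∀ᶠ q in nhds q₀, ∃ c : Fin _ → ℝ, e q = ∑ i, c i • s i q := by
    filter_upwards [hev] with q hq
    have hliq : LinearIndependent ℝ fun i => s i q := by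
      refine Fintype.linearIndependent_iff.2 fun c hc => ?_
      by_contra hne
      refine hq (Matrix.exists_mulVec_eq_zero_iff.1 ⟨c, fun h => hne (congrFun h), ?_⟩)
      funext i
      rw [hAc, hc]; simp
    have heq : Submodule.span ℝ (Set.range fun i => s i q) = spanAt S q := by
      refine Submodule.eq_of_le_of_finrank_eq ?_ ?_
      · rw [Submodule.span_le]
        rintro _ ⟨i, rfl⟩
        exact mem_spanAt (hsS i) q
      · rw [finrank_span_eq_card hliq, Fintype.card_fin]
        exact hrank q₀ q
    have := he q
    rw [← heq, Submodule.mem_span_range_iff_exists_fun] at this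
    obtain ⟨c, hc⟩ := this
    exact ⟨c, hc.symm⟩
  classical
  -- The default value `0` is harmless: near `q₀` an expansion exists, and smoothness is only
  -- claimed at `q₀`.
  let f : Fin _ → P → ℝ := fun i q =>
    if h : ∃ c : Fin _ → ℝ, e q = ∑ i, c i • s i q then h.choose i else 0
  have hf : ∀ᶠ q in nhds q₀, e q = ∑ i, f i q • s i q := by
    filter_upwards [hexp] with q hq
    simp only [f, dif_pos hq]
    exact hq.choose_spec
  refine ⟨_, s, f, hsS, ?_, hf⟩
  refine contMDiffAt_of_linear_system (A := A) (b := fun i q => pairing q (e q) (s i q))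
    (fun i j => (hA i j).contMDiffAt) (fun i => (hsm _ (hsS i)).contMDiffAt) hdet ?_
  filter_upwards [hf] with q hq i
  have := hAc q (fun j => f j q) i
  rw [← hq] at this
  exact this

/-- A field with values in the span of a set of sections whose span is non-degenerate and of
constant rank is a section if its pairings with these sections are smooth and invariant. -/
theorem isSection_of_pairing {S : Set (∀ q : P, GT EP q)} (hS : ∀ s ∈ S, R.IsSection s)
    (hnd : ∀ q, ∀ a ∈ spanAt S q, (∀ s ∈ S, pairing q a (s q) = 0) → a = 0)
    (hrank : ∀ q q', Module.finrank ℝ (spanAt S q) = Module.finrank ℝ (spanAt S q'))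
    {e : ∀ q : P, GT EP q} (he : ∀ q, e q ∈ spanAt S q)
    (hsm : ∀ s ∈ S, ContMDiff 𝓘(ℝ, EP) 𝓘(ℝ, ℝ) ∞ (fun q => pairing q (e q) (s q)))
    (hinv : ∀ s ∈ S, ∀ (g : G) (q : P),
      pairing _ (e (MulOpposite.op g • q)) (s (MulOpposite.op g • q)) = pairing q (e q) (s q)) :
    R.IsSection e where
  smooth_vector := by
    intro q₀
    obtain ⟨n, s, f, hsS, hf, hev⟩ := R.exists_local_expansion hS hnd hrank he hsm q₀
    have h1 : ContMDiffAt 𝓘(ℝ, EP) (𝓘(ℝ, EP)).tangent ∞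
        (fun q => (⟨q, ∑ i, f i q • (s i q).1⟩ : TangentBundle 𝓘(ℝ, EP) P)) q₀ :=
      ContMDiffAt.sum_section (t := fun i q => f i q • (s i q).1) fun i _ =>
        (hf i).smul_section ((hS _ (hsS i)).smooth_vector q₀)
    refine h1.congr_of_eventuallyEq ?_
    filter_upwards [hev] with q hq
    rw [hq]
    simp [Prod.fst_sum]
  smooth_form := by
    intro X hX q₀
    obtain ⟨n, s, f, hsS, hf, hev⟩ := R.exists_local_expansion hS hnd hrank he hsm q₀
    have h1 : ContMDiffAt 𝓘(ℝ, EP) 𝓘(ℝ, ℝ) ∞ (fun q => ∑ i, f i q * (s i q).2 (X q)) q₀ :=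
      contMDiffAt_finsetSum fun i _ =>
        (hf i).mul ((hS _ (hsS i)).smooth_form X hX q₀)
    refine h1.congr_of_eventuallyEq ?_
    filter_upwards [hev] with q hq
    rw [hq]
    simp [Prod.snd_sum, LinearMap.sum_apply]
  invariant := by
    intro g q
    -- Every element of the span at `q` has a translate in the span at `q · g`. The translate of `e
    -- q` has the same pairings with `S` as `e (q · g)`, so non-degeneracy identifies the two.
    have key : ∀ a ∈ spanAt S q, ∃ b ∈ spanAt S (MulOpposite.op g • q), IsTranslate g q a b := by
      intro a ha
      induction ha using Submodule.span_induction with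
      | mem x h =>
        obtain ⟨s, hs, rfl⟩ := h
        exact ⟨_, mem_spanAt hs _, (hS s hs).invariant g q⟩
      | zero => exact ⟨0, zero_mem _, IsTranslate.zero g q⟩
      | add x y _ _ hx hy =>
        obtain ⟨b, hb, hxb⟩ := hx
        obtain ⟨c, hc, hyc⟩ := hy
        exact ⟨b + c, add_mem hb hc, hxb.add hyc⟩
      | smul t x _ hx =>
        obtain ⟨b, hb, hxb⟩ := hx
        exact ⟨t • b, Submodule.smul_mem _ _ hb, hxb.smul t⟩
    obtain ⟨b, hb, hqb⟩ := key _ (he q)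
    have : e (MulOpposite.op g • q) = b := by
      rw [← sub_eq_zero]
      refine hnd _ _ (sub_mem (he _) hb) fun s hs => ?_
      rw [map_sub, LinearMap.sub_apply, hinv s hs, hqb.pairing_eq ((hS s hs).invariant g q),
        sub_self]
    rw [this]; exact hqb
  mem_Kperp := fun q => spanAt_le (fun s hs => (hS s hs).mem_Kperp q) (he q)

end CourantReduction
end Principal

/-! ### Linear algebra in the fibres of `K^⊥` and `V₊`. -/

section Principal

variable {EM : Type*} [NormedAddCommGroup EM] [NormedSpace ℝ EM] [FiniteDimensional ℝ EM]
  {M : Type*} [TopologicalSpace M] [T2Space M] [ChartedSpace EM M] [IsManifold 𝓘(ℝ, EM) ∞ M]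
  {EG : Type*} [NormedAddCommGroup EG] [NormedSpace ℝ EG] [FiniteDimensional ℝ EG]
  {G : Type*} [TopologicalSpace G] [ChartedSpace EG G] [Group G] [LieGroup 𝓘(ℝ, EG) ∞ G]
  {EP : Type*} [NormedAddCommGroup EP] [NormedSpace ℝ EP] [FiniteDimensional ℝ EP]
  {P : Type*} [TopologicalSpace P] [T2Space P] [ChartedSpace EP P] [IsManifold 𝓘(ℝ, EP) ∞ P]
  [MulAction Gᵐᵒᵖ P]

namespace CourantReduction

section

/-- A functional is represented on a subspace on which a bilinear form is non-degenerate. -/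
theorem exists_bilin_eq {E : Type*} [AddCommGroup E] [Module ℝ E] [FiniteDimensional ℝ E]
    (b : E →ₗ[ℝ] E →ₗ[ℝ] ℝ) (W : Submodule ℝ E)
    (hW : ∀ a ∈ W, (∀ c ∈ W, b a c = 0) → a = 0) (φ : Module.Dual ℝ E) :
    ∃ a ∈ W, ∀ c ∈ W, b a c = φ c := by
  let B : W →ₗ[ℝ] Module.Dual ℝ W := b.compl₁₂ W.subtype W.subtype
  have hinj : Function.Injective B := by
    refine (injective_iff_map_eq_zero B).2 fun a ha => ?_
    exact Subtype.ext (hW a a.2 fun b hb => LinearMap.congr_fun ha ⟨b, hb⟩)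
  have hsurj : Function.Surjective B :=
    (LinearMap.injective_iff_surjective_of_finrank_eq_finrank Subspace.dual_finrank_eq.symm).1 hinj
  obtain ⟨a, ha⟩ := hsurj (φ ∘ₗ W.subtype)
  exact ⟨a, a.2, fun b hb => LinearMap.congr_fun ha ⟨b, hb⟩⟩

/-- A surjective linear map on a subspace has a right inverse that is orthogonal to its kernel, if
the kernel is non-degenerate. -/
theorem exists_orthogonal_section {E F : Type*} [AddCommGroup E] [Module ℝ E]
    [FiniteDimensional ℝ E] [AddCommGroup F] [Module ℝ F] (b : E →ₗ[ℝ] E →ₗ[ℝ] ℝ)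
    (V : Submodule ℝ E) (π : E →ₗ[ℝ] F) (hπ : ∀ v, ∃ a ∈ V, π a = v)
    (hnd : ∀ a ∈ V, π a = 0 → (∀ c ∈ V, π c = 0 → b a c = 0) → a = 0) :
    ∃ μ : F →ₗ[ℝ] E, ∀ v, μ v ∈ V ∧ (∀ a ∈ V, π a = 0 → b (μ v) a = 0) ∧ π (μ v) = v := by
  -- On the orthogonal complement `W` of `U` in `V`, the map `π` is injective because the form is
  -- non-degenerate on `U`. It is surjective because a preimage in `V` can be corrected by its
  -- projection onto `U`.
  let U : Submodule ℝ E := V ⊓ LinearMap.ker π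
  let W : Submodule ℝ E :=
    { carrier := {a | a ∈ V ∧ ∀ c ∈ U, b a c = 0}
      add_mem' := fun ha hb => ⟨add_mem ha.1 hb.1, fun c hc => by
        rw [map_add, LinearMap.add_apply, ha.2 c hc, hb.2 c hc, add_zero]⟩
      zero_mem' := ⟨zero_mem _, fun c _ => by simp⟩
      smul_mem' := fun t a ha => ⟨Submodule.smul_mem _ t ha.1, fun c hc => by
        rw [map_smul, LinearMap.smul_apply, ha.2 c hc, smul_zero]⟩ }
  let L : W →ₗ[ℝ] F := π ∘ₗ W.subtype
  have hinj : Function.Injective L := by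
    refine (injective_iff_map_eq_zero L).2 fun a ha => ?_
    exact Subtype.ext (hnd a a.2.1 ha fun c hc hc1 => a.2.2 c ⟨hc, hc1⟩)
  have hsurj : Function.Surjective L := by
    intro v
    obtain ⟨a, ha, rfl⟩ := hπ v
    obtain ⟨c, hc, h⟩ := exists_bilin_eq b U
      (fun a ha h => hnd a ha.1 ha.2 fun c hc hc1 => h c ⟨hc, hc1⟩) (b a)
    refine ⟨⟨a - c, sub_mem ha hc.1, fun d hd => ?_⟩, ?_⟩
    · rw [map_sub, LinearMap.sub_apply, h d hd, sub_self]
    · change π (a - c) = _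
      have : π c = 0 := hc.2
      rw [map_sub, this, sub_zero]
  let T := LinearEquiv.ofBijective L ⟨hinj, hsurj⟩
  exact ⟨W.subtype ∘ₗ T.symm.toLinearMap, fun v => ⟨(T.symm v).2.1, fun a ha ha1 =>
    (T.symm v).2.2 a ⟨ha, ha1⟩, T.apply_symm_apply v⟩⟩

variable (R : CourantReduction EM M EG G EP P)

theorem dp_surjective (q : P) : Function.Surjective (R.dp q) :=
  R.principal.mfderiv_surjective q

theorem dp_fundamentalVF (z : GroupLieAlgebra 𝓘(ℝ, EG) G) (q : P) :
    R.dp q (fundamentalVF z q) = 0 :=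
  R.principal.mfderiv_fundamentalVF z q

theorem exists_fundamentalVF_eq {q : P} {v : TangentSpace 𝓘(ℝ, EP) q} (hv : R.dp q v = 0) :
    ∃ z : GroupLieAlgebra 𝓘(ℝ, EG) G, fundamentalVF z q = v :=
  R.principal.exists_fundamentalVF_eq hv

theorem mem_Kperp_iff {q : P} {a : GT EP q} :
    a ∈ R.Kperp q ↔ ∀ z, a.2 (fundamentalVF z q) = - R.xi z q a.1 := by
  refine forall_congr' fun z => ?_
  rw [pairing_apply]
  change (1 / 2 : ℝ) * (a.2 (fundamentalVF z q) + R.xi z q a.1) = 0 ↔ _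
  constructor
  · intro h; linarith
  · intro h; rw [h]; ring

theorem cotIncl_fst (q : P) (ζ : Module.Dual ℝ (TangentSpace 𝓘(ℝ, EM) (R.p q))) :
    (R.cotIncl q ζ).1 = 0 := rfl

theorem cotIncl_snd (q : P) (ζ : Module.Dual ℝ (TangentSpace 𝓘(ℝ, EM) (R.p q)))
    (v : TangentSpace 𝓘(ℝ, EP) q) : (R.cotIncl q ζ).2 v = ζ (R.dp q v) := rfl

theorem pairing_cotIncl (q : P) (ζ : Module.Dual ℝ (TangentSpace 𝓘(ℝ, EM) (R.p q))) (a : GT EP q) :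
    pairing q (R.cotIncl q ζ) a = (1 / 2 : ℝ) * ζ (R.dp q a.1) := by
  rw [pairing_apply, cotIncl_snd, cotIncl_fst, map_zero, add_zero]

theorem cotIncl_mem_Kperp (q : P) (ζ : Module.Dual ℝ (TangentSpace 𝓘(ℝ, EM) (R.p q))) :
    R.cotIncl q ζ ∈ R.Kperp q := by
  intro z
  rw [pairing_cotIncl]
  change (1 / 2 : ℝ) * ζ (R.dp q (fundamentalVF z q)) = 0
  rw [dp_fundamentalVF, map_zero, mul_zero]

theorem cotIncl_injective (q : P) : Function.Injective (R.cotIncl q) := by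
  intro ζ η h
  ext v
  obtain ⟨u, rfl⟩ := R.dp_surjective q v
  rw [← R.cotIncl_snd q ζ, h, R.cotIncl_snd]

/-- Every tangent vector of `P` lifts to `K^⊥`. -/
theorem exists_mem_Kperp (q : P) (v : TangentSpace 𝓘(ℝ, EP) q) : ∃ a ∈ R.Kperp q, a.1 = v := by
  let Y : GroupLieAlgebra 𝓘(ℝ, EG) G →ₗ[ℝ] TangentSpace 𝓘(ℝ, EP) q :=
    { toFun := fun z => fundamentalVF z q
      map_add' := fun z w => fundamentalVF_add z w q
      map_smul' := fun a z => fundamentalVF_smul a z q }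
  have hY : LinearMap.ker Y = ⊥ :=
    LinearMap.ker_eq_bot.2 (R.principal.fundamentalVF_injective q)
  -- Membership in `K^⊥` prescribes the form on the vectors `Y_z` only, where it has to be
  -- `-ξ_z(v)`; a left inverse of `z ↦ Y_z` extends this to all of the tangent space.
  obtain ⟨L, hL⟩ := LinearMap.exists_leftInverse_of_injective Y hY
  let ξv : GroupLieAlgebra 𝓘(ℝ, EG) G →ₗ[ℝ] ℝ :=
    { toFun := fun z => R.xi z q v
      map_add' := fun z w => by simp
      map_smul' := fun a z => by simp }
  refine ⟨(v, -(ξv ∘ₗ L)), R.mem_Kperp_iff.2 fun z => ?_, rfl⟩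
  have : L (fundamentalVF z q) = z := LinearMap.congr_fun hL z
  simp [this, ξv]

/-- With zero vector part, orthogonality to `K` says that the form kills vertical vectors, so it
factors through `dp`. Thus `T*` is the kernel of `E → TP / G`. -/
theorem exists_eq_cotIncl {q : P} {a : GT EP q} (ha : a ∈ R.Kperp q) (ha1 : a.1 = 0) :
    ∃ ζ, R.cotIncl q ζ = a := by
  obtain ⟨L, hL⟩ := LinearMap.exists_rightInverse_of_surjective (R.dp q)
    (LinearMap.range_eq_top.2 (R.dp_surjective q))
  have hL' : ∀ v, R.dp q (L v) = v := LinearMap.congr_fun hL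
  refine ⟨a.2 ∘ₗ L, Prod.ext ha1.symm ?_⟩
  ext v
  rw [cotIncl_snd, LinearMap.comp_apply]
  obtain ⟨z, hz⟩ := R.exists_fundamentalVF_eq (q := q) (v := v - L (R.dp q v)) (by
    rw [map_sub, hL', sub_self])
  have h := R.mem_Kperp_iff.1 ha z
  rw [hz, ha1, map_zero, neg_zero, map_sub, sub_eq_zero] at h
  exact h.symm

/-- On `K^⊥ ∩ Ker π` the pairing is `c`. -/
theorem pairing_eq_c {q : P} {a b : GT EP q} (ha : a ∈ R.Kperp q) (hb : b ∈ R.Kperp q)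
    {z w : GroupLieAlgebra 𝓘(ℝ, EG) G} (hz : a.1 = fundamentalVF z q)
    (hw : b.1 = fundamentalVF w q) : pairing q a b = R.c z w := by
  rw [R.c_eq z w q, pairing_apply, pairing_apply]
  -- For an element of `K^⊥` the values of the form on vertical vectors are dictated by `ξ`, so the
  -- pairing of vertical elements depends on their vector parts alone.
  have h1 := R.mem_Kperp_iff.1 ha w
  have h2 := R.mem_Kperp_iff.1 hb z
  rw [hw, hz, h1, h2, hz, hw]
  ring

theorem cAd_eq_pairing {q : P} {a b : GT EP q} (ha : a ∈ R.Kperp q) (hb : b ∈ R.Kperp q)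
    (ha1 : R.dp q a.1 = 0) (hb1 : R.dp q b.1 = 0) : R.cAd q a.1 b.1 = pairing q a b := by
  refine (R.pairing_eq_c ha hb ?_ ?_).symm
  · exact (Classical.epsilon_spec (R.exists_fundamentalVF_eq ha1)).symm
  · exact (Classical.epsilon_spec (R.exists_fundamentalVF_eq hb1)).symm

/-- On vertical elements the pairing is `c`, and every `Y_w` lifts to `K^⊥`; this is where the
non-degeneracy of `c` is used. -/
theorem fst_eq_zero_of_vertical {q : P} {a : GT EP q} (ha : a ∈ R.Kperp q) (ha1 : R.dp q a.1 = 0)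
    (h : ∀ b ∈ R.Kperp q, R.dp q b.1 = 0 → pairing q a b = 0) : a.1 = 0 := by
  obtain ⟨z, hz⟩ := R.exists_fundamentalVF_eq ha1
  have : z = 0 := by
    refine R.c_nondegenerate z fun w => ?_
    obtain ⟨b, hb, hbw⟩ := R.exists_mem_Kperp q (fundamentalVF w q)
    rw [← R.pairing_eq_c ha hb hz.symm hbw]
    exact h b hb (by rw [hbw, dp_fundamentalVF])
  rw [← hz, this]
  exact map_zero (mfderiv 𝓘(ℝ, EG) 𝓘(ℝ, EP) (fun h : G => MulOpposite.op h • q) 1 : EG →L[ℝ] EP)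

/-- Three tests in succession: pairing with `T*` shows that `a` is vertical, pairing with vertical
elements shows that it lies in `T*`, and pairing with lifts of arbitrary tangent vectors shows that
it is zero. -/
theorem Kperp_nondegenerate {q : P} {a : GT EP q} (ha : a ∈ R.Kperp q)
    (h : ∀ b ∈ R.Kperp q, pairing q a b = 0) : a = 0 := by
  have hdp : R.dp q a.1 = 0 := by
    refine (Module.forall_dual_apply_eq_zero_iff ℝ _).1 fun ζ => ?_
    have := h _ (R.cotIncl_mem_Kperp q ζ)
    rw [pairing_comm, pairing_cotIncl] at this
    linarith
  have h1 := R.fst_eq_zero_of_vertical ha hdp fun b hb _ => h b hb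
  obtain ⟨ζ, rfl⟩ := R.exists_eq_cotIncl ha h1
  have : ζ = 0 := by
    ext v
    obtain ⟨u, rfl⟩ := R.dp_surjective q v
    obtain ⟨b, hb, rfl⟩ := R.exists_mem_Kperp q u
    have := h b hb
    rw [pairing_cotIncl] at this
    simp only [LinearMap.zero_apply]
    linarith
  rw [this, map_zero]

/-- A functional is represented on a subspace on which the pairing is non-degenerate. -/
theorem exists_pairing_eq {q : P} (W : Submodule ℝ (GT EP q))
    (hW : ∀ a ∈ W, (∀ b ∈ W, pairing q a b = 0) → a = 0) (φ : Module.Dual ℝ (GT EP q)) :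
    ∃ a ∈ W, ∀ b ∈ W, pairing q a b = φ b :=
  exists_bilin_eq (pairing q) W hW φ

theorem sharp_spec (φ : ∀ q : P, Module.Dual ℝ (GT EP q)) (q : P) :
    R.sharp φ q ∈ R.Kperp q ∧ ∀ a ∈ R.Kperp q, pairing q (R.sharp φ q) a = φ q a := by
  refine Classical.epsilon_spec (p := fun u => u ∈ R.Kperp q ∧ ∀ a ∈ R.Kperp q,
    pairing q u a = φ q a) ?_
  obtain ⟨a, ha, h⟩ := exists_pairing_eq (R.Kperp q)
    (fun a ha h => R.Kperp_nondegenerate ha h) (φ q)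
  exact ⟨a, ha, h⟩

section Admissible

variable {R} {V : ∀ q : P, Submodule ℝ (GT EP q)} (hV : R.IsAdmissible V)
include hV

theorem IsAdmissible.le_Kperp (q : P) : V q ≤ R.Kperp q := hV.isGeneralizedMetric.le_Kperp q

/-- The two conditions of admissibility make `V₊` a complement of `T*`, by counting dimensions.
Hence the vector part identifies the fibre of `V₊` at `q` with the tangent space of `P` there, which
is what the next two lemmas extract. -/
theorem IsAdmissible.sup_cotIncl (q : P) : V q ⊔ LinearMap.range (R.cotIncl q) = R.Kperp q := by
  refine Submodule.eq_of_le_of_finrank_eq (sup_le (hV.le_Kperp q) ?_) ?_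
  · rintro _ ⟨ζ, rfl⟩
    exact R.cotIncl_mem_Kperp q ζ
  · have h := Submodule.finrank_sup_add_finrank_inf_eq (V q) (LinearMap.range (R.cotIncl q))
    rw [hV.inf_cotangent q, finrank_bot, add_zero,
      LinearMap.finrank_range_of_inj (R.cotIncl_injective q), Subspace.dual_finrank_eq] at h
    rw [h, ← hV.rank_eq q]
    rfl

theorem IsAdmissible.exists_mem_fst_eq (q : P) (r : TangentSpace 𝓘(ℝ, EP) q) :
    ∃ a, a ∈ V q ∧ a.1 = r := by
  obtain ⟨a, ha, rfl⟩ := R.exists_mem_Kperp q r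
  rw [← hV.sup_cotIncl q, Submodule.mem_sup] at ha
  obtain ⟨v, hv, _, ⟨ζ, rfl⟩, rfl⟩ := ha
  exact ⟨v, hv, by simp [cotIncl_fst]⟩

theorem IsAdmissible.eq_of_fst_eq {q : P} {a b : GT EP q} (ha : a ∈ V q) (hb : b ∈ V q)
    (h : a.1 = b.1) : a = b := by
  rw [← sub_eq_zero]
  have hm : a - b ∈ V q := sub_mem ha hb
  obtain ⟨ζ, hζ⟩ := R.exists_eq_cotIncl (hV.le_Kperp q hm) (by simp [h])
  have : a - b ∈ V q ⊓ LinearMap.range (R.cotIncl q) := ⟨hm, ζ, hζ⟩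
  rw [hV.inf_cotangent q] at this
  exact this

theorem IsAdmissible.adLift_spec (q : P) (r : TangentSpace 𝓘(ℝ, EP) q) :
    adLift V q r ∈ V q ∧ (adLift V q r).1 = r :=
  Classical.epsilon_spec (hV.exists_mem_fst_eq q r)

theorem IsAdmissible.adLift_eq {q : P} {a : GT EP q} (ha : a ∈ V q) : adLift V q a.1 = a :=
  hV.eq_of_fst_eq (hV.adLift_spec q _).1 ha (hV.adLift_spec q _).2

theorem IsAdmissible.projPlus_spec (e : ∀ q : P, GT EP q) (q : P) :
    projPlus V e q ∈ V q ∧ ∀ b ∈ V q, pairing q (e q - projPlus V e q) b = 0 := by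
  refine Classical.epsilon_spec (p := fun a => a ∈ V q ∧ ∀ b ∈ V q, pairing q (e q - a) b = 0) ?_
  obtain ⟨a, ha, h⟩ := exists_pairing_eq (V q) (hV.isGeneralizedMetric.nondegenerate q)
    (pairing q (e q))
  refine ⟨a, ha, fun b hb => ?_⟩
  rw [map_sub, LinearMap.sub_apply, h b hb, sub_self]

theorem IsAdmissible.projPlus_mem (e : ∀ q : P, GT EP q) (q : P) : projPlus V e q ∈ V q :=
  (hV.projPlus_spec e q).1

theorem IsAdmissible.pairing_projPlus (e : ∀ q : P, GT EP q) {q : P} {b : GT EP q} (hb : b ∈ V q) :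
    pairing q (projPlus V e q) b = pairing q (e q) b := by
  have := (hV.projPlus_spec e q).2 b hb
  rw [map_sub, LinearMap.sub_apply] at this
  linarith

theorem IsAdmissible.pairing_projMinus (e : ∀ q : P, GT EP q) {q : P} {b : GT EP q}
    (hb : b ∈ V q) : pairing q (projMinus V e q) b = 0 :=
  (hV.projPlus_spec e q).2 b hb

theorem IsAdmissible.projPlus_eq {e : ∀ q : P, GT EP q} {q : P} {a : GT EP q} (ha : a ∈ V q)
    (h : ∀ b ∈ V q, pairing q (e q - a) b = 0) : projPlus V e q = a := by
  rw [← sub_eq_zero]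
  refine hV.isGeneralizedMetric.nondegenerate q _ (sub_mem (hV.projPlus_mem e q) ha)
    fun b hb => ?_
  have := h b hb
  rw [map_sub, LinearMap.sub_apply] at this ⊢
  rw [hV.pairing_projPlus e hb, this]

/-- By `cAd_eq_pairing`, a vertical element of `K^⊥` may be replaced by the element of `V₊` with the
same vector part without changing its pairing with `a`. So the non-degeneracy of `c` passes to `V₊ ∩
Ker π`. -/
theorem IsAdmissible.vertical_nondegenerate {q : P} {a : GT EP q} (ha : a ∈ V q)
    (ha1 : R.dp q a.1 = 0) (h : ∀ b ∈ V q, R.dp q b.1 = 0 → pairing q a b = 0) : a = 0 := by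
  have h1 : a.1 = 0 := by
    refine R.fst_eq_zero_of_vertical (hV.le_Kperp q ha) ha1 fun b hb hb1 => ?_
    obtain ⟨b', hb', hbb'⟩ := hV.exists_mem_fst_eq q b.1
    rw [← R.cAd_eq_pairing (hV.le_Kperp q ha) hb ha1 hb1, ← hbb',
      R.cAd_eq_pairing (hV.le_Kperp q ha) (hV.le_Kperp q hb') ha1 (by rw [hbb', hb1])]
    exact h b' hb' (by rw [hbb', hb1])
  exact hV.eq_of_fst_eq ha (zero_mem _) h1

theorem IsAdmissible.piPerpInv_spec (q : P) (v : TangentSpace 𝓘(ℝ, EM) (R.p q)) :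
    R.piPerpInv V q v ∈ V q ∧
    (∀ a ∈ V q, R.dp q a.1 = 0 → pairing q (R.piPerpInv V q v) a = 0) ∧
    R.dp q (R.piPerpInv V q v).1 = v := by
  refine Classical.epsilon_spec (p := fun μ : TangentSpace 𝓘(ℝ, EM) (R.p q) →ₗ[ℝ] GT EP q =>
    ∀ v, μ v ∈ V q ∧ (∀ a ∈ V q, R.dp q a.1 = 0 → pairing q (μ v) a = 0) ∧
      R.dp q (μ v).1 = v) ?_ v
  refine exists_orthogonal_section (pairing q) (V q) (R.dp q ∘ₗ LinearMap.fst ℝ _ _)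
    (fun v => ?_) fun a ha ha1 h => hV.vertical_nondegenerate ha ha1 h
  obtain ⟨u, rfl⟩ := R.dp_surjective q v
  obtain ⟨a, ha, rfl⟩ := hV.exists_mem_fst_eq q u
  exact ⟨a, ha, rfl⟩

theorem IsAdmissible.piPerpInv_mem (q : P) (v : TangentSpace 𝓘(ℝ, EM) (R.p q)) :
    R.piPerpInv V q v ∈ V q := (hV.piPerpInv_spec q v).1

theorem IsAdmissible.dp_piPerpInv (q : P) (v : TangentSpace 𝓘(ℝ, EM) (R.p q)) :
    R.dp q (R.piPerpInv V q v).1 = v := (hV.piPerpInv_spec q v).2.2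

/-- Subtracting from `a` the lift of its projection leaves an element of `V₊ ∩ Ker π`, to which the
lift of `v` is orthogonal. -/
theorem IsAdmissible.pairing_piPerpInv {q : P} (v : TangentSpace 𝓘(ℝ, EM) (R.p q)) {a : GT EP q}
    (ha : a ∈ V q) :
    pairing q (R.piPerpInv V q v) a = R.metricAt V q v (R.dp q a.1) := by
  have h := (hV.piPerpInv_spec q v).2.1 (a - R.piPerpInv V q (R.dp q a.1))
    (sub_mem ha (hV.piPerpInv_mem q _)) (by
      change R.dp q (a.1 - _) = 0
      rw [map_sub, hV.dp_piPerpInv, sub_self])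
  rw [map_sub, sub_eq_zero] at h
  exact h

theorem IsAdmissible.eq_piPerpInv {q : P} {a : GT EP q} (ha : a ∈ V q)
    (h : ∀ b ∈ V q, R.dp q b.1 = 0 → pairing q a b = 0) :
    a = R.piPerpInv V q (R.dp q a.1) := by
  rw [← sub_eq_zero]
  refine hV.vertical_nondegenerate (sub_mem ha (hV.piPerpInv_mem q _)) ?_ fun b hb hb1 => ?_
  · change R.dp q (a.1 - _) = 0
    rw [map_sub, hV.dp_piPerpInv, sub_self]
  · rw [map_sub, LinearMap.sub_apply, h b hb hb1, (hV.piPerpInv_spec q _).2.1 b hb hb1, sub_self]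

theorem IsAdmissible.metricAt_symm (q : P) (v w : TangentSpace 𝓘(ℝ, EM) (R.p q)) :
    R.metricAt V q v w = R.metricAt V q w v := pairing_comm _ _ _

theorem IsAdmissible.metricAt_nondegenerate {q : P} {v : TangentSpace 𝓘(ℝ, EM) (R.p q)}
    (h : ∀ w, R.metricAt V q v w = 0) : v = 0 := by
  have h1 : R.piPerpInv V q v = 0 :=
    hV.isGeneralizedMetric.nondegenerate q _ (hV.piPerpInv_mem q v) fun b hb => by
      rw [hV.pairing_piPerpInv v hb, h]
  rw [← hV.dp_piPerpInv q v, h1]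
  exact map_zero _

end Admissible

end

/-! ### Basic smooth sections: `p^* ζ`, anchors and projections. -/

section

/-- A smooth `1`-form, as a function on the tangent bundle, is smooth along smooth maps. -/
theorem _root_.GenGeom.SmoothOneForm.contMDiff_comp
    {ζ : ∀ x : M, Module.Dual ℝ (TangentSpace 𝓘(ℝ, EM) x)} (hζ : SmoothOneForm ζ)
    {Φ : P → TangentBundle 𝓘(ℝ, EM) M}
    (hΦ : ContMDiff 𝓘(ℝ, EP) (𝓘(ℝ, EM)).tangent ∞ Φ) :
    ContMDiff 𝓘(ℝ, EP) 𝓘(ℝ, ℝ) ∞ (fun q => ζ (Φ q).1 (Φ q).2) := by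
  classical
  intro q₀
  have : IsManifold 𝓘(ℝ, EM) (1 + 1) M := IsManifold.of_le (n := ∞) (by
    exact WithTop.coe_le_coe.2 (le_top : (2 : ℕ∞) ≤ ⊤))
  let t := trivializationAt EM (TangentSpace 𝓘(ℝ, EM) : M → Type _) (Φ q₀).1
  obtain ⟨h1, h2⟩ := (Bundle.contMDiffAt_totalSpace (F := EM)
    (E := (TangentSpace 𝓘(ℝ, EM) : M → Type _)) (IB := 𝓘(ℝ, EM))).1 (hΦ q₀)
  let B := Module.finBasis ℝ EM
  let ψ : SmoothBumpFunction 𝓘(ℝ, EM) (Φ q₀).1 := Classical.arbitrary _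
  have : IsManifold 𝓘(ℝ, EM) (∞ + 1) M := by simpa using ‹IsManifold 𝓘(ℝ, EM) ∞ M›
  have ht : t.baseSet = (chartAt EM (Φ q₀).1).source := rfl
  have hfr : ∀ i, SmoothVF (fun y => ψ y • t.localFrame B i y) := fun i =>
    ContMDiffOn.smul_section_of_tsupport (u := (chartAt EM (Φ q₀).1).source)
      ψ.contMDiff.contMDiffOn (chartAt EM (Φ q₀).1).open_source ψ.tsupport_subset_chartAt_source
      (ht ▸ t.contMDiffOn_localFrame_baseSet ∞ B i)
  have hcoord : ∀ i, ContMDiffAt 𝓘(ℝ, EP) 𝓘(ℝ, ℝ) ∞ (fun q => B.coord i (t (Φ q)).2) q₀ :=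
    fun i => (LinearMap.toContinuousLinearMap (B.coord i)).contMDiff.contMDiffAt.comp q₀ h2
  -- A `SmoothOneForm` is tested only on global vector fields, so `Φ` is expanded in the cut-off
  -- frame: smooth coordinates in a trivialization times the values of `ζ` on global smooth fields,
  -- pulled back along the base map of `Φ`.
  have hsum : ContMDiffAt 𝓘(ℝ, EP) 𝓘(ℝ, ℝ) ∞ (fun q => ∑ i, B.coord i (t (Φ q)).2 *
      ζ (Φ q).1 (ψ (Φ q).1 • t.localFrame B i (Φ q).1)) q₀ :=
    contMDiffAt_finsetSum fun i _ => (hcoord i).mul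
      (((hζ _ (hfr i)) (Φ q₀).1).comp q₀ h1)
  refine hsum.congr_of_eventuallyEq ?_
  have hev1 : ∀ᶠ q in nhds q₀, (Φ q).1 ∈ t.baseSet :=
    h1.continuousAt.eventually (t.open_baseSet.mem_nhds (FiberBundle.mem_baseSet_trivializationAt' _))
  have hev2 : ∀ᶠ q in nhds q₀, ψ (Φ q).1 = 1 :=
    h1.continuousAt.eventually ψ.eventuallyEq_one
  filter_upwards [hev1, hev2] with q hq1 hq2
  have hv := t.eq_sum_localFrameCoeff_smul (I := 𝓘(ℝ, EM)) (b := B) hq1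
    (s := Function.update (fun z => (0 : TangentSpace 𝓘(ℝ, EM) z)) (Φ q).1 (Φ q).2)
  have hc : ∀ i, t.localFrameCoeff 𝓘(ℝ, EM) B i (Φ q).1 (Φ q).2 = B.coord i (t (Φ q)).2 := by
    intro i
    have := t.localFrameCoeff_eq_coeff (I := 𝓘(ℝ, EM)) (b := B) (i := i) hq1
      (s := Function.update (fun z => (0 : TangentSpace 𝓘(ℝ, EM) z)) (Φ q).1 (Φ q).2)
    simp only [Function.update_self] at this
    exact this
  simp only [Function.update_self, hc] at hv
  refine (congrArg (ζ (Φ q).1) hv).trans ?_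
  rw [map_sum]
  refine Finset.sum_congr rfl fun i _ => ?_
  rw [map_smul, hq2, one_smul, smul_eq_mul]

variable (R : CourantReduction EM M EG G EP P)

/-- The image in the tangent bundle of `M` of a smooth vector field on `P`. -/
theorem contMDiff_dp {W : ∀ q : P, TangentSpace 𝓘(ℝ, EP) q} (hW : SmoothVF W) :
    ContMDiff 𝓘(ℝ, EP) (𝓘(ℝ, EM)).tangent ∞
      (fun q => (⟨R.p q, R.dp q (W q)⟩ : TangentBundle 𝓘(ℝ, EM) M)) :=
  (R.contMDiff_proj.contMDiff_tangentMap (m := ∞) (by simp)).comp hW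

/-- The section `p^* ζ` of `E`. -/
def cot (ζ : ∀ x : M, Module.Dual ℝ (TangentSpace 𝓘(ℝ, EM) x)) (q : P) : GT EP q :=
  R.cotIncl q (ζ (R.p q))

/-- The two values lie in tangent spaces at points that are equal only propositionally; stating the
equality in `EM` avoids a transport. -/
theorem vf_proj_act (X : ∀ x : M, TangentSpace 𝓘(ℝ, EM) x) (g : G) (q : P) :
    (X (R.p (MulOpposite.op g • q)) : EM) = X (R.p q) := by
  have : ∀ x x' : M, x' = x → (X x' : EM) = X x := by rintro _ _ rfl; rfl
  exact this _ _ (R.principal.proj_act g q)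

theorem dp_dR (g : G) (q : P) (v : TangentSpace 𝓘(ℝ, EP) q) :
    (R.dp (MulOpposite.op g • q) (dR g q v) : EM) = R.dp q v :=
  R.principal.mfderiv_dR g q v

theorem form_proj_act (ζ : ∀ x : M, Module.Dual ℝ (TangentSpace 𝓘(ℝ, EM) x)) (g : G) (q : P)
    (v : EM) : ζ (R.p (MulOpposite.op g • q)) v = ζ (R.p q) v := by
  have : ∀ x x' : M, x' = x → (ζ x' : EM → ℝ) v = ζ x v := by rintro _ _ rfl; rfl
  exact this _ _ (R.principal.proj_act g q)

theorem isSection_cot {ζ : ∀ x : M, Module.Dual ℝ (TangentSpace 𝓘(ℝ, EM) x)}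
    (hζ : SmoothOneForm ζ) : R.IsSection (R.cot ζ) where
  smooth_vector := SmoothVF.zero
  smooth_form := fun _ hW => hζ.contMDiff_comp (R.contMDiff_dp hW)
  invariant := fun g q => by
    refine ⟨(map_zero (dR g q)).symm, fun v => ?_⟩
    refine (R.form_proj_act ζ g q (R.dp (MulOpposite.op g • q) (dR g q v))).trans ?_
    exact congrArg (ζ (R.p q)) (R.dp_dR g q v)
  mem_Kperp := fun q => R.cotIncl_mem_Kperp q _

theorem pairing_cot (ζ : ∀ x : M, Module.Dual ℝ (TangentSpace 𝓘(ℝ, EM) x)) (q : P) (a : GT EP q) :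
    pairing q (R.cot ζ q) a = (1 / 2 : ℝ) * ζ (R.p q) (R.dp q a.1) :=
  R.pairing_cotIncl q _ a

/-- The representative picked by choice lies in the same fibre as `q`, hence is a translate of `q`,
and `hf` compares the values at translates. -/
theorem descend_apply {B : M → Type*} [∀ x, Zero (B x)] (f : ∀ q : P, B (R.p q))
    (hf : ∀ (g : G) (q : P), R.principal.proj_act g q ▸ f (MulOpposite.op g • q) = f q) (q : P) :
    R.descend f (R.p q) = f q := by
  have key : ∀ (q' : P) (h : R.p q' = R.p q), h ▸ f q' = f q := by
    intro q' h
    obtain ⟨g, rfl⟩ := R.principal.exists_act_eq h.symm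
    exact hf g q
  have h : ∃ q', R.p q' = R.p q := ⟨q, rfl⟩
  rw [descend, dif_pos h]
  exact key _ _

theorem anchor_apply {e : ∀ q : P, GT EP q} (he : R.IsSection e) (q : P) :
    R.anchor e (R.p q) = R.dp q (e q).1 := by
  refine R.descend_apply (B := fun x => TangentSpace 𝓘(ℝ, EM) x) _ (fun g q => ?_) q
  have cast : ∀ (x x' : M) (h : x' = x) (v : TangentSpace 𝓘(ℝ, EM) x')
      (w : TangentSpace 𝓘(ℝ, EM) x), (v : EM) = w → h ▸ v = w := by rintro _ _ rfl v w h; exact h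
  refine cast _ _ _ _ _ ?_
  rw [(he.invariant g q).1]
  exact R.dp_dR g q _

theorem smoothVF_anchor {e : ∀ q : P, GT EP q} (he : R.IsSection e) : SmoothVF (R.anchor e) := by
  refine R.principal.contMDiff_of_comp ?_
  convert R.contMDiff_dp he.smooth_vector using 3 with q
  exact R.anchor_apply he q

theorem vf_ext {X Y : ∀ x : M, TangentSpace 𝓘(ℝ, EM) x} (h : ∀ q, X (R.p q) = Y (R.p q)) :
    X = Y := by
  funext x
  obtain ⟨q, rfl⟩ := R.principal.surjective x
  exact h q

theorem anchor_add {e s : ∀ q : P, GT EP q} (he : R.IsSection e) (hs : R.IsSection s) :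
    R.anchor (e + s) = R.anchor e + R.anchor s := by
  refine R.vf_ext fun q => ?_
  refine (R.anchor_apply (he.add hs) q).trans ?_
  refine ((R.dp q).map_add _ _).trans ?_
  exact (congrArg₂ (· + ·) (R.anchor_apply he q) (R.anchor_apply hs q)).symm

theorem anchor_smul {f : M → ℝ} (hf : ContMDiff 𝓘(ℝ, EM) 𝓘(ℝ, ℝ) ∞ f) {e : ∀ q : P, GT EP q}
    (he : R.IsSection e) :
    R.anchor (fun q => f (R.p q) • e q) = fun x => f x • R.anchor e x := by
  refine R.vf_ext fun q => ?_
  refine (R.anchor_apply (he.smul hf) q).trans ?_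
  refine ((R.dp q).map_smul _ _).trans ?_
  exact congrArg (f (R.p q) • ·) (R.anchor_apply he q).symm

/-- The derivative along `e` of a function on `M`. -/
theorem dirDeriv_fst {e : ∀ q : P, GT EP q} (he : R.IsSection e) {f : M → ℝ}
    (hf : ContMDiff 𝓘(ℝ, EM) 𝓘(ℝ, ℝ) ∞ f) (q : P) :
    dirDeriv (fun q => (e q).1) (fun q => f (R.p q)) q = dirDeriv (R.anchor e) f (R.p q) :=
  dirDeriv_comp R.contMDiff_proj (R.anchor_apply he q).symm hf

section Admissible

variable {R} {V : ∀ q : P, Submodule ℝ (GT EP q)} (hV : R.IsAdmissible V)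
include hV

/-- The sections with values in `V₊` span it, with constant rank and a non-degenerate pairing, and
on them the projection of `e` has the same pairings as `e`. -/
theorem IsAdmissible.isSection_projPlus {e : ∀ q : P, GT EP q} (he : R.IsSection e) :
    R.IsSection (projPlus V e) := by
  let S : Set (∀ q : P, GT EP q) := {s | R.IsSection s ∧ ∀ q, s q ∈ V q}
  have hspan : ∀ q, spanAt S q = V q := fun q => by
    refine le_antisymm (spanAt_le fun s hs => hs.2 q) fun a ha => ?_
    obtain ⟨s, hs, hsV, rfl⟩ := hV.isGeneralizedMetric.smooth q a ha
    exact mem_spanAt (S := S) ⟨hs, hsV⟩ q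
  refine R.isSection_of_pairing (S := S) (fun s hs => hs.1) (fun q a ha h => ?_) (fun q q' => ?_)
    (fun q => ?_) (fun s hs => ?_) fun s hs g q => ?_
  · rw [hspan] at ha
    refine hV.isGeneralizedMetric.nondegenerate q a ha fun b hb => ?_
    obtain ⟨s, hs, hsV, rfl⟩ := hV.isGeneralizedMetric.smooth q b hb
    exact h s ⟨hs, hsV⟩
  · rw [hspan, hspan]; exact hV.isGeneralizedMetric.const_rank q q'
  · rw [hspan]; exact hV.projPlus_mem e q
  · simp only [hV.pairing_projPlus e (hs.2 _)]
    exact he.contMDiff_pairing hs.1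
  · rw [hV.pairing_projPlus e (hs.2 _), hV.pairing_projPlus e (hs.2 _), he.pairing_act hs.1]

theorem IsAdmissible.isSection_projMinus {e : ∀ q : P, GT EP q} (he : R.IsSection e) :
    R.IsSection (projMinus V e) :=
  he.sub (hV.isSection_projPlus he)

/-- Every element of a fibre of `E` is the value of a section. -/
theorem IsAdmissible.exists_isSection {q : P} {a : GT EP q} (ha : a ∈ R.Kperp q) :
    ∃ e, R.IsSection e ∧ e q = a := by
  rw [← hV.sup_cotIncl q, Submodule.mem_sup] at ha
  obtain ⟨v, hv, _, ⟨ζ, rfl⟩, rfl⟩ := ha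
  obtain ⟨s, hs, -, rfl⟩ := hV.isGeneralizedMetric.smooth q v hv
  obtain ⟨α, hα, rfl⟩ := exists_smoothOneForm (E := EM) (R.p q) ζ
  exact ⟨s + R.cot α, hs.add (R.isSection_cot hα), rfl⟩

/-- A field with values in `K^⊥` is a section if its pairings with all sections are smooth and
invariant. -/
theorem IsAdmissible.isSection_of_forall {e : ∀ q : P, GT EP q} (he : ∀ q, e q ∈ R.Kperp q)
    (hsm : ∀ s, R.IsSection s → ContMDiff 𝓘(ℝ, EP) 𝓘(ℝ, ℝ) ∞ (fun q => pairing q (e q) (s q)))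
    (hinv : ∀ s, R.IsSection s → ∀ (g : G) (q : P),
      pairing _ (e (MulOpposite.op g • q)) (s (MulOpposite.op g • q)) = pairing q (e q) (s q)) :
    R.IsSection e := by
  have hspan : ∀ q, spanAt {s | R.IsSection s} q = R.Kperp q := fun q => by
    refine le_antisymm (spanAt_le fun s hs => hs.mem_Kperp q) fun a ha => ?_
    obtain ⟨s, hs, rfl⟩ := hV.exists_isSection ha
    exact mem_spanAt (S := {s | R.IsSection s}) hs q
  refine R.isSection_of_pairing (S := {s | R.IsSection s}) (fun s hs => hs) (fun q a ha h => ?_)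
    (fun q q' => ?_) (fun q => ?_) hsm hinv
  · rw [hspan] at ha
    refine R.Kperp_nondegenerate ha fun b hb => ?_
    obtain ⟨s, hs, rfl⟩ := hV.exists_isSection hb
    exact h s hs
  · rw [hspan, hspan, ← hV.rank_eq q, ← hV.rank_eq q', hV.isGeneralizedMetric.const_rank q q']
  · rw [hspan]; exact he q

/-- This turns identities between elements of `E` into identities of functions, where the rules for
the bracket and for derivatives apply. -/
theorem IsAdmissible.ext_pairing {q : P} {a b : GT EP q} (ha : a ∈ R.Kperp q)
    (hb : b ∈ R.Kperp q) (h : ∀ s, R.IsSection s → pairing q a (s q) = pairing q b (s q)) :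
    a = b := by
  rw [← sub_eq_zero]
  refine R.Kperp_nondegenerate (sub_mem ha hb) fun c hc => ?_
  obtain ⟨s, hs, rfl⟩ := hV.exists_isSection hc
  rw [map_sub, LinearMap.sub_apply, h s hs, sub_self]

end Admissible

end

/-! ### The induced metric and splitting, and `E ≅ T ⊕ ad P ⊕ T*`. -/

section

variable (R : CourantReduction EM M EG G EP P)

/-- The lift of a vector field to `V₊`, orthogonal to `Ker π`. -/
def liftPlus (V : ∀ q : P, Submodule ℝ (GT EP q)) (X : ∀ x : M, TangentSpace 𝓘(ℝ, EM) x) (q : P) :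
    GT EP q :=
  R.piPerpInv V q (X (R.p q))

/-- The component in `ad P ≅ V₊ ∩ Ker π` of a section of `E`. -/
def adSec (V : ∀ q : P, Submodule ℝ (GT EP q)) (e : ∀ q : P, GT EP q) : ∀ q : P, GT EP q :=
  e - R.lam V (R.anchor e) - R.cot (R.cotPart V e)

theorem eq_lam_add_adSec_add_cot (V : ∀ q : P, Submodule ℝ (GT EP q))
    (e : ∀ q : P, GT EP q) :
    e = R.lam V (R.anchor e) + R.adSec V e + R.cot (R.cotPart V e) := by
  rw [adSec]; abel

section Admissible

variable {R} {V : ∀ q : P, Submodule ℝ (GT EP q)} (hV : R.IsAdmissible V)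
include hV

/-- Since `p^* ζ` is orthogonal to `Ker π`, its projection to `V₊` is orthogonal to `V₊ ∩ Ker π`.
These projections are smooth and span the complement of `V₊ ∩ Ker π` in `V₊`. -/
theorem IsAdmissible.projPlus_cot (ζ : ∀ x : M, Module.Dual ℝ (TangentSpace 𝓘(ℝ, EM) x)) (q : P) :
    projPlus V (R.cot ζ) q = R.piPerpInv V q (R.dp q (projPlus V (R.cot ζ) q).1) := by
  refine hV.eq_piPerpInv (hV.projPlus_mem _ q) fun b hb hb1 => ?_
  rw [hV.pairing_projPlus _ hb, pairing_cot, hb1, map_zero, mul_zero]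

theorem IsAdmissible.pairing_piPerpInv_projPlus_cot
    (ζ : ∀ x : M, Module.Dual ℝ (TangentSpace 𝓘(ℝ, EM) x)) (q : P)
    (v : TangentSpace 𝓘(ℝ, EM) (R.p q)) :
    pairing q (R.piPerpInv V q v) (projPlus V (R.cot ζ) q) = (1 / 2 : ℝ) * ζ (R.p q) v := by
  rw [pairing_comm, hV.pairing_projPlus _ (hV.piPerpInv_mem q v), pairing_cot, hV.dp_piPerpInv]

theorem IsAdmissible.piPerpInv_eq_projPlus_cot
    {ζ : ∀ x : M, Module.Dual ℝ (TangentSpace 𝓘(ℝ, EM) x)} {q : P}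
    {v : TangentSpace 𝓘(ℝ, EM) (R.p q)} (h : ∀ w, ζ (R.p q) w = 2 * R.metricAt V q v w) :
    projPlus V (R.cot ζ) q = R.piPerpInv V q v := by
  refine hV.projPlus_eq (hV.piPerpInv_mem q v) fun b hb => ?_
  rw [map_sub, LinearMap.sub_apply, pairing_cot, hV.pairing_piPerpInv v hb, h]
  ring

/-- The lifts take values in the bundle spanned by the projections of the `p^* ζ`, of rank `dim M`,
and pair with these to the smooth functions `ζ(X) / 2`. The criterion by pairings gives smoothness
and invariance together. -/
theorem IsAdmissible.isSection_liftPlus {X : ∀ x : M, TangentSpace 𝓘(ℝ, EM) x}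
    (hX : SmoothVF X) : R.IsSection (R.liftPlus V X) := by
  let S : Set (∀ q : P, GT EP q) := {s | ∃ ζ, SmoothOneForm ζ ∧ s = projPlus V (R.cot ζ)}
  have hspan : ∀ q, spanAt S q = LinearMap.range (R.piPerpInv V q) := fun q => by
    refine le_antisymm (spanAt_le ?_) ?_
    · rintro _ ⟨ζ, -, rfl⟩
      exact ⟨_, (hV.projPlus_cot ζ q).symm⟩
    · rintro _ ⟨v, rfl⟩
      obtain ⟨ζ, hζ, hζv⟩ := exists_smoothOneForm (E := EM) (R.p q)
        ((2 : ℝ) • R.metricAt V q v)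
      rw [← hV.piPerpInv_eq_projPlus_cot (ζ := ζ) fun w => by rw [hζv]; rfl]
      exact mem_spanAt (S := S) ⟨ζ, hζ, rfl⟩ q
  have hpair : ∀ (ζ : ∀ x : M, Module.Dual ℝ (TangentSpace 𝓘(ℝ, EM) x)) (q : P),
      pairing q (R.liftPlus V X q) (projPlus V (R.cot ζ) q)
        = (1 / 2 : ℝ) * ζ (R.p q) (X (R.p q)) := fun ζ q =>
    hV.pairing_piPerpInv_projPlus_cot ζ q _
  refine R.isSection_of_pairing (S := S) ?_ (fun q a ha h => ?_) (fun q q' => ?_)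
    (fun q => ?_) ?_ ?_
  · rintro _ ⟨ζ, hζ, rfl⟩
    exact hV.isSection_projPlus (R.isSection_cot hζ)
  · rw [hspan] at ha
    obtain ⟨v, rfl⟩ := ha
    have : v = 0 := by
      refine (Module.forall_dual_apply_eq_zero_iff ℝ _).1 fun η => ?_
      obtain ⟨ζ, hζ, rfl⟩ := exists_smoothOneForm (E := EM) (R.p q) η
      have := h _ ⟨ζ, hζ, rfl⟩
      rw [hV.pairing_piPerpInv_projPlus_cot] at this
      linarith
    rw [this, map_zero]
  · have : ∀ q, Module.finrank ℝ (spanAt S q) = Module.finrank ℝ EM := fun q => by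
      rw [hspan]
      refine LinearMap.finrank_range_of_inj fun v w h => ?_
      rw [← hV.dp_piPerpInv q v, h, hV.dp_piPerpInv]
    rw [this, this]
  · rw [hspan]; exact ⟨_, rfl⟩
  · rintro _ ⟨ζ, hζ, rfl⟩
    simp only [hpair]
    exact contMDiff_const.mul ((hζ X hX).comp R.contMDiff_proj)
  · rintro _ ⟨ζ, hζ, rfl⟩ g q
    rw [hpair, hpair]
    exact congrArg (fun x => (1 / 2 : ℝ) * ζ x (X x)) (R.principal.proj_act g q)

theorem IsAdmissible.metric_apply (q : P) : R.metric V (R.p q) = R.metricAt V q := by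
  refine R.descend_apply (B := fun x => TangentSpace 𝓘(ℝ, EM) x →ₗ[ℝ]
    TangentSpace 𝓘(ℝ, EM) x →ₗ[ℝ] ℝ) _ (fun g q => ?_) q
  have cast : ∀ (x x' : M) (h : x' = x)
      (β : TangentSpace 𝓘(ℝ, EM) x' →ₗ[ℝ] TangentSpace 𝓘(ℝ, EM) x' →ₗ[ℝ] ℝ)
      (γ : TangentSpace 𝓘(ℝ, EM) x →ₗ[ℝ] TangentSpace 𝓘(ℝ, EM) x →ₗ[ℝ] ℝ),
      (∀ u v : EM, β u v = γ u v) → h ▸ β = γ := by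
    rintro _ _ rfl β γ h
    exact LinearMap.ext₂ h
  refine cast _ _ _ _ _ fun u v => ?_
  obtain ⟨X, hX, hXu⟩ := exists_smoothVF (E := EM) (R.p q) u
  obtain ⟨Y, hY, hYv⟩ := exists_smoothVF (E := EM) (R.p q) v
  -- At each point of the fibre the metric is the pairing of two invariant sections, so it takes the
  -- same values at `q` and `q · g`.
  have h := (hV.isSection_liftPlus hX).pairing_act (hV.isSection_liftPlus hY) g q
  have hX' : (X (R.p (MulOpposite.op g • q)) : EM) = u := (R.vf_proj_act X g q).trans hXu
  have hY' : (Y (R.p (MulOpposite.op g • q)) : EM) = v := (R.vf_proj_act Y g q).trans hYv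
  have h1 : R.metricAt V (MulOpposite.op g • q) (X (R.p (MulOpposite.op g • q)))
    (Y (R.p (MulOpposite.op g • q))) = R.metricAt V q (X (R.p q)) (Y (R.p q)) := h
  rw [hXu, hYv] at h1
  refine Eq.trans ?_ h1
  exact congrArg₂ (fun a b : EM => R.metricAt V (MulOpposite.op g • q) a b) hX'.symm hY'.symm

theorem IsAdmissible.contMDiff_metric {X Y : ∀ x : M, TangentSpace 𝓘(ℝ, EM) x}
    (hX : SmoothVF X) (hY : SmoothVF Y) :
    ContMDiff 𝓘(ℝ, EM) 𝓘(ℝ, ℝ) ∞ (fun x => R.metric V x (X x) (Y x)) := by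
  refine R.principal.contMDiff_of_comp ?_
  simp only [hV.metric_apply]
  exact (hV.isSection_liftPlus hX).contMDiff_pairing (hV.isSection_liftPlus hY)

theorem IsAdmissible.smoothOneForm_metric {X : ∀ x : M, TangentSpace 𝓘(ℝ, EM) x}
    (hX : SmoothVF X) : SmoothOneForm (fun x => R.metric V x (X x)) :=
  fun _ hY => hV.contMDiff_metric hX hY

theorem IsAdmissible.metric_symm (x : M) (v w : TangentSpace 𝓘(ℝ, EM) x) :
    R.metric V x v w = R.metric V x w v := by
  obtain ⟨q, rfl⟩ := R.principal.surjective x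
  rw [hV.metric_apply]
  exact hV.metricAt_symm q v w

theorem IsAdmissible.metric_nondegenerate {x : M} {v : TangentSpace 𝓘(ℝ, EM) x}
    (h : ∀ w, R.metric V x v w = 0) : v = 0 := by
  obtain ⟨q, rfl⟩ := R.principal.surjective x
  rw [hV.metric_apply] at h
  exact hV.metricAt_nondegenerate h

theorem IsAdmissible.lam_eq (X : ∀ x : M, TangentSpace 𝓘(ℝ, EM) x) :
    R.lam V X = R.liftPlus V X - R.cot (fun x => R.metric V x (X x)) := by
  funext q
  change R.piPerpInv V q (X (R.p q)) - R.cotIncl q (R.metricAt V q (X (R.p q)))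
    = R.piPerpInv V q (X (R.p q)) - R.cotIncl q (R.metric V (R.p q) (X (R.p q)))
  rw [hV.metric_apply]

theorem IsAdmissible.isSection_lam {X : ∀ x : M, TangentSpace 𝓘(ℝ, EM) x}
    (hX : SmoothVF X) : R.IsSection (R.lam V X) := by
  rw [hV.lam_eq]
  exact (hV.isSection_liftPlus hX).sub (R.isSection_cot (hV.smoothOneForm_metric hX))

theorem IsAdmissible.dp_splitting (q : P) (v : TangentSpace 𝓘(ℝ, EM) (R.p q)) :
    R.dp q (R.splitting V q v).1 = v := by
  change R.dp q ((R.piPerpInv V q v).1 - 0) = v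
  rw [sub_zero, hV.dp_piPerpInv]

theorem IsAdmissible.pairing_splitting_of_mem {q : P} (v : TangentSpace 𝓘(ℝ, EM) (R.p q))
    {a : GT EP q} (ha : a ∈ V q) :
    pairing q (R.splitting V q v) a = (1 / 2 : ℝ) * R.metricAt V q v (R.dp q a.1) := by
  change pairing q (R.piPerpInv V q v - R.cotIncl q (R.metricAt V q v)) a = _
  rw [map_sub, LinearMap.sub_apply, hV.pairing_piPerpInv v ha, pairing_cotIncl]
  ring

theorem IsAdmissible.pairing_splitting_splitting (q : P) (v w : TangentSpace 𝓘(ℝ, EM) (R.p q)) :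
    pairing q (R.splitting V q v) (R.splitting V q w) = 0 := by
  change pairing q (R.splitting V q v) (R.piPerpInv V q w - R.cotIncl q (R.metricAt V q w)) = _
  rw [map_sub, hV.pairing_splitting_of_mem v (hV.piPerpInv_mem q w), pairing_comm _ _ (R.cotIncl _ _),
    pairing_cotIncl, hV.dp_piPerpInv, hV.dp_splitting, hV.metricAt_symm q w v, sub_self]

theorem IsAdmissible.anchor_lam {X : ∀ x : M, TangentSpace 𝓘(ℝ, EM) x} (hX : SmoothVF X) :
    R.anchor (R.lam V X) = X :=
  R.vf_ext fun q => (R.anchor_apply (hV.isSection_lam hX) q).trans (hV.dp_splitting q _)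

theorem IsAdmissible.cotPart_apply {e : ∀ q : P, GT EP q} (he : R.IsSection e) (q : P)
    (v : TangentSpace 𝓘(ℝ, EM) (R.p q)) :
    R.cotPart V e (R.p q) v = 2 * pairing q (e q) (R.splitting V q v) := by
  have key : R.cotPart V e (R.p q) = (2 : ℝ) • (pairing q (e q) ∘ₗ R.splitting V q) := by
    refine R.descend_apply (B := fun x => Module.Dual ℝ (TangentSpace 𝓘(ℝ, EM) x)) _
      (fun g q => ?_) q
    have cast : ∀ (x x' : M) (h : x' = x) (β : Module.Dual ℝ (TangentSpace 𝓘(ℝ, EM) x'))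
        (γ : Module.Dual ℝ (TangentSpace 𝓘(ℝ, EM) x)), (∀ u : EM, β u = γ u) → h ▸ β = γ := by
      rintro _ _ rfl β γ h
      exact LinearMap.ext h
    refine cast _ _ _ _ _ fun u => ?_
    obtain ⟨X, hX, hXu⟩ := exists_smoothVF (E := EM) (R.p q) u
    have hX' : (X (R.p (MulOpposite.op g • q)) : EM) = u := (R.vf_proj_act X g q).trans hXu
    have h := he.pairing_act (hV.isSection_lam hX) g q
    have h1 : (2 : ℝ) * pairing _ (e (MulOpposite.op g • q))
        (R.splitting V (MulOpposite.op g • q) (X (R.p (MulOpposite.op g • q))))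
        = 2 * pairing q (e q) (R.splitting V q (X (R.p q))) := congrArg (2 * ·) h
    rw [hXu] at h1
    refine Eq.trans ?_ h1
    exact congrArg (fun a : EM => (2 : ℝ) * pairing _ (e (MulOpposite.op g • q))
      (R.splitting V (MulOpposite.op g • q) a)) hX'.symm
  rw [key]; rfl

theorem IsAdmissible.smoothOneForm_cotPart {e : ∀ q : P, GT EP q} (he : R.IsSection e) :
    SmoothOneForm (R.cotPart V e) := by
  intro X hX
  refine R.principal.contMDiff_of_comp ?_
  simp only [hV.cotPart_apply he]
  exact contMDiff_const.mul (he.contMDiff_pairing (hV.isSection_lam hX))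

theorem IsAdmissible.isSection_adSec {e : ∀ q : P, GT EP q} (he : R.IsSection e) :
    R.IsSection (R.adSec V e) :=
  (he.sub (hV.isSection_lam (R.smoothVF_anchor he))).sub
    (R.isSection_cot (hV.smoothOneForm_cotPart he))

theorem IsAdmissible.adSec_fst {e : ∀ q : P, GT EP q} (he : R.IsSection e) (q : P) :
    (R.adSec V e q).1 = R.adPart V e q := by
  change (e q).1 - (R.splitting V q (R.anchor e (R.p q))).1 - 0
    = (e q).1 - (R.splitting V q (R.dp q (e q).1)).1
  rw [sub_zero, R.anchor_apply he]

theorem IsAdmissible.dp_adSec {e : ∀ q : P, GT EP q} (he : R.IsSection e) (q : P) :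
    R.dp q (R.adSec V e q).1 = 0 := by
  rw [hV.adSec_fst he]
  change R.dp q ((e q).1 - (R.splitting V q (R.dp q (e q).1)).1) = 0
  rw [map_sub, hV.dp_splitting, sub_self]

theorem IsAdmissible.pairing_adSec_splitting {e : ∀ q : P, GT EP q} (he : R.IsSection e) (q : P)
    (v : TangentSpace 𝓘(ℝ, EM) (R.p q)) :
    pairing q (R.adSec V e q) (R.splitting V q v) = 0 := by
  change pairing q (e q - R.splitting V q (R.anchor e (R.p q)) - R.cot (R.cotPart V e) q) _ = 0
  rw [map_sub, map_sub, LinearMap.sub_apply, LinearMap.sub_apply, hV.pairing_splitting_splitting,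
    pairing_cot, hV.dp_splitting, hV.cotPart_apply he]
  ring

/-- The element of `V₊` with the same vector part differs from `a` by some `p^* ζ`. It pairs to zero
with `λ(v)` because it is vertical, and so does `a`; hence `ζ = 0`. -/
theorem IsAdmissible.mem_of_vertical {q : P} {a : GT EP q} (ha : a ∈ R.Kperp q)
    (ha1 : R.dp q a.1 = 0) (h : ∀ v, pairing q a (R.splitting V q v) = 0) : a ∈ V q := by
  obtain ⟨b, hb, hba⟩ := hV.exists_mem_fst_eq q a.1
  obtain ⟨ζ, hζ⟩ := R.exists_eq_cotIncl (sub_mem ha (hV.le_Kperp q hb))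
    (show a.1 - b.1 = 0 by rw [hba, sub_self])
  have : ζ = 0 := by
    ext v
    have h1 := R.pairing_cotIncl q ζ (R.splitting V q v)
    rw [hζ, map_sub, LinearMap.sub_apply, h, pairing_comm, hV.pairing_splitting_of_mem v hb, hba,
      ha1, map_zero, hV.dp_splitting] at h1
    simp only [LinearMap.zero_apply]
    linarith
  rw [this, map_zero] at hζ
  rw [sub_eq_zero.1 hζ.symm]; exact hb

theorem IsAdmissible.adSec_mem {e : ∀ q : P, GT EP q} (he : R.IsSection e) (q : P) :
    R.adSec V e q ∈ V q :=
  hV.mem_of_vertical ((hV.isSection_adSec he).mem_Kperp q) (hV.dp_adSec he q)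
    (hV.pairing_adSec_splitting he q)

/-- The pairing in the decomposition `E ≅ T ⊕ ad P ⊕ T*`. -/
theorem IsAdmissible.pairing_eq {e s : ∀ q : P, GT EP q} (he : R.IsSection e)
    (hs : R.IsSection s) (q : P) :
    pairing q (e q) (s q) = (1 / 2 : ℝ) * (R.cotPart V e (R.p q) (R.anchor s (R.p q))
      + R.cotPart V s (R.p q) (R.anchor e (R.p q)))
      + pairing q (R.adSec V e q) (R.adSec V s q) := by
  have h1 : pairing q (e q) (s q) = pairing q (e q) (R.splitting V q (R.anchor s (R.p q)))
      + pairing q (e q) (R.adSec V s q) + pairing q (e q) (R.cot (R.cotPart V s) q) := by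
    conv_lhs => rw [congrFun (R.eq_lam_add_adSec_add_cot V s) q]
    exact (map_add _ _ _).trans (congrArg (· + _) (map_add _ _ _))
  have h2 : pairing q (e q) (R.adSec V s q) = pairing q (R.adSec V e q) (R.adSec V s q) := by
    conv_lhs => rw [congrFun (R.eq_lam_add_adSec_add_cot V e) q]
    change pairing q (R.splitting V q _ + _ + R.cot _ q) _ = _
    rw [map_add, map_add, LinearMap.add_apply, LinearMap.add_apply, pairing_cot,
      pairing_comm _ (R.splitting V q _), hV.pairing_adSec_splitting hs, hV.dp_adSec hs, map_zero]
    ring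
  rw [h1, h2, hV.cotPart_apply he, pairing_comm _ _ (R.cot _ q), pairing_cot, R.anchor_apply he]
  ring

/-- Write `e` as the lift of its anchor to `V₊`, plus its `ad P` part, plus an element of `T*`. The
first two lie in `V₊`, and the last one is in `V₊` only if it vanishes. -/
theorem IsAdmissible.mem_iff {e : ∀ q : P, GT EP q} (he : R.IsSection e) (q : P) :
    e q ∈ V q ↔ R.cotPart V e (R.p q) = R.metric V (R.p q) (R.anchor e (R.p q)) := by
  have h : e q = R.liftPlus V (R.anchor e) q + R.adSec V e q
      + R.cotIncl q (R.cotPart V e (R.p q) - R.metric V (R.p q) (R.anchor e (R.p q))) := by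
    conv_lhs => rw [congrFun (R.eq_lam_add_adSec_add_cot V e) q, hV.lam_eq]
    rw [map_sub]
    change R.liftPlus V (R.anchor e) q - R.cotIncl q _ + R.adSec V e q + R.cotIncl q _ = _
    abel
  have hm : R.liftPlus V (R.anchor e) q + R.adSec V e q ∈ V q :=
    add_mem (hV.piPerpInv_mem q _) (hV.adSec_mem he q)
  constructor
  · intro hmem
    rw [h] at hmem
    have h0 : R.cotIncl q (R.cotPart V e (R.p q) - R.metric V (R.p q) (R.anchor e (R.p q)))
        ∈ V q ⊓ LinearMap.range (R.cotIncl q) := ⟨(Submodule.add_mem_iff_right _ hm).1 hmem, _, rfl⟩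
    rw [hV.inf_cotangent q] at h0
    exact sub_eq_zero.1 (R.cotIncl_injective q (h0.trans (map_zero _).symm))
  · intro h0
    rw [h, h0, sub_self, map_zero, add_zero]
    exact hm

end Admissible

end

/-! ### The Dorfman bracket on invariant sections of `K^⊥`. -/

section

variable (R : CourantReduction EM M EG G EP P)

theorem Hhat_eq_update (q : P) (u v w : TangentSpace 𝓘(ℝ, EP) q) :
    R.Hhat q ![u, v, w] = R.Hhat q (Function.update ![u, v, 0] 2 w) := by
  congr 1
  funext i
  fin_cases i <;> rfl

theorem Hhat_add (q : P) (u v w w' : TangentSpace 𝓘(ℝ, EP) q) :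
    R.Hhat q ![u, v, w + w'] = R.Hhat q ![u, v, w] + R.Hhat q ![u, v, w'] := by
  simp only [R.Hhat_eq_update q u v]
  exact (R.Hhat q).map_update_add _ _ _ _

theorem Hhat_smul (q : P) (u v w : TangentSpace 𝓘(ℝ, EP) q) (c : ℝ) :
    R.Hhat q ![u, v, c • w] = c * R.Hhat q ![u, v, w] := by
  simp only [R.Hhat_eq_update q u v]
  exact (R.Hhat q).map_update_smul _ _ _ _

theorem Hhat_swap_left (q : P) (u v w : TangentSpace 𝓘(ℝ, EP) q) :
    R.Hhat q ![v, u, w] = - R.Hhat q ![u, v, w] := by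
  rw [← (R.Hhat q).map_swap ![u, v, w] (i := 0) (j := 1) (by decide)]
  congr 1
  funext i
  fin_cases i <;> rfl

theorem Hhat_swap_right (q : P) (u v w : TangentSpace 𝓘(ℝ, EP) q) :
    R.Hhat q ![u, w, v] = - R.Hhat q ![u, v, w] := by
  rw [← (R.Hhat q).map_swap ![u, v, w] (i := 1) (j := 2) (by decide)]
  congr 1
  funext i
  fin_cases i <;> rfl

/-- A smooth section of `TP ⊕ T*P`. -/
structure IsSmoothGT (e : ∀ q : P, GT EP q) : Prop where
  smooth_vector : SmoothVF (fun q => (e q).1)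
  smooth_form : SmoothOneForm (fun q => (e q).2)

theorem IsSection.isSmoothGT {R : CourantReduction EM M EG G EP P} {e : ∀ q : P, GT EP q}
    (he : R.IsSection e) : IsSmoothGT e :=
  ⟨he.smooth_vector, he.smooth_form⟩

theorem isSmoothGT_rho (z : GroupLieAlgebra 𝓘(ℝ, EG) G) : IsSmoothGT (R.rho z) :=
  ⟨R.principal.smoothVF_fundamentalVF z, R.xi_smooth z⟩

/-- The non-tensorial terms in `W` come from the derivatives and brackets, and they cancel; hence
the functional is represented by a covector. -/
theorem dorfman_snd {e₁ e₂ : ∀ q : P, GT EP q} (h₁ : IsSmoothGT e₁) (h₂ : IsSmoothGT e₂)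
    {W : ∀ q : P, TangentSpace 𝓘(ℝ, EP) q} (hW : SmoothVF W) (q : P) :
    (R.dorfman e₁ e₂ q).2 (W q) =
      dirDeriv (fun q => (e₁ q).1) (fun q => (e₂ q).2 (W q)) q
        - (e₂ q).2 (lie (fun q => (e₁ q).1) W q)
        - (dirDeriv (fun q => (e₂ q).1) (fun q => (e₁ q).2 (W q)) q
          - dirDeriv W (fun q => (e₁ q).2 (e₂ q).1) q
          - (e₁ q).2 (lie (fun q => (e₂ q).1) W q))
        + R.Hhat q ![(e₁ q).1, (e₂ q).1, W q] := by
  refine covectorOf_apply q (exists_covector q _ ?_ ?_) hW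
  · intro X Y hX hY
    simp only [lieDerivOne, extDerivOne]
    have e1 : ∀ α : ∀ q : P, Module.Dual ℝ (TangentSpace 𝓘(ℝ, EP) q), SmoothOneForm α →
        ∀ U : ∀ q : P, TangentSpace 𝓘(ℝ, EP) q,
        dirDeriv U (fun y => α y ((X + Y) y)) q
          = dirDeriv U (fun y => α y (X y)) q + dirDeriv U (fun y => α y (Y y)) q := by
      intro α hα U
      rw [← dirDeriv_add U (hα X hX) (hα Y hY)]
      congr 1
      funext y
      exact map_add _ _ _
    rw [e1 _ h₂.smooth_form, e1 _ h₁.smooth_form, lie_add_right _ hX hY, lie_add_right _ hX hY,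
      dirDeriv_add_field]
    simp only [Pi.add_apply, map_add, Hhat_add]
    ring
  · intro f X hf hX
    simp only [lieDerivOne, extDerivOne]
    have e1 : ∀ α : ∀ q : P, Module.Dual ℝ (TangentSpace 𝓘(ℝ, EP) q), SmoothOneForm α →
        ∀ U : ∀ q : P, TangentSpace 𝓘(ℝ, EP) q,
        dirDeriv U (fun y => α y (f y • X y)) q
          = dirDeriv U f q * α q (X q) + f q * dirDeriv U (fun y => α y (X y)) q := by
      intro α hα U
      rw [← dirDeriv_mul U hf (hα X hX)]
      congr 1
      funext y
      exact map_smul _ _ _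
    rw [e1 _ h₂.smooth_form, e1 _ h₁.smooth_form, lie_smul_right hf _ hX, lie_smul_right hf _ hX,
      dirDeriv_smul_field]
    simp only [map_add, map_smul, smul_eq_mul, Hhat_smul]
    ring

/-- A formula in which the three arguments play comparable roles: the identities of the bracket
follow by permuting them. -/
theorem two_mul_pairing_dorfman {e₁ e₂ e₃ : ∀ q : P, GT EP q} (h₁ : IsSmoothGT e₁)
    (h₂ : IsSmoothGT e₂) (h₃ : IsSmoothGT e₃) (q : P) :
    2 * pairing q (R.dorfman e₁ e₂ q) (e₃ q) =
      (e₃ q).2 (lie (fun q => (e₁ q).1) (fun q => (e₂ q).1) q)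
      - (e₂ q).2 (lie (fun q => (e₁ q).1) (fun q => (e₃ q).1) q)
      + (e₁ q).2 (lie (fun q => (e₂ q).1) (fun q => (e₃ q).1) q)
      + dirDeriv (fun q => (e₁ q).1) (fun q => (e₂ q).2 (e₃ q).1) q
      - dirDeriv (fun q => (e₂ q).1) (fun q => (e₁ q).2 (e₃ q).1) q
      + dirDeriv (fun q => (e₃ q).1) (fun q => (e₁ q).2 (e₂ q).1) q
      + R.Hhat q ![(e₁ q).1, (e₂ q).1, (e₃ q).1] := by
  rw [pairing_apply, R.dorfman_snd h₁ h₂ h₃.smooth_vector q]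
  change 2 * ((1 / 2 : ℝ) * (_ + (e₃ q).2 (lie (fun q => (e₁ q).1) (fun q => (e₂ q).1) q))) = _
  ring

theorem dirDeriv_pairing {e s : ∀ q : P, GT EP q} (he : IsSmoothGT e) (hs : IsSmoothGT s)
    (X : ∀ q : P, TangentSpace 𝓘(ℝ, EP) q) (q : P) :
    dirDeriv X (fun q => pairing q (e q) (s q)) q = (1 / 2 : ℝ) *
      (dirDeriv X (fun q => (e q).2 (s q).1) q + dirDeriv X (fun q => (s q).2 (e q).1) q) := by
  rw [← dirDeriv_add X (he.smooth_form _ hs.smooth_vector) (hs.smooth_form _ he.smooth_vector)]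
  exact dirDeriv_const_mul X _
    ((he.smooth_form _ hs.smooth_vector).add (hs.smooth_form _ he.smooth_vector)) q

theorem lie_swap_apply {q : P} (α : Module.Dual ℝ (TangentSpace 𝓘(ℝ, EP) q))
    (X Y : ∀ q : P, TangentSpace 𝓘(ℝ, EP) q) : α (lie X Y q) = - α (lie Y X q) := by
  rw [lie_swap X Y q, map_neg]

/-- Under the exchange of `e₁` and `e₂` the bracket and `Hhat` terms change sign, and the surviving
derivatives assemble to that of the pairing. -/
theorem pairing_dorfman_add_swap {e₁ e₂ e₃ : ∀ q : P, GT EP q} (h₁ : IsSmoothGT e₁)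
    (h₂ : IsSmoothGT e₂) (h₃ : IsSmoothGT e₃) (q : P) :
    pairing q (R.dorfman e₁ e₂ q) (e₃ q) + pairing q (R.dorfman e₂ e₁ q) (e₃ q)
      = dirDeriv (fun q => (e₃ q).1) (fun q => pairing q (e₁ q) (e₂ q)) q := by
  have a := R.two_mul_pairing_dorfman h₁ h₂ h₃ q
  have b := R.two_mul_pairing_dorfman h₂ h₁ h₃ q
  rw [R.Hhat_swap_left, lie_swap_apply _ (fun q => (e₂ q).1) (fun q => (e₁ q).1)] at b
  rw [dirDeriv_pairing h₁ h₂]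
  linarith

/-- The same cancellation for the exchange of `e₂` and `e₃`: the bracket acts by derivations of the
pairing. -/
theorem pairing_dorfman_add_pairing {e₁ e₂ e₃ : ∀ q : P, GT EP q} (h₁ : IsSmoothGT e₁)
    (h₂ : IsSmoothGT e₂) (h₃ : IsSmoothGT e₃) (q : P) :
    pairing q (R.dorfman e₁ e₂ q) (e₃ q) + pairing q (R.dorfman e₁ e₃ q) (e₂ q)
      = dirDeriv (fun q => (e₁ q).1) (fun q => pairing q (e₂ q) (e₃ q)) q := by
  have a := R.two_mul_pairing_dorfman h₁ h₂ h₃ q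
  have b := R.two_mul_pairing_dorfman h₁ h₃ h₂ q
  rw [R.Hhat_swap_right, lie_swap_apply _ (fun q => (e₃ q).1) (fun q => (e₂ q).1)] at b
  rw [dirDeriv_pairing h₂ h₃]
  linarith

theorem lie_act (R : CourantReduction EM M EG G EP P)
    {X Y : ∀ q : P, TangentSpace 𝓘(ℝ, EP) q} (hX : SmoothVF X) (hY : SmoothVF Y)
    (hXi : ∀ (g : G) q, X (MulOpposite.op g • q) = dR g q (X q))
    (hYi : ∀ (g : G) q, Y (MulOpposite.op g • q) = dR g q (Y q)) (g : G) (q : P) :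
    lie X Y (MulOpposite.op g • q) = dR g q (lie X Y q) :=
  (mfderiv_lie (R.principal.contMDiff_act g) hX hY hX hY (fun q => (hXi g q).symm)
    (fun q => (hYi g q).symm) q).symm

theorem dp_lie {e s : ∀ q : P, GT EP q} (he : R.IsSection e) (hs : R.IsSection s) (q : P) :
    R.dp q (lie (fun q => (e q).1) (fun q => (s q).1) q)
      = lie (R.anchor e) (R.anchor s) (R.p q) :=
  mfderiv_lie R.contMDiff_proj he.smooth_vector hs.smooth_vector (R.smoothVF_anchor he)
    (R.smoothVF_anchor hs) (fun q => (R.anchor_apply he q).symm)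
    (fun q => (R.anchor_apply hs q).symm) q

/-- The derivative of an invariant function along an invariant vector field is invariant. -/
theorem dirDeriv_act {e : ∀ q : P, GT EP q} (he : R.IsSection e) {f : P → ℝ}
    (hf : ContMDiff 𝓘(ℝ, EP) 𝓘(ℝ, ℝ) ∞ f)
    (hinv : ∀ (g : G) (q : P), f (MulOpposite.op g • q) = f q) (g : G) (q : P) :
    dirDeriv (fun q => (e q).1) f (MulOpposite.op g • q) = dirDeriv (fun q => (e q).1) f q := by
  obtain ⟨h, hh, hfh⟩ := R.exists_eq_comp_proj hf hinv
  obtain rfl : f = fun q => h (R.p q) := funext hfh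
  rw [R.dirDeriv_fst he hh, R.dirDeriv_fst he hh, R.principal.proj_act]

theorem dirDeriv_eq_zero_of_dp {X : ∀ q : P, TangentSpace 𝓘(ℝ, EP) q} {f : P → ℝ}
    (hf : ContMDiff 𝓘(ℝ, EP) 𝓘(ℝ, ℝ) ∞ f)
    (hinv : ∀ (g : G) (q : P), f (MulOpposite.op g • q) = f q) {q : P} (hX : R.dp q (X q) = 0) :
    dirDeriv X f q = 0 := by
  obtain ⟨h, hh, hfh⟩ := R.exists_eq_comp_proj hf hinv
  obtain rfl : f = fun q => h (R.p q) := funext hfh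
  refine (dirDeriv_comp R.contMDiff_proj (Y := 0) hX hh).trans ?_
  exact map_zero (mfderiv 𝓘(ℝ, EM) 𝓘(ℝ, ℝ) h (R.p q))

theorem IsSection.form_act {R : CourantReduction EM M EG G EP P} {e s : ∀ q : P, GT EP q}
    (he : R.IsSection e) (hs : R.IsSection s) (g : G) (q : P) :
    (e (MulOpposite.op g • q)).2 (s (MulOpposite.op g • q)).1 = (e q).2 (s q).1 := by
  rw [(hs.invariant g q).1, (he.invariant g q).2]

/-- The functions `⟨e, ρ(z)⟩` and `⟨s, ρ(z)⟩` vanish, so the two symmetry rules replace the claim by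
`⟨[ρ(z), e], s⟩ = 0`. There, by invariance, the brackets with `Y_z` and the derivative along `Y_z`
are zero, and the rest is the difference of `i_{Y_z} Hhat` and `dξ_z`. -/
theorem pairing_dorfman_rho {e s : ∀ q : P, GT EP q} (he : R.IsSection e) (hs : R.IsSection s)
    (z : GroupLieAlgebra 𝓘(ℝ, EG) G) (q : P) :
    pairing q (R.dorfman e s q) (R.rho z q) = 0 := by
  have hz := R.isSmoothGT_rho z
  have h1 := R.pairing_dorfman_add_pairing he.isSmoothGT hs.isSmoothGT hz q
  have h2 := R.pairing_dorfman_add_swap he.isSmoothGT hz hs.isSmoothGT q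
  have e1 : (fun q => pairing q (s q) (R.rho z q)) = fun _ => 0 :=
    funext fun q => hs.mem_Kperp q z
  have e2 : (fun q => pairing q (e q) (R.rho z q)) = fun _ => 0 :=
    funext fun q => he.mem_Kperp q z
  rw [e1, dirDeriv_const] at h1
  rw [e2, dirDeriv_const] at h2
  have h3 := R.two_mul_pairing_dorfman hz he.isSmoothGT hs.isSmoothGT q
  have l1 := R.principal.lie_fundamentalVF_eq_zero z he.smooth_vector
    (fun g q => (he.invariant g q).1) q
  have l2 := R.principal.lie_fundamentalVF_eq_zero z hs.smooth_vector
    (fun g q => (hs.invariant g q).1) q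
  have d1 : dirDeriv (fun q => (R.rho z q).1) (fun q => (e q).2 (s q).1) q = 0 :=
    R.dirDeriv_eq_zero_of_dp (he.smooth_form _ hs.smooth_vector) (he.form_act hs)
      (R.dp_fundamentalVF z q)
  have d2 := R.d_xi z _ _ he.smooth_vector hs.smooth_vector q
  change 2 * _ = (s q).2 (lie (fun q => (fundamentalVF z q : TangentSpace 𝓘(ℝ, EP) q)) _ q)
    - (e q).2 (lie (fun q => (fundamentalVF z q : TangentSpace 𝓘(ℝ, EP) q)) _ q)
    + R.xi z q _ + _ - dirDeriv _ (fun q => R.xi z q _) q + dirDeriv _ (fun q => R.xi z q _) q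
    + R.Hhat q ![fundamentalVF z q, _, _] at h3
  rw [l1, l2, d1, map_zero, map_zero, ← d2, extDerivOne] at h3
  linarith

section Admissible

variable {R} {V : ∀ q : P, Submodule ℝ (GT EP q)} (hV : R.IsAdmissible V)
include hV

/-- Every term of `two_mul_pairing_dorfman` is smooth and invariant when the arguments are sections,
and the values lie in `K^⊥` by `pairing_dorfman_rho`. -/
theorem IsAdmissible.isSection_dorfman {e s : ∀ q : P, GT EP q} (he : R.IsSection e)
    (hs : R.IsSection s) : R.IsSection (R.dorfman e s) := by
  have hform : ∀ u, R.IsSection u → ∀ X : ∀ q : P, TangentSpace 𝓘(ℝ, EP) q,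
      (∀ (g : G) q, X (MulOpposite.op g • q) = dR g q (X q)) → ∀ (g : G) q,
      (u (MulOpposite.op g • q)).2 (X (MulOpposite.op g • q)) = (u q).2 (X q) := by
    intro u hu X hX g q
    rw [hX, (hu.invariant g q).2]
  have hlie : ∀ u v, R.IsSection u → R.IsSection v → ∀ (g : G) q,
      lie (fun q => (u q).1) (fun q => (v q).1) (MulOpposite.op g • q)
        = dR g q (lie (fun q => (u q).1) (fun q => (v q).1) q) := fun u v hu hv =>
    R.lie_act hu.smooth_vector hv.smooth_vector (fun g q => (hu.invariant g q).1)
      (fun g q => (hv.invariant g q).1)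
  have key : ∀ u, R.IsSection u → ∀ q, pairing q (R.dorfman e s q) (u q) = (1 / 2 : ℝ) *
      (2 * pairing q (R.dorfman e s q) (u q)) := fun u _ q => by ring
  refine hV.isSection_of_forall (fun q z => R.pairing_dorfman_rho he hs z q) (fun u hu => ?_)
    fun u hu g q => ?_
  · have hf : ContMDiff 𝓘(ℝ, EP) 𝓘(ℝ, ℝ) ∞ (fun q => (1 / 2 : ℝ) *
        (2 * pairing q (R.dorfman e s q) (u q))) := by
      refine contMDiff_const.mul ?_
      simp only [R.two_mul_pairing_dorfman he.isSmoothGT hs.isSmoothGT hu.isSmoothGT]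
      have l : ∀ {a b c : ∀ q : P, GT EP q}, R.IsSection a → R.IsSection b → R.IsSection c →
          ContMDiff 𝓘(ℝ, EP) 𝓘(ℝ, ℝ) ∞
            (fun q => (c q).2 (lie (fun q => (a q).1) (fun q => (b q).1) q)) :=
        fun ha hb hc => hc.smooth_form _ (ha.smooth_vector.lie hb.smooth_vector)
      have d : ∀ {a b c : ∀ q : P, GT EP q}, R.IsSection a → R.IsSection b → R.IsSection c →
          ContMDiff 𝓘(ℝ, EP) 𝓘(ℝ, ℝ) ∞
            (fun q => dirDeriv (fun q => (a q).1) (fun q => (b q).2 (c q).1) q) :=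
        fun ha hb hc => ha.smooth_vector.dirDeriv (hb.smooth_form _ hc.smooth_vector)
      exact ((((((l he hs hu).sub (l he hu hs)).add (l hs hu he)).add (d he hs hu)).sub
        (d hs he hu)).add (d hu he hs)).add
        (R.Hhat_smooth _ _ _ he.smooth_vector hs.smooth_vector hu.smooth_vector)
    convert hf using 2 with q
    exact key u hu q
  · rw [key u hu, key u hu q]
    simp only [R.two_mul_pairing_dorfman he.isSmoothGT hs.isSmoothGT hu.isSmoothGT]
    have d : ∀ {a b c : ∀ q : P, GT EP q}, R.IsSection a → R.IsSection b → R.IsSection c →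
        dirDeriv (fun q => (a q).1) (fun q => (b q).2 (c q).1) (MulOpposite.op g • q)
          = dirDeriv (fun q => (a q).1) (fun q => (b q).2 (c q).1) q :=
      fun ha hb hc => R.dirDeriv_act ha (hb.smooth_form _ hc.smooth_vector) (hb.form_act hc) g q
    rw [d he hs hu, d hs he hu, d hu he hs, hform u hu _ (hlie e s he hs),
      hform s hs _ (hlie e u he hu), hform e he _ (hlie s u hs hu), (he.invariant g q).1,
      (hs.invariant g q).1, (hu.invariant g q).1, R.Hhat_invariant]

end Admissible

theorem anchor_dorfman {e s : ∀ q : P, GT EP q} (he : R.IsSection e) (hs : R.IsSection s)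
    (h : R.IsSection (R.dorfman e s)) :
    R.anchor (R.dorfman e s) = lie (R.anchor e) (R.anchor s) :=
  R.vf_ext fun q => (R.anchor_apply h q).trans (R.dp_lie he hs q)

end

/-! ### Existence of the Levi-Civita connection. -/

section

section LeviCivita

variable {E : Type*} [NormedAddCommGroup E] [NormedSpace ℝ E] [FiniteDimensional ℝ E]
  {N : Type*} [TopologicalSpace N] [T2Space N] [ChartedSpace E N] [IsManifold 𝓘(ℝ, E) ∞ N]

/-- The right-hand side `X g(Y, Z) + Y g(X, Z) - Z g(X, Y) + g([X, Y], Z) - g([X, Z], Y)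
- g([Y, Z], X)` of the Koszul formula. -/
def koszul (g : ∀ x : N, TangentSpace 𝓘(ℝ, E) x →ₗ[ℝ] TangentSpace 𝓘(ℝ, E) x →ₗ[ℝ] ℝ)
    (X Y Z : ∀ x : N, TangentSpace 𝓘(ℝ, E) x) (x : N) : ℝ :=
  dirDeriv X (fun y => g y (Y y) (Z y)) x + dirDeriv Y (fun y => g y (X y) (Z y)) x
    - dirDeriv Z (fun y => g y (X y) (Y y)) x + g x (lie X Y x) (Z x) - g x (lie X Z x) (Y x)
    - g x (lie Y Z x) (X x)

/-- This symmetry is the metric property of the connection; it also carries linearity from the third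
argument over to the second. -/
theorem koszul_swap_right
    {g : ∀ x : N, TangentSpace 𝓘(ℝ, E) x →ₗ[ℝ] TangentSpace 𝓘(ℝ, E) x →ₗ[ℝ] ℝ}
    (hsymm : ∀ x v w, g x v w = g x w v) (X Y Z : ∀ x : N, TangentSpace 𝓘(ℝ, E) x) (x : N) :
    koszul g X Y Z x + koszul g X Z Y x = 2 * dirDeriv X (fun y => g y (Y y) (Z y)) x := by
  simp only [koszul]
  rw [lie_swap Z Y x]
  simp only [map_neg, LinearMap.neg_apply, hsymm _ (Z _) (Y _), hsymm _ (X _) (Z _)]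
  ring

/-- This symmetry is the vanishing of the torsion. -/
theorem koszul_swap_left
    {g : ∀ x : N, TangentSpace 𝓘(ℝ, E) x →ₗ[ℝ] TangentSpace 𝓘(ℝ, E) x →ₗ[ℝ] ℝ}
    (hsymm : ∀ x v w, g x v w = g x w v) (X Y Z : ∀ x : N, TangentSpace 𝓘(ℝ, E) x) (x : N) :
    koszul g X Y Z x - koszul g Y X Z x = 2 * g x (lie X Y x) (Z x) := by
  simp only [koszul]
  rw [lie_swap Y X x]
  simp only [map_neg, LinearMap.neg_apply, hsymm _ (Y _) (X _)]
  ring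

variable {g : ∀ x : N, TangentSpace 𝓘(ℝ, E) x →ₗ[ℝ] TangentSpace 𝓘(ℝ, E) x →ₗ[ℝ] ℝ}
  (hsm : ∀ X Y : ∀ x : N, TangentSpace 𝓘(ℝ, E) x, SmoothVF X → SmoothVF Y →
    ContMDiff 𝓘(ℝ, E) 𝓘(ℝ, ℝ) ∞ (fun x => g x (X x) (Y x)))
  (hsymm : ∀ x v w, g x v w = g x w v)
include hsm

theorem dirDeriv_metric_add {X X' Y : ∀ x : N, TangentSpace 𝓘(ℝ, E) x} (hX : SmoothVF X)
    (hX' : SmoothVF X') (hY : SmoothVF Y) (U : ∀ x : N, TangentSpace 𝓘(ℝ, E) x) (x : N) :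
    dirDeriv U (fun y => g y ((X + X') y) (Y y)) x
      = dirDeriv U (fun y => g y (X y) (Y y)) x + dirDeriv U (fun y => g y (X' y) (Y y)) x := by
  rw [← dirDeriv_add U (hsm X Y hX hY) (hsm X' Y hX' hY)]
  congr 1
  funext y
  simp only [Pi.add_apply, map_add, LinearMap.add_apply]

theorem dirDeriv_metric_smul {f : N → ℝ} (hf : ContMDiff 𝓘(ℝ, E) 𝓘(ℝ, ℝ) ∞ f)
    {X Y : ∀ x : N, TangentSpace 𝓘(ℝ, E) x} (hX : SmoothVF X)
    (hY : SmoothVF Y) (U : ∀ x : N, TangentSpace 𝓘(ℝ, E) x) (x : N) :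
    dirDeriv U (fun y => g y (f y • X y) (Y y)) x
      = dirDeriv U f x * g x (X x) (Y x) + f x * dirDeriv U (fun y => g y (X y) (Y y)) x := by
  rw [← dirDeriv_mul U hf (hsm X Y hX hY)]
  congr 1
  funext y
  simp only [map_smul, LinearMap.smul_apply, smul_eq_mul]

theorem koszul_add_left {X X' Y Z : ∀ x : N, TangentSpace 𝓘(ℝ, E) x} (hX : SmoothVF X)
    (hX' : SmoothVF X') (hY : SmoothVF Y) (hZ : SmoothVF Z) (x : N) :
    koszul g (X + X') Y Z x = koszul g X Y Z x + koszul g X' Y Z x := by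
  simp only [koszul]
  rw [dirDeriv_add_field, dirDeriv_metric_add hsm hX hX' hZ, dirDeriv_metric_add hsm hX hX' hY,
    lie_add_left Y hX hX', lie_add_left Z hX hX']
  simp only [Pi.add_apply, map_add, LinearMap.add_apply]
  ring

theorem koszul_smul_left {f : N → ℝ} (hf : ContMDiff 𝓘(ℝ, E) 𝓘(ℝ, ℝ) ∞ f)
    {X Y Z : ∀ x : N, TangentSpace 𝓘(ℝ, E) x} (hX : SmoothVF X)
    (hY : SmoothVF Y) (hZ : SmoothVF Z) (x : N) :
    koszul g (fun x => f x • X x) Y Z x = f x * koszul g X Y Z x := by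
  simp only [koszul]
  rw [dirDeriv_smul_field, dirDeriv_metric_smul hsm hf hX hZ, dirDeriv_metric_smul hsm hf hX hY,
    lie_smul_left hf Y hX, lie_smul_left hf Z hX]
  simp only [map_add, LinearMap.add_apply, map_smul, LinearMap.smul_apply, smul_eq_mul]
  ring

theorem contMDiff_koszul {X Y Z : ∀ x : N, TangentSpace 𝓘(ℝ, E) x} (hX : SmoothVF X)
    (hY : SmoothVF Y) (hZ : SmoothVF Z) :
    ContMDiff 𝓘(ℝ, E) 𝓘(ℝ, ℝ) ∞ (koszul g X Y Z) :=
  (((((hX.dirDeriv (hsm Y Z hY hZ)).add (hY.dirDeriv (hsm X Z hX hZ))).sub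
    (hZ.dirDeriv (hsm X Y hX hY))).add (hsm _ _ (hX.lie hY) hZ)).sub
    (hsm _ _ (hX.lie hZ) hY)).sub (hsm _ _ (hY.lie hZ) hX)

include hsymm

theorem koszul_add_right {X Y Z Z' : ∀ x : N, TangentSpace 𝓘(ℝ, E) x} (hX : SmoothVF X)
    (hY : SmoothVF Y) (hZ : SmoothVF Z) (hZ' : SmoothVF Z') (x : N) :
    koszul g X Y (Z + Z') x = koszul g X Y Z x + koszul g X Y Z' x := by
  simp only [koszul]
  simp only [hsymm _ (Y _) ((Z + Z') _), hsymm _ (X _) ((Z + Z') _), hsymm _ (Y _) (Z _),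
    hsymm _ (Y _) (Z' _), hsymm _ (X _) (Z _), hsymm _ (X _) (Z' _)]
  rw [dirDeriv_add_field, dirDeriv_metric_add hsm hZ hZ' hX, dirDeriv_metric_add hsm hZ hZ' hY,
    lie_add_right Y hZ hZ', lie_add_right X hZ hZ']
  simp only [Pi.add_apply, map_add, LinearMap.add_apply]
  ring

theorem koszul_smul_right {f : N → ℝ} (hf : ContMDiff 𝓘(ℝ, E) 𝓘(ℝ, ℝ) ∞ f)
    {X Y Z : ∀ x : N, TangentSpace 𝓘(ℝ, E) x} (hX : SmoothVF X)
    (hY : SmoothVF Y) (hZ : SmoothVF Z) (x : N) :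
    koszul g X Y (fun x => f x • Z x) x = f x * koszul g X Y Z x := by
  simp only [koszul]
  simp only [hsymm _ (Y _) (f _ • Z _), hsymm _ (X _) (f _ • Z _)]
  rw [dirDeriv_smul_field, dirDeriv_metric_smul hsm hf hZ hX, dirDeriv_metric_smul hsm hf hZ hY,
    lie_smul_right hf Y hZ, lie_smul_right hf X hZ]
  simp only [map_add, LinearMap.add_apply, map_smul, LinearMap.smul_apply, smul_eq_mul,
    hsymm _ (Z _) (Y _), hsymm _ (Z _) (X _)]
  ring

/-- The Levi-Civita connection of a metric exists. -/
theorem isLeviCivita_leviCivita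
    (hnd : ∀ x v, (∀ w, g x v w = 0) → v = 0)
    (hrep : ∀ ζ : ∀ x : N, Module.Dual ℝ (TangentSpace 𝓘(ℝ, E) x), SmoothOneForm ζ →
      ∃ X, SmoothVF X ∧ ∀ x w, g x (X x) w = ζ x w) : IsLeviCivita g (leviCivita g) := by
  -- The connection is an operator on all fields, smooth or not; for the others the specification is
  -- vacuous and `0` serves.
  have hex : ∀ X Y : ∀ x : N, TangentSpace 𝓘(ℝ, E) x, ∃ U, SmoothVF X → SmoothVF Y →
      SmoothVF U ∧ ∀ Z, SmoothVF Z → ∀ x, 2 * g x (U x) (Z x) = koszul g X Y Z x := by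
    intro X Y
    by_cases hX : SmoothVF X
    swap
    · exact ⟨0, fun h => absurd h hX⟩
    by_cases hY : SmoothVF Y
    swap
    · exact ⟨0, fun _ h => absurd h hY⟩
    choose κ hκ using fun x => exists_covector x (fun Z => koszul g X Y Z x)
      (fun Z Z' hZ hZ' => koszul_add_right hsm hsymm hX hY hZ hZ' x)
      (fun f Z hf hZ => koszul_smul_right hsm hsymm hf hX hY hZ x)
    have hκs : SmoothOneForm (fun x => (1 / 2 : ℝ) • κ x) := by
      intro Z hZ
      have : (fun x => ((1 / 2 : ℝ) • κ x) (Z x)) = fun x => (1 / 2 : ℝ) * koszul g X Y Z x := by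
        funext x
        rw [LinearMap.smul_apply, hκ x Z hZ, smul_eq_mul]
      rw [this]
      exact contMDiff_const.mul (contMDiff_koszul hsm hX hY hZ)
    obtain ⟨U, hU, hUκ⟩ := hrep _ hκs
    refine ⟨U, fun _ _ => ⟨hU, fun Z hZ x => ?_⟩⟩
    rw [hUκ, LinearMap.smul_apply, hκ x Z hZ, smul_eq_mul]
    ring
  choose D hD using hex
  have ext : ∀ (x : N) (v w : TangentSpace 𝓘(ℝ, E) x),
      (∀ Z, SmoothVF Z → 2 * g x v (Z x) = 2 * g x w (Z x)) → v = w := by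
    intro x v w h
    refine sub_eq_zero.1 (hnd x _ fun u => ?_)
    obtain ⟨Z, hZ, rfl⟩ := exists_smoothVF (E := E) x u
    have := h Z hZ
    rw [map_sub, LinearMap.sub_apply]
    linarith
  have kz : ∀ {X Y Z}, SmoothVF X → SmoothVF Y → SmoothVF Z → ∀ x,
      2 * g x (D X Y x) (Z x) = koszul g X Y Z x := fun hX hY hZ x => (hD _ _ hX hY).2 _ hZ x
  refine Classical.epsilon_spec (p := IsLeviCivita g) ⟨D, ?_⟩
  refine ⟨fun X Y hX hY => (hD X Y hX hY).1, fun X X' Y hX hX' hY => ?_, fun f X Y hf hX hY => ?_,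
    fun X Y Y' hX hY hY' => ?_, fun f X Y hf hX hY => ?_, fun X Y hX hY => ?_,
    fun X Y Z hX hY hZ x => ?_⟩
  · funext x
    refine ext x _ _ fun Z hZ => ?_
    rw [kz (hX.add hX') hY hZ, Pi.add_apply, map_add, LinearMap.add_apply, mul_add,
      kz hX hY hZ, kz hX' hY hZ, koszul_add_left hsm hX hX' hY hZ]
  · funext x
    refine ext x _ _ fun Z hZ => ?_
    rw [kz (hX.smul hf) hY hZ, map_smul, LinearMap.smul_apply, smul_eq_mul,
      koszul_smul_left hsm hf hX hY hZ, ← kz hX hY hZ]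
    ring
  · funext x
    refine ext x _ _ fun Z hZ => ?_
    -- The Koszul expression is not tensorial in its second argument. Exchanging it with the third
    -- brings in a derivative of `g(Y, Z)`, which in the proof of `leibniz` yields the term `X(f)
    -- Y`.
    have a := koszul_swap_right hsymm X (Y + Y') Z x
    have b := koszul_swap_right hsymm X Y Z x
    have c := koszul_swap_right hsymm X Y' Z x
    rw [koszul_add_right hsm hsymm hX hZ hY hY', dirDeriv_metric_add hsm hY hY' hZ] at a
    rw [kz hX (hY.add hY') hZ, Pi.add_apply, map_add, LinearMap.add_apply, mul_add,
      kz hX hY hZ, kz hX hY' hZ]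
    linarith
  · funext x
    refine ext x _ _ fun Z hZ => ?_
    have a := koszul_swap_right hsymm X (fun x => f x • Y x) Z x
    have b := koszul_swap_right hsymm X Y Z x
    rw [koszul_smul_right hsm hsymm hf hX hZ hY, dirDeriv_metric_smul hsm hf hY hZ] at a
    rw [kz hX (hY.smul hf) hZ, map_add, LinearMap.add_apply, map_smul, map_smul,
      LinearMap.smul_apply, LinearMap.smul_apply, smul_eq_mul, smul_eq_mul]
    have d := kz hX hY hZ x
    linear_combination a - f x * b - f x * d
  · funext x
    refine ext x _ _ fun Z hZ => ?_
    rw [Pi.sub_apply, map_sub, LinearMap.sub_apply, mul_sub, kz hX hY hZ, kz hY hX hZ,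
      koszul_swap_left hsymm X Y Z]
  · have a := koszul_swap_right hsymm X Y Z x
    rw [← kz hX hY hZ, ← kz hX hZ hY] at a
    rw [hsymm x (Y x)]
    linarith

end LeviCivita

section Admissible

variable {R : CourantReduction EM M EG G EP P} {V : ∀ q : P, Submodule ℝ (GT EP q)}
  (hV : R.IsAdmissible V)
include hV

/-- The vector field dual to `ζ` is the anchor of `2 Π₊(p^* ζ)`, which is already known to be a
smooth section. -/
theorem IsAdmissible.exists_metric_eq {ζ : ∀ x : M, Module.Dual ℝ (TangentSpace 𝓘(ℝ, EM) x)}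
    (hζ : SmoothOneForm ζ) : ∃ X, SmoothVF X ∧ ∀ x w, R.metric V x (X x) w = ζ x w := by
  have h1 : R.IsSection ((2 : ℝ) • projPlus V (R.cot ζ)) :=
    (hV.isSection_projPlus (R.isSection_cot hζ)).const_smul 2
  refine ⟨R.anchor ((2 : ℝ) • projPlus V (R.cot ζ)), R.smoothVF_anchor h1, fun x w => ?_⟩
  obtain ⟨q, rfl⟩ := R.principal.surjective x
  have h2 := hV.pairing_piPerpInv_projPlus_cot ζ q w
  rw [hV.pairing_piPerpInv w (hV.projPlus_mem _ q)] at h2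
  rw [hV.metric_symm, hV.metric_apply, R.anchor_apply h1]
  change R.metricAt V q w (R.dp q ((2 : ℝ) • (projPlus V (R.cot ζ) q).1)) = _
  rw [map_smul, map_smul, h2, smul_eq_mul]
  ring

theorem IsAdmissible.isLeviCivita : IsLeviCivita (R.metric V) (leviCivita (R.metric V)) :=
  isLeviCivita_leviCivita (fun _ _ hX hY => hV.contMDiff_metric hX hY)
    (fun x v w => hV.metric_symm x v w) (fun _ _ h => hV.metric_nondegenerate h)
    fun _ hζ => hV.exists_metric_eq hζ

end Admissible

end

/-! ### The operator `D'` is a generalized connection preserving `V₊`. -/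

section

variable {R : CourantReduction EM M EG G EP P}

/-- An invariant function comes from `M`, where only the anchor differentiates it. -/
theorem IsSection.dirDeriv_congr {e e' : ∀ q : P, GT EP q} (he : R.IsSection e)
    (he' : R.IsSection e') (h : R.anchor e = R.anchor e') {f : P → ℝ}
    (hf : ContMDiff 𝓘(ℝ, EP) 𝓘(ℝ, ℝ) ∞ f)
    (hinv : ∀ (g : G) (q : P), f (MulOpposite.op g • q) = f q) (q : P) :
    dirDeriv (fun q => (e q).1) f q = dirDeriv (fun q => (e' q).1) f q := by
  obtain ⟨k, hk, hfk⟩ := R.exists_eq_comp_proj hf hinv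
  obtain rfl : f = fun q => k (R.p q) := funext hfk
  rw [R.dirDeriv_fst he hk, R.dirDeriv_fst he' hk, h]

/-- The cyclic permutation of the arguments of `⟨[e₁, e₂], e₃⟩`. -/
theorem pairing_dorfman_cycle {e₁ e₂ e₃ : ∀ q : P, GT EP q} (h₁ : IsSmoothGT e₁)
    (h₂ : IsSmoothGT e₂) (h₃ : IsSmoothGT e₃) (q : P) :
    pairing q (R.dorfman e₁ e₂ q) (e₃ q) = pairing q (R.dorfman e₂ e₃ q) (e₁ q)
      + dirDeriv (fun q => (e₃ q).1) (fun q => pairing q (e₁ q) (e₂ q)) q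
      - dirDeriv (fun q => (e₂ q).1) (fun q => pairing q (e₁ q) (e₃ q)) q := by
  have a := R.pairing_dorfman_add_swap h₁ h₂ h₃ q
  have b := R.pairing_dorfman_add_pairing h₂ h₁ h₃ q
  linarith

section LeviCivita

variable {E : Type*} [NormedAddCommGroup E] [NormedSpace ℝ E] [FiniteDimensional ℝ E]
  {N : Type*} [TopologicalSpace N] [T2Space N] [ChartedSpace E N] [IsManifold 𝓘(ℝ, E) ∞ N]
  {g : ∀ x : N, TangentSpace 𝓘(ℝ, E) x →ₗ[ℝ] TangentSpace 𝓘(ℝ, E) x →ₗ[ℝ] ℝ}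
  {D : (∀ x : N, TangentSpace 𝓘(ℝ, E) x) → (∀ x : N, TangentSpace 𝓘(ℝ, E) x) →
      ∀ x : N, TangentSpace 𝓘(ℝ, E) x}

theorem _root_.GenGeom.IsLeviCivita.dualConnection_apply (hD : IsLeviCivita g D)
    {X Z : ∀ x : N, TangentSpace 𝓘(ℝ, E) x}
    {η : ∀ x : N, Module.Dual ℝ (TangentSpace 𝓘(ℝ, E) x)} (hX : SmoothVF X)
    (hη : SmoothOneForm η) (hZ : SmoothVF Z) (x : N) :
    dualConnection D X η x (Z x) = dirDeriv X (fun y => η y (Z y)) x - η x (D X Z x) := by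
  refine covectorOf_apply x (exists_covector x _ ?_ ?_) hZ
  · intro Y Z hY hZ
    have : (fun y => η y ((Y + Z) y)) = fun y => η y (Y y) + η y (Z y) :=
      funext fun y => map_add _ _ _
    rw [this, dirDeriv_add X (hη Y hY) (hη Z hZ), hD.add_right X Y Z hX hY hZ, Pi.add_apply, map_add]
    ring
  · intro f Z hf hZ
    have : (fun y => η y (f y • Z y)) = fun y => f y * η y (Z y) :=
      funext fun y => map_smul _ _ _
    rw [this, dirDeriv_mul X hf (hη Z hZ), hD.leibniz f X Z hf hX hZ, map_add, map_smul, map_smul,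
      smul_eq_mul, smul_eq_mul]
    ring

theorem _root_.GenGeom.IsLeviCivita.smoothOneForm_dualConnection (hD : IsLeviCivita g D)
    {X : ∀ x : N, TangentSpace 𝓘(ℝ, E) x}
    {η : ∀ x : N, Module.Dual ℝ (TangentSpace 𝓘(ℝ, E) x)} (hX : SmoothVF X)
    (hη : SmoothOneForm η) : SmoothOneForm (dualConnection D X η) := by
  intro Z hZ
  simp only [hD.dualConnection_apply hX hη hZ]
  exact (hX.dirDeriv (hη Z hZ)).sub (hη _ (hD.smooth X Z hX hZ))

theorem _root_.GenGeom.IsLeviCivita.zero_left (hD : IsLeviCivita g D)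
    {Y : ∀ x : N, TangentSpace 𝓘(ℝ, E) x} (hY : SmoothVF Y) : D 0 Y = 0 := by
  have h := hD.add_left 0 0 Y SmoothVF.zero SmoothVF.zero hY
  rw [add_zero] at h
  exact left_eq_add.1 h

end LeviCivita

section Admissible

variable {V : ∀ q : P, Submodule ℝ (GT EP q)} (hV : R.IsAdmissible V)
include hV

theorem IsAdmissible.anchor_adSec {e : ∀ q : P, GT EP q} (he : R.IsSection e) :
    R.anchor (R.adSec V e) = 0 :=
  R.vf_ext fun q => (R.anchor_apply (hV.isSection_adSec he) q).trans (hV.dp_adSec he q)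

theorem IsAdmissible.cotPart_adSec {e : ∀ q : P, GT EP q} (he : R.IsSection e) :
    R.cotPart V (R.adSec V e) = 0 := by
  funext x
  obtain ⟨q, rfl⟩ := R.principal.surjective x
  refine LinearMap.ext fun v => ?_
  rw [hV.cotPart_apply (hV.isSection_adSec he), hV.pairing_adSec_splitting he, mul_zero]
  rfl

theorem IsAdmissible.cotPart_lam {X : ∀ x : M, TangentSpace 𝓘(ℝ, EM) x} (hX : SmoothVF X) :
    R.cotPart V (R.lam V X) = 0 := by
  funext x
  obtain ⟨q, rfl⟩ := R.principal.surjective x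
  refine LinearMap.ext fun v => ?_
  rw [hV.cotPart_apply (hV.isSection_lam hX)]
  refine (congrArg (2 * ·) (hV.pairing_splitting_splitting q _ v)).trans ?_
  exact mul_zero _

omit hV in
theorem cot_zero : R.cot 0 = 0 := funext fun q => map_zero (R.cotIncl q)

omit hV in
theorem lam_zero : R.lam V 0 = 0 := funext fun q => map_zero (R.splitting V q)

theorem IsAdmissible.adSec_lam {X : ∀ x : M, TangentSpace 𝓘(ℝ, EM) x} (hX : SmoothVF X) :
    R.adSec V (R.lam V X) = 0 := by
  rw [adSec, hV.anchor_lam hX, hV.cotPart_lam hX, cot_zero, sub_self, sub_zero]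

theorem IsAdmissible.adSec_adSec {e : ∀ q : P, GT EP q} (he : R.IsSection e) :
    R.adSec V (R.adSec V e) = R.adSec V e := by
  conv_lhs => rw [adSec, hV.anchor_adSec he, hV.cotPart_adSec he, cot_zero, lam_zero]
  rw [sub_zero, sub_zero]

theorem IsAdmissible.pairing_adSec {e s : ∀ q : P, GT EP q} (he : R.IsSection e)
    (hs : R.IsSection s) (q : P) :
    pairing q (R.adSec V e q) (s q) = pairing q (R.adSec V e q) (R.adSec V s q) := by
  have h := hV.pairing_eq (hV.isSection_adSec he) hs q
  rw [hV.anchor_adSec he, hV.cotPart_adSec he, hV.adSec_adSec he] at h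
  rw [h]
  simp

theorem IsAdmissible.pairing_lam {X : ∀ x : M, TangentSpace 𝓘(ℝ, EM) x} (hX : SmoothVF X)
    {s : ∀ q : P, GT EP q} (hs : R.IsSection s) (q : P) :
    pairing q (R.lam V X q) (s q) = (1 / 2 : ℝ) * R.cotPart V s (R.p q) (X (R.p q)) := by
  rw [hV.pairing_eq (hV.isSection_lam hX) hs q, hV.cotPart_lam hX, hV.anchor_lam hX,
    hV.adSec_lam hX]
  simp

/-- The derivative `∇^A_X` of the component in `ad P` of a section. -/
theorem IsAdmissible.adLift_lie {X : ∀ x : M, TangentSpace 𝓘(ℝ, EM) x} (hX : SmoothVF X)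
    {s : ∀ q : P, GT EP q} (hs : R.IsSection s) (q : P) :
    adLift V q (lie (R.horLift V X) (R.adPart V s) q)
      = R.adSec V (R.dorfman (R.lam V X) (R.adSec V s)) q := by
  have hl := hV.isSection_lam hX
  have ha := hV.isSection_adSec hs
  have hd := hV.isSection_dorfman hl ha
  have h1 : R.adPart V s = fun q => (R.adSec V s q).1 := funext fun q => (hV.adSec_fst hs q).symm
  have h2 : lie (R.horLift V X) (R.adPart V s) q
      = (R.adSec V (R.dorfman (R.lam V X) (R.adSec V s)) q).1 := by
    rw [hV.adSec_fst hd, h1]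
    change _ = (R.dorfman (R.lam V X) (R.adSec V s) q).1 - (R.splitting V q (R.dp q _)).1
    have h3 : R.dp q (R.dorfman (R.lam V X) (R.adSec V s) q).1 = 0 := by
      refine (R.dp_lie hl ha q).trans ?_
      rw [hV.anchor_adSec hs]
      exact congrFun (VectorField.mlieBracket_zero_right) _
    rw [h3, map_zero]
    exact (sub_zero _).symm
  rw [h2]
  exact hV.adLift_eq (hV.adSec_mem hd q)

/-- This trades `∇^A`, a bracket of vector fields on `P`, for a Dorfman bracket of sections of `E`,
so that the rules for the latter apply to `D'`. -/
theorem IsAdmissible.Dprime_eq {e s : ∀ q : P, GT EP q} (he : R.IsSection e)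
    (hs : R.IsSection s) :
    R.Dprime V e s = R.lam V (leviCivita (R.metric V) (R.anchor e) (R.anchor s))
      + R.adSec V (R.dorfman (R.lam V (R.anchor e)) (R.adSec V s))
      + R.cot (dualConnection (leviCivita (R.metric V)) (R.anchor e) (R.cotPart V s)) := by
  funext q
  exact congrArg (fun a => R.lam V _ q + a + R.cotIncl q _)
    (hV.adLift_lie (R.smoothVF_anchor he) hs q)

theorem IsAdmissible.isSection_Dprime {e s : ∀ q : P, GT EP q} (he : R.IsSection e)
    (hs : R.IsSection s) : R.IsSection (R.Dprime V e s) := by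
  rw [hV.Dprime_eq he hs]
  have hX := R.smoothVF_anchor he
  exact ((hV.isSection_lam (hV.isLeviCivita.smooth _ _ hX (R.smoothVF_anchor hs))).add
    (hV.isSection_adSec (hV.isSection_dorfman (hV.isSection_lam hX) (hV.isSection_adSec hs)))).add
    (R.isSection_cot (hV.isLeviCivita.smoothOneForm_dualConnection hX
      (hV.smoothOneForm_cotPart hs)))

theorem IsAdmissible.dp_Dprime {e s : ∀ q : P, GT EP q} (he : R.IsSection e)
    (hs : R.IsSection s) (q : P) : R.dp q (R.Dprime V e s q).1
      = leviCivita (R.metric V) (R.anchor e) (R.anchor s) (R.p q) := by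
  rw [hV.Dprime_eq he hs]
  change R.dp q ((R.splitting V q _).1 + (R.adSec V _ q).1 + 0) = _
  rw [map_add, map_add, hV.dp_splitting, hV.dp_adSec (hV.isSection_dorfman
    (hV.isSection_lam (R.smoothVF_anchor he)) (hV.isSection_adSec hs)), map_zero, add_zero, add_zero]

/-- For `s = Y + r + g(Y, ·)` the dual connection gives `g(∇Y, ·)`, because `∇^g` preserves `g`; the
result has the same shape. -/
theorem IsAdmissible.Dprime_mem {e s : ∀ q : P, GT EP q} (he : R.IsSection e)
    (hs : R.IsSection s) (hsV : ∀ q, s q ∈ V q) (q : P) : R.Dprime V e s q ∈ V q := by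
  have hX := R.smoothVF_anchor he
  have hY := R.smoothVF_anchor hs
  have hD := hV.isLeviCivita
  have hc : R.cotPart V s = fun x => R.metric V x (R.anchor s x) := by
    funext x
    obtain ⟨q, rfl⟩ := R.principal.surjective x
    exact (hV.mem_iff hs q).1 (hsV q)
  have hd : dualConnection (leviCivita (R.metric V)) (R.anchor e) (R.cotPart V s)
      = fun x => R.metric V x (leviCivita (R.metric V) (R.anchor e) (R.anchor s) x) := by
    funext x
    refine LinearMap.ext fun v => ?_
    obtain ⟨Z, hZ, rfl⟩ := exists_smoothVF (E := EM) x v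
    rw [hD.dualConnection_apply hX (hV.smoothOneForm_cotPart hs) hZ, hc,
      hD.metric _ _ _ hX hY hZ]
    ring
  have h : R.Dprime V e s q = R.liftPlus V (leviCivita (R.metric V) (R.anchor e) (R.anchor s)) q
      + R.adSec V (R.dorfman (R.lam V (R.anchor e)) (R.adSec V s)) q := by
    rw [hV.Dprime_eq he hs, hd, hV.lam_eq]
    simp only [Pi.add_apply, Pi.sub_apply]
    abel
  rw [h]
  exact add_mem (hV.piPerpInv_mem q _) (hV.adSec_mem (hV.isSection_dorfman
    (hV.isSection_lam hX) (hV.isSection_adSec hs)) q)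

theorem IsAdmissible.pairing_Dprime {e s u : ∀ q : P, GT EP q} (he : R.IsSection e)
    (hs : R.IsSection s) (hu : R.IsSection u) (q : P) :
    pairing q (R.Dprime V e s q) (u q) = (1 / 2 : ℝ) *
      (dirDeriv (R.anchor e) (fun x => R.cotPart V s x (R.anchor u x)) (R.p q)
        - R.cotPart V s (R.p q) (leviCivita (R.metric V) (R.anchor e) (R.anchor u) (R.p q))
        + R.cotPart V u (R.p q) (leviCivita (R.metric V) (R.anchor e) (R.anchor s) (R.p q)))
      + pairing q (R.dorfman (R.lam V (R.anchor e)) (R.adSec V s) q) (R.adSec V u q) := by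
  have hX := R.smoothVF_anchor he
  have hD := hV.isLeviCivita
  have hd := hV.isSection_dorfman (hV.isSection_lam hX) (hV.isSection_adSec hs)
  rw [hV.Dprime_eq he hs]
  simp only [Pi.add_apply, map_add, LinearMap.add_apply]
  rw [hV.pairing_lam (hD.smooth _ _ hX (R.smoothVF_anchor hs)) hu, hV.pairing_adSec hd hu,
    pairing_cot, ← R.anchor_apply hu,
    hD.dualConnection_apply hX (hV.smoothOneForm_cotPart hs) (R.smoothVF_anchor hu),
    pairing_comm q (R.adSec V _ q), ← hV.pairing_adSec hu hd, pairing_comm q (R.adSec V u q)]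
  ring

/-- As `λ(X)` is orthogonal to `ad P`, cycling the arguments produces no derivatives. On the right
`X` enters only through its value, which shows that `∇^A_X` is tensorial in `X`. -/
theorem IsAdmissible.pairing_dorfman_lam_adSec {X : ∀ x : M, TangentSpace 𝓘(ℝ, EM) x}
    (hX : SmoothVF X) {s u : ∀ q : P, GT EP q} (hs : R.IsSection s) (hu : R.IsSection u) (q : P) :
    pairing q (R.dorfman (R.lam V X) (R.adSec V s) q) (R.adSec V u q)
      = pairing q (R.dorfman (R.adSec V s) (R.adSec V u) q) (R.splitting V q (X (R.p q))) := by
  have hz : ∀ {t}, R.IsSection t →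
      (fun q => pairing q (R.lam V X q) (R.adSec V t q)) = fun _ => 0 := fun ht => by
    funext q
    rw [pairing_comm]
    exact hV.pairing_adSec_splitting ht q _
  rw [pairing_dorfman_cycle (hV.isSection_lam hX).isSmoothGT (hV.isSection_adSec hs).isSmoothGT
    (hV.isSection_adSec hu).isSmoothGT, hz hs, hz hu, dirDeriv_const, dirDeriv_const, add_zero,
    sub_zero]
  rfl

/-- An operator that is tensorial in its first argument and preserves the pairing is a generalized
connection. -/
theorem IsAdmissible.isGeneralizedConnection
    {D : (∀ q : P, GT EP q) → (∀ q : P, GT EP q) → ∀ q : P, GT EP q}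
    (hsec : ∀ e s, R.IsSection e → R.IsSection s → R.IsSection (D e s))
    (hadd : ∀ e e' s u, R.IsSection e → R.IsSection e' → R.IsSection s → R.IsSection u → ∀ q,
      pairing q (D (e + e') s q) (u q) = pairing q (D e s q) (u q) + pairing q (D e' s q) (u q))
    (hsmul : ∀ (f : M → ℝ) e s u, ContMDiff 𝓘(ℝ, EM) 𝓘(ℝ, ℝ) ∞ f → R.IsSection e →
      R.IsSection s → R.IsSection u → ∀ q,
      pairing q (D (fun q => f (R.p q) • e q) s q) (u q) = f (R.p q) * pairing q (D e s q) (u q))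
    (hmet : ∀ e s₁ s₂, R.IsSection e → R.IsSection s₁ → R.IsSection s₂ → ∀ q,
      dirDeriv (fun q => (e q).1) (fun q => pairing q (s₁ q) (s₂ q)) q
        = pairing q (D e s₁ q) (s₂ q) + pairing q (s₁ q) (D e s₂ q)) :
    R.IsGeneralizedConnection D where
  isSection := hsec
  metric := hmet
  add_left := fun e e' s he he' hs => by
    funext q
    refine hV.ext_pairing ((hsec _ _ (he.add he') hs).mem_Kperp q)
      (((hsec _ _ he hs).add (hsec _ _ he' hs)).mem_Kperp q) fun u hu => ?_
    rw [hadd e e' s u he he' hs hu, Pi.add_apply, map_add, LinearMap.add_apply]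
  smul_left := fun f e s hf he hs => by
    funext q
    refine hV.ext_pairing ((hsec _ _ (he.smul hf) hs).mem_Kperp q)
      (((hsec _ _ he hs).smul hf).mem_Kperp q) fun u hu => ?_
    rw [hsmul f e s u hf he hs hu, map_smul, LinearMap.smul_apply, smul_eq_mul]
  -- The rules in the second argument need no separate input: by `hmet`, pairing with `u` reduces
  -- them to the sum and product rules for the derivative of `⟨s, u⟩`.
  add_right := fun e s s' he hs hs' => by
    funext q
    refine hV.ext_pairing ((hsec _ _ he (hs.add hs')).mem_Kperp q)
      (((hsec _ _ he hs).add (hsec _ _ he hs')).mem_Kperp q) fun u hu => ?_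
    have a := hmet e _ u he (hs.add hs') hu q
    have b := hmet e s u he hs hu q
    have c := hmet e s' u he hs' hu q
    simp only [Pi.add_apply, map_add, LinearMap.add_apply] at a ⊢
    rw [dirDeriv_add _ (hs.contMDiff_pairing hu) (hs'.contMDiff_pairing hu)] at a
    linarith
  leibniz := fun f e s hf he hs => by
    funext q
    have hfs : R.IsSection (fun q => f (R.p q) • D e s q
        + dirDeriv (R.anchor e) f (R.p q) • s q) :=
      ((hsec _ _ he hs).smul hf).add (hs.smul ((R.smoothVF_anchor he).dirDeriv hf))
    refine hV.ext_pairing ((hsec _ _ he (hs.smul hf)).mem_Kperp q) (hfs.mem_Kperp q) fun u hu => ?_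
    have a := hmet e _ u he (hs.smul hf) hu q
    have b := hmet e s u he hs hu q
    simp only [map_smul, LinearMap.smul_apply, smul_eq_mul, map_add, LinearMap.add_apply] at a ⊢
    rw [dirDeriv_mul (f := fun q => f (R.p q)) _ (hf.comp R.contMDiff_proj)
      (hs.contMDiff_pairing hu), R.dirDeriv_fst he hf, b] at a
    linarith

theorem IsAdmissible.isGeneralizedConnection_Dprime : R.IsGeneralizedConnection (R.Dprime V) := by
  have hD := hV.isLeviCivita
  refine hV.isGeneralizedConnection (fun e s he hs => hV.isSection_Dprime he hs)
    (fun e e' s u he he' hs hu q => ?_) (fun f e s u hf he hs hu q => ?_)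
    (fun e s u he hs hu q => ?_)
  · have hX := R.smoothVF_anchor he
    have hX' := R.smoothVF_anchor he'
    rw [hV.pairing_Dprime (he.add he') hs hu, hV.pairing_Dprime he hs hu,
      hV.pairing_Dprime he' hs hu, R.anchor_add he he', dirDeriv_add_field,
      hD.add_left _ _ _ hX hX' (R.smoothVF_anchor hs),
      hD.add_left _ _ _ hX hX' (R.smoothVF_anchor hu),
      hV.pairing_dorfman_lam_adSec (hX.add hX') hs hu, hV.pairing_dorfman_lam_adSec hX hs hu,
      hV.pairing_dorfman_lam_adSec hX' hs hu]
    simp only [Pi.add_apply, map_add]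
    ring
  · have hX := R.smoothVF_anchor he
    rw [hV.pairing_Dprime (he.smul hf) hs hu, hV.pairing_Dprime he hs hu,
      R.anchor_smul hf he, dirDeriv_smul_field,
      hD.smul_left _ _ _ hf hX (R.smoothVF_anchor hs),
      hD.smul_left _ _ _ hf hX (R.smoothVF_anchor hu),
      hV.pairing_dorfman_lam_adSec (hX.smul hf) hs hu, hV.pairing_dorfman_lam_adSec hX hs hu]
    simp only [map_smul, smul_eq_mul]
    ring
  · have hX := R.smoothVF_anchor he
    have hl := hV.isSection_lam hX
    have has := hV.isSection_adSec hs
    have hau := hV.isSection_adSec hu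
    rw [pairing_comm q (s q), hV.pairing_Dprime he hs hu, hV.pairing_Dprime he hu hs]
    -- On `T ⊕ T*` the definition of the dual connection does the work; on `ad P` it is the
    -- derivation property of `[λ(X), ·]`, whose anchor is that of `e`.
    have h1 := R.pairing_dorfman_add_pairing hl.isSmoothGT has.isSmoothGT hau.isSmoothGT q
    have h2 := IsSection.dirDeriv_congr he hl (hV.anchor_lam hX).symm (has.contMDiff_pairing hau)
      (has.pairing_act hau) q
    have s1 := hV.smoothOneForm_cotPart hs _ (R.smoothVF_anchor hu)
    have s2 := hV.smoothOneForm_cotPart hu _ (R.smoothVF_anchor hs)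
    have s3 : ContMDiff 𝓘(ℝ, EM) 𝓘(ℝ, ℝ) ∞ (fun x => (1 / 2 : ℝ) *
        (R.cotPart V s x (R.anchor u x) + R.cotPart V u x (R.anchor s x))) :=
      contMDiff_const.mul (s1.add s2)
    have h3 : (fun q => pairing q (s q) (u q)) = fun q => (1 / 2 : ℝ) *
        (R.cotPart V s (R.p q) (R.anchor u (R.p q)) + R.cotPart V u (R.p q) (R.anchor s (R.p q)))
        + pairing q (R.adSec V s q) (R.adSec V u q) := funext (hV.pairing_eq hs hu)
    have h4 := (R.dirDeriv_fst he s3 q).trans ((dirDeriv_const_mul _ _ (s1.add s2) _).trans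
      (congrArg ((1 / 2 : ℝ) * ·) (dirDeriv_add _ s1 s2 _)))
    rw [h3, dirDeriv_add (f := fun q => (1 / 2 : ℝ) * (R.cotPart V s (R.p q) (R.anchor u (R.p q))
      + R.cotPart V u (R.p q) (R.anchor s (R.p q)))) _ (s3.comp R.contMDiff_proj)
      (has.contMDiff_pairing hau), h4]
    linarith

end Admissible

end

/-! ### The torsion of `D'`. -/

section

variable (R : CourantReduction EM M EG G EP P)

/-- The generalized torsion of a connection that preserves the pairing. -/
def torsionForm (D : (∀ q : P, GT EP q) → (∀ q : P, GT EP q) → ∀ q : P, GT EP q)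
    (e₁ e₂ e₃ : ∀ q : P, GT EP q) (q : P) : ℝ :=
  pairing q (D e₁ e₂ q) (e₃ q) - pairing q (D e₂ e₁ q) (e₃ q) + pairing q (D e₃ e₁ q) (e₂ q)
    - pairing q (R.dorfman e₁ e₂ q) (e₃ q)

variable {R}

namespace IsGeneralizedConnection

variable {D : (∀ q : P, GT EP q) → (∀ q : P, GT EP q) → ∀ q : P, GT EP q}
  (hD : R.IsGeneralizedConnection D) {e₁ e₁' e₂ e₂' e₃ e₃' : ∀ q : P, GT EP q}
include hD

/-- Removing the two skew-symmetrizations costs one half of the derivative of `⟨e₁, e₂⟩` along `e₃`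
each, once for the bracket and once for `D`, and these cancel. -/
theorem torsion_eq_torsionForm (h₁ : R.IsSection e₁) (h₂ : R.IsSection e₂) (h₃ : R.IsSection e₃)
    (q : P) : R.torsion D e₁ e₂ e₃ q = R.torsionForm D e₁ e₂ e₃ q := by
  have a := hD.metric e₃ e₁ e₂ h₃ h₁ h₂ q
  have b := R.pairing_dorfman_add_swap h₁.isSmoothGT h₂.isSmoothGT h₃.isSmoothGT q
  rw [pairing_comm q (e₁ q)] at a
  simp only [torsion, torsionForm, courant, map_sub, map_smul, LinearMap.sub_apply,
    LinearMap.smul_apply, smul_eq_mul]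
  linarith

/-- The symmetric part of the bracket and the metric property of `D` yield the same derivative of
`⟨e₁, e₂⟩`; the next lemma argues likewise with `⟨e₂, e₃⟩`. -/
theorem torsionForm_swap_left (h₁ : R.IsSection e₁) (h₂ : R.IsSection e₂) (h₃ : R.IsSection e₃)
    (q : P) : R.torsionForm D e₂ e₁ e₃ q = - R.torsionForm D e₁ e₂ e₃ q := by
  have a := hD.metric e₃ e₁ e₂ h₃ h₁ h₂ q
  have b := R.pairing_dorfman_add_swap h₁.isSmoothGT h₂.isSmoothGT h₃.isSmoothGT q
  rw [pairing_comm q (e₁ q)] at a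
  simp only [torsionForm]
  linarith

theorem torsionForm_swap_right (h₁ : R.IsSection e₁) (h₂ : R.IsSection e₂) (h₃ : R.IsSection e₃)
    (q : P) : R.torsionForm D e₁ e₃ e₂ q = - R.torsionForm D e₁ e₂ e₃ q := by
  have a := hD.metric e₁ e₂ e₃ h₁ h₂ h₃ q
  have b := R.pairing_dorfman_add_pairing h₁.isSmoothGT h₂.isSmoothGT h₃.isSmoothGT q
  rw [pairing_comm q (e₂ q)] at a
  simp only [torsionForm]
  linarith

/-- The third argument is differentiated nowhere: it occurs in pairings and as the direction of `D`.
Linearity in the other two arguments then follows from skewness. -/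
theorem torsionForm_add_right (h₁ : R.IsSection e₁) (h₃ : R.IsSection e₃) (h₃' : R.IsSection e₃')
    (q : P) : R.torsionForm D e₁ e₂ (e₃ + e₃') q
      = R.torsionForm D e₁ e₂ e₃ q + R.torsionForm D e₁ e₂ e₃' q := by
  simp only [torsionForm]
  rw [hD.add_left e₃ e₃' e₁ h₃ h₃' h₁]
  simp only [Pi.add_apply, map_add, LinearMap.add_apply]
  ring

theorem torsionForm_smul_right {f : M → ℝ} (hf : ContMDiff 𝓘(ℝ, EM) 𝓘(ℝ, ℝ) ∞ f)
    (h₁ : R.IsSection e₁) (h₃ : R.IsSection e₃) (q : P) :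
    R.torsionForm D e₁ e₂ (fun q => f (R.p q) • e₃ q) q
      = f (R.p q) * R.torsionForm D e₁ e₂ e₃ q := by
  simp only [torsionForm]
  rw [hD.smul_left f e₃ e₁ hf h₃ h₁]
  simp only [map_smul, LinearMap.smul_apply, smul_eq_mul]
  ring

theorem torsionForm_add_middle (h₁ : R.IsSection e₁) (h₂ : R.IsSection e₂) (h₂' : R.IsSection e₂')
    (h₃ : R.IsSection e₃) (q : P) : R.torsionForm D e₁ (e₂ + e₂') e₃ q
      = R.torsionForm D e₁ e₂ e₃ q + R.torsionForm D e₁ e₂' e₃ q := by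
  rw [hD.torsionForm_swap_right h₁ h₃ (h₂.add h₂'), hD.torsionForm_add_right h₁ h₂ h₂',
    hD.torsionForm_swap_right h₁ h₂ h₃, hD.torsionForm_swap_right h₁ h₂' h₃]
  ring

theorem torsionForm_add_left (h₁ : R.IsSection e₁) (h₁' : R.IsSection e₁') (h₂ : R.IsSection e₂)
    (h₃ : R.IsSection e₃) (q : P) : R.torsionForm D (e₁ + e₁') e₂ e₃ q
      = R.torsionForm D e₁ e₂ e₃ q + R.torsionForm D e₁' e₂ e₃ q := by
  rw [hD.torsionForm_swap_left h₂ (h₁.add h₁') h₃, hD.torsionForm_add_middle h₂ h₁ h₁' h₃,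
    hD.torsionForm_swap_left h₁ h₂ h₃, hD.torsionForm_swap_left h₁' h₂ h₃]
  ring

theorem torsionForm_smul_left {f : M → ℝ} (hf : ContMDiff 𝓘(ℝ, EM) 𝓘(ℝ, ℝ) ∞ f)
    (h₁ : R.IsSection e₁) (h₂ : R.IsSection e₂) (h₃ : R.IsSection e₃) (q : P) :
    R.torsionForm D (fun q => f (R.p q) • e₁ q) e₂ e₃ q
      = f (R.p q) * R.torsionForm D e₁ e₂ e₃ q := by
  rw [hD.torsionForm_swap_left h₂ (h₁.smul hf) h₃, hD.torsionForm_swap_right h₂ h₃ (h₁.smul hf),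
    hD.torsionForm_smul_right hf h₂ h₁, hD.torsionForm_swap_right h₂ h₁ h₃,
    hD.torsionForm_swap_left h₁ h₂ h₃]
  ring

theorem torsionForm_cycle (h₁ : R.IsSection e₁) (h₂ : R.IsSection e₂) (h₃ : R.IsSection e₃)
    (q : P) : R.torsionForm D e₂ e₃ e₁ q = R.torsionForm D e₁ e₂ e₃ q := by
  rw [hD.torsionForm_swap_right h₂ h₁ h₃, hD.torsionForm_swap_left h₁ h₂ h₃, neg_neg]

end IsGeneralizedConnection

section Admissible

variable {V : ∀ q : P, Submodule ℝ (GT EP q)} (hV : R.IsAdmissible V)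
include hV

theorem IsAdmissible.contMDiff_torsionForm
    {D : (∀ q : P, GT EP q) → (∀ q : P, GT EP q) → ∀ q : P, GT EP q}
    (hD : R.IsGeneralizedConnection D) {e₁ e₂ e₃ : ∀ q : P, GT EP q} (h₁ : R.IsSection e₁)
    (h₂ : R.IsSection e₂) (h₃ : R.IsSection e₃) :
    ContMDiff 𝓘(ℝ, EP) 𝓘(ℝ, ℝ) ∞ (R.torsionForm D e₁ e₂ e₃) :=
  ((((hD.isSection _ _ h₁ h₂).contMDiff_pairing h₃).sub
    ((hD.isSection _ _ h₂ h₁).contMDiff_pairing h₃)).add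
    ((hD.isSection _ _ h₃ h₁).contMDiff_pairing h₂)).sub
    ((hV.isSection_dorfman h₁ h₂).contMDiff_pairing h₃)

theorem IsAdmissible.torsionForm_act
    {D : (∀ q : P, GT EP q) → (∀ q : P, GT EP q) → ∀ q : P, GT EP q}
    (hD : R.IsGeneralizedConnection D) {e₁ e₂ e₃ : ∀ q : P, GT EP q} (h₁ : R.IsSection e₁)
    (h₂ : R.IsSection e₂) (h₃ : R.IsSection e₃) (g : G) (q : P) :
    R.torsionForm D e₁ e₂ e₃ (MulOpposite.op g • q) = R.torsionForm D e₁ e₂ e₃ q := by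
  simp only [torsionForm]
  rw [(hD.isSection _ _ h₁ h₂).pairing_act h₃, (hD.isSection _ _ h₂ h₁).pairing_act h₃,
    (hD.isSection _ _ h₃ h₁).pairing_act h₂, (hV.isSection_dorfman h₁ h₂).pairing_act h₃]

omit hV in
theorem pairing_dorfman_zero_left {s u : ∀ q : P, GT EP q} (hs : R.IsSection s)
    (hu : R.IsSection u) (q : P) : pairing q (R.dorfman 0 s q) (u q) = 0 := by
  rw [pairing_dorfman_cycle (IsSection.zero (R := R)).isSmoothGT hs.isSmoothGT hu.isSmoothGT]
  simp only [Pi.zero_apply, map_zero, LinearMap.zero_apply, dirDeriv_const, add_zero, sub_zero]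

omit hV in
theorem pairing_dorfman_zero_right {s u : ∀ q : P, GT EP q} (hs : R.IsSection s)
    (hu : R.IsSection u) (q : P) : pairing q (R.dorfman s 0 q) (u q) = 0 := by
  have h := R.pairing_dorfman_add_pairing hs.isSmoothGT (IsSection.zero (R := R)).isSmoothGT
    hu.isSmoothGT q
  simpa only [Pi.zero_apply, map_zero, LinearMap.zero_apply, dirDeriv_const, add_zero] using h

theorem IsAdmissible.pairing_Dprime_of_cotPart {e s u : ∀ q : P, GT EP q} (he : R.IsSection e)
    (hs : R.IsSection s) (hu : R.IsSection u) (hs0 : R.cotPart V s = 0)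
    (hu0 : R.cotPart V u = 0) (q : P) :
    pairing q (R.Dprime V e s q) (u q)
      = pairing q (R.dorfman (R.lam V (R.anchor e)) (R.adSec V s) q) (R.adSec V u q) := by
  rw [hV.pairing_Dprime he hs hu, hs0, hu0]
  simp [dirDeriv_const]

theorem IsAdmissible.pairing_Dprime_of_anchor {e s u : ∀ q : P, GT EP q} (he : R.IsSection e)
    (hs : R.IsSection s) (hu : R.IsSection u) (he0 : R.anchor e = 0) (q : P) :
    pairing q (R.Dprime V e s q) (u q) = 0 := by
  have hz : ∀ f : M → ℝ, dirDeriv (0 : ∀ x : M, TangentSpace 𝓘(ℝ, EM) x) f (R.p q) = 0 :=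
    fun f => map_zero (mfderiv 𝓘(ℝ, EM) 𝓘(ℝ, ℝ) f (R.p q))
  rw [hV.pairing_Dprime he hs hu, he0, hz, hV.isLeviCivita.zero_left (R.smoothVF_anchor hs),
    hV.isLeviCivita.zero_left (R.smoothVF_anchor hu), lam_zero,
    pairing_dorfman_zero_left (hV.isSection_adSec hs) (hV.isSection_adSec hu)]
  simp

/-- Pairing with `p^* ζ` sees only anchors, and the direction `p^* ζ` has zero anchor, so what
remains is `ζ` applied to the torsion of `∇^g`. -/
theorem IsAdmissible.torsionForm_cot {e s : ∀ q : P, GT EP q} (he : R.IsSection e)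
    (hs : R.IsSection s) {ζ : ∀ x : M, Module.Dual ℝ (TangentSpace 𝓘(ℝ, EM) x)}
    (hζ : SmoothOneForm ζ) (q : P) : R.torsionForm (R.Dprime V) e s (R.cot ζ) q = 0 := by
  have h0 : R.anchor (R.cot ζ) = 0 :=
    R.vf_ext fun q => (R.anchor_apply (R.isSection_cot hζ) q).trans (map_zero (R.dp q))
  have hd := hV.isSection_dorfman he hs
  have ht := hV.isLeviCivita.torsion_free _ _ (R.smoothVF_anchor he) (R.smoothVF_anchor hs)
  have ht' := congrArg (ζ (R.p q)) (congrFun ht (R.p q))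
  rw [Pi.sub_apply, map_sub] at ht'
  simp only [torsionForm]
  rw [hV.pairing_Dprime_of_anchor (R.isSection_cot hζ) he hs h0, pairing_comm, pairing_cot,
    pairing_comm _ (R.Dprime V s e q), pairing_cot, pairing_comm _ (R.dorfman e s q), pairing_cot,
    hV.dp_Dprime he hs, hV.dp_Dprime hs he, ← R.anchor_apply hd, R.anchor_dorfman he hs hd]
  linarith

/-- The torsion of `D'` only depends on the components in `T` and `ad P`. -/
theorem IsAdmissible.torsionForm_eq {e s u : ∀ q : P, GT EP q} (he : R.IsSection e)
    (hs : R.IsSection s) (hu : R.IsSection u) (q : P) :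
    R.torsionForm (R.Dprime V) e s u q
      = R.torsionForm (R.Dprime V) (R.lam V (R.anchor e) + R.adSec V e) s u q := by
  have hD := hV.isGeneralizedConnection_Dprime
  have hl := hV.isSection_lam (R.smoothVF_anchor he)
  have ha := hV.isSection_adSec he
  have hζ := hV.smoothOneForm_cotPart he
  have hc := R.isSection_cot hζ
  conv_lhs => rw [R.eq_lam_add_adSec_add_cot V e]
  rw [hD.torsionForm_add_left (hl.add ha) hc hs hu, ← hD.torsionForm_cycle hc hs hu,
    hV.torsionForm_cot hs hu hζ, add_zero]

/-- `D'` maps the image of `λ` to itself, and this image is orthogonal to everything without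
component in `T*`; only the bracket term is left. -/
theorem IsAdmissible.torsionForm_lam_lam {X Y : ∀ x : M, TangentSpace 𝓘(ℝ, EM) x}
    (hX : SmoothVF X) (hY : SmoothVF Y) {u : ∀ q : P, GT EP q} (hu : R.IsSection u)
    (hu0 : R.cotPart V u = 0) (q : P) :
    R.torsionForm (R.Dprime V) (R.lam V X) (R.lam V Y) u q
      = - pairing q (R.dorfman (R.lam V X) (R.lam V Y) q) (u q) := by
  have hlX := hV.isSection_lam hX
  have hlY := hV.isSection_lam hY
  have z : ∀ {e s t : ∀ q : P, GT EP q}, R.IsSection e → R.IsSection s → R.IsSection t →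
      R.cotPart V s = 0 → R.cotPart V t = 0 → R.adSec V s = 0 →
      pairing q (R.Dprime V e s q) (t q) = 0 := by
    intro e s t he hs ht hs0 ht0 hsa
    rw [hV.pairing_Dprime_of_cotPart he hs ht hs0 ht0, hsa, pairing_dorfman_zero_right
      (hV.isSection_lam (R.smoothVF_anchor he)) (hV.isSection_adSec ht)]
  simp only [torsionForm]
  rw [z hlX hlY hu (hV.cotPart_lam hY) hu0 (hV.adSec_lam hY),
    z hlY hlX hu (hV.cotPart_lam hX) hu0 (hV.adSec_lam hX),
    z hu hlX hlY (hV.cotPart_lam hX) (hV.cotPart_lam hY) (hV.adSec_lam hX)]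
  ring

/-- `∇^A` is defined by the bracket with `λ(X)`, so it cancels the bracket term; the other two
derivatives have vertical direction and vanish. -/
theorem IsAdmissible.torsionForm_lam_adSec {X : ∀ x : M, TangentSpace 𝓘(ℝ, EM) x}
    (hX : SmoothVF X) {s u : ∀ q : P, GT EP q} (hs : R.IsSection s) (hu : R.IsSection u) (q : P) :
    R.torsionForm (R.Dprime V) (R.lam V X) (R.adSec V s) (R.adSec V u) q = 0 := by
  have hl := hV.isSection_lam hX
  have has := hV.isSection_adSec hs
  have hau := hV.isSection_adSec hu
  simp only [torsionForm]
  rw [hV.pairing_Dprime_of_cotPart hl has hau (hV.cotPart_adSec hs) (hV.cotPart_adSec hu),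
    hV.pairing_Dprime_of_anchor has hl hau (hV.anchor_adSec hs),
    hV.pairing_Dprime_of_anchor hau hl has (hV.anchor_adSec hu), hV.anchor_lam hX,
    hV.adSec_adSec hs, hV.adSec_adSec hu]
  ring

theorem IsAdmissible.torsionForm_adSec_adSec {e s u : ∀ q : P, GT EP q} (he : R.IsSection e)
    (hs : R.IsSection s) (hu : R.IsSection u) (q : P) :
    R.torsionForm (R.Dprime V) (R.adSec V e) (R.adSec V s) (R.adSec V u) q
      = - pairing q (R.dorfman (R.adSec V e) (R.adSec V s) q) (R.adSec V u q) := by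
  have hae := hV.isSection_adSec he
  have has := hV.isSection_adSec hs
  have hau := hV.isSection_adSec hu
  simp only [torsionForm]
  rw [hV.pairing_Dprime_of_anchor hae has hau (hV.anchor_adSec he),
    hV.pairing_Dprime_of_anchor has hae hau (hV.anchor_adSec hs),
    hV.pairing_Dprime_of_anchor hau hae has (hV.anchor_adSec hu)]
  ring

/-- The components of `e` and `s` in `T*` drop out, that of `s` after moving it to the first place
by skewness. -/
theorem IsAdmissible.torsionForm_expand {e s u : ∀ q : P, GT EP q} (he : R.IsSection e)
    (hs : R.IsSection s) (hu : R.IsSection u) (q : P) :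
    R.torsionForm (R.Dprime V) e s u q
      = R.torsionForm (R.Dprime V) (R.lam V (R.anchor e)) (R.lam V (R.anchor s)) u q
        + R.torsionForm (R.Dprime V) (R.lam V (R.anchor e)) (R.adSec V s) u q
        + R.torsionForm (R.Dprime V) (R.adSec V e) (R.lam V (R.anchor s)) u q
        + R.torsionForm (R.Dprime V) (R.adSec V e) (R.adSec V s) u q := by
  have hD := hV.isGeneralizedConnection_Dprime
  have hl := hV.isSection_lam (R.smoothVF_anchor he)
  have ha := hV.isSection_adSec he
  have hl' := hV.isSection_lam (R.smoothVF_anchor hs)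
  have ha' := hV.isSection_adSec hs
  rw [hV.torsionForm_eq he hs hu, hD.torsionForm_swap_left hs (hl.add ha) hu,
    hV.torsionForm_eq hs (hl.add ha) hu, hD.torsionForm_swap_left (hl.add ha) (hl'.add ha') hu,
    neg_neg, hD.torsionForm_add_left hl ha (hl'.add ha') hu, hD.torsionForm_add_middle hl hl' ha' hu,
    hD.torsionForm_add_middle ha hl' ha' hu]
  ring

theorem IsAdmissible.torsionForm_lam {e s : ∀ q : P, GT EP q} (he : R.IsSection e)
    (hs : R.IsSection s) {Z : ∀ x : M, TangentSpace 𝓘(ℝ, EM) x} (hZ : SmoothVF Z) (q : P) :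
    R.torsionForm (R.Dprime V) e s (R.lam V Z) q =
      - pairing q (R.dorfman (R.lam V (R.anchor e)) (R.lam V (R.anchor s)) q) (R.lam V Z q)
      + pairing q (R.dorfman (R.lam V (R.anchor e)) (R.lam V Z) q) (R.adSec V s q)
      - pairing q (R.dorfman (R.lam V (R.anchor s)) (R.lam V Z) q) (R.adSec V e q) := by
  have hD := hV.isGeneralizedConnection_Dprime
  have hX := R.smoothVF_anchor he
  have hY := R.smoothVF_anchor hs
  have hl := hV.isSection_lam hX
  have ha := hV.isSection_adSec he
  have hl' := hV.isSection_lam hY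
  have ha' := hV.isSection_adSec hs
  have hz := hV.isSection_lam hZ
  rw [hV.torsionForm_expand he hs hz, hV.torsionForm_lam_lam hX hY hz (hV.cotPart_lam hZ),
    hD.torsionForm_swap_right hl hz ha', hV.torsionForm_lam_lam hX hZ ha' (hV.cotPart_adSec hs),
    ← hD.torsionForm_cycle ha hl' hz, hV.torsionForm_lam_lam hY hZ ha (hV.cotPart_adSec he),
    hD.torsionForm_cycle hz ha ha', hV.torsionForm_lam_adSec hZ he hs]
  ring

theorem IsAdmissible.torsionForm_adSec {e s u : ∀ q : P, GT EP q} (he : R.IsSection e)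
    (hs : R.IsSection s) (hu : R.IsSection u) (q : P) :
    R.torsionForm (R.Dprime V) e s (R.adSec V u) q =
      - pairing q (R.dorfman (R.lam V (R.anchor e)) (R.lam V (R.anchor s)) q) (R.adSec V u q)
      - pairing q (R.dorfman (R.adSec V e) (R.adSec V s) q) (R.adSec V u q) := by
  have hD := hV.isGeneralizedConnection_Dprime
  have hX := R.smoothVF_anchor he
  have hY := R.smoothVF_anchor hs
  have hau := hV.isSection_adSec hu
  rw [hV.torsionForm_expand he hs hau, hV.torsionForm_lam_lam hX hY hau (hV.cotPart_adSec hu),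
    hV.torsionForm_lam_adSec hX hs hu,
    hD.torsionForm_swap_left (hV.isSection_lam hY) (hV.isSection_adSec he) hau,
    hV.torsionForm_lam_adSec hY he hu, hV.torsionForm_adSec_adSec he hs hu]
  ring

end Admissible

end

/-! ### The tensor `χ⁰` as minus the torsion of `D'`; the Weyl term; the projections. -/

section

variable {R : CourantReduction EM M EG G EP P} {V : ∀ q : P, Submodule ℝ (GT EP q)}
  (hV : R.IsAdmissible V)
include hV

/-- The `ad P` part is an orthogonal projection, so it can be moved to the other side of the
pairing. -/
theorem IsAdmissible.pairing_adSec_left {e s : ∀ q : P, GT EP q} (he : R.IsSection e)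
    (hs : R.IsSection s) (q : P) :
    pairing q (R.adSec V e q) (s q) = pairing q (e q) (R.adSec V s q) := by
  rw [hV.pairing_adSec he hs, pairing_comm, ← hV.pairing_adSec hs he, pairing_comm]

theorem IsAdmissible.neg_curvF {X Y : ∀ x : M, TangentSpace 𝓘(ℝ, EM) x} (hX : SmoothVF X)
    (hY : SmoothVF Y) (q : P) :
    - R.curvF V X Y q = (R.adSec V (R.dorfman (R.lam V X) (R.lam V Y)) q).1 := by
  rw [hV.adSec_fst (hV.isSection_dorfman (hV.isSection_lam hX) (hV.isSection_lam hY)), curvF,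
    neg_neg]
  rfl

theorem IsAdmissible.cAd_curvF {X Y : ∀ x : M, TangentSpace 𝓘(ℝ, EM) x} (hX : SmoothVF X)
    (hY : SmoothVF Y) {s : ∀ q : P, GT EP q} (hs : R.IsSection s) (q : P) :
    R.cAd q (R.curvF V X Y q) (R.adPart V s q)
      = - pairing q (R.dorfman (R.lam V X) (R.lam V Y) q) (R.adSec V s q) := by
  have hd := hV.isSection_dorfman (hV.isSection_lam hX) (hV.isSection_lam hY)
  have h1 : R.curvF V X Y q = (- R.adSec V (R.dorfman (R.lam V X) (R.lam V Y)) q).1 := by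
    rw [Prod.fst_neg, ← hV.neg_curvF hX hY, neg_neg]
  have ha := hV.isSection_adSec hd
  have hs' := hV.isSection_adSec hs
  rw [h1, ← hV.adSec_fst hs, R.cAd_eq_pairing (neg_mem (ha.mem_Kperp q)) (hs'.mem_Kperp q)
    (by rw [Prod.fst_neg, map_neg, hV.dp_adSec hd, neg_zero]) (hV.dp_adSec hs q), map_neg,
    LinearMap.neg_apply, hV.pairing_adSec_left hd hs', hV.adSec_adSec hs]

theorem IsAdmissible.lie_adPart {e s : ∀ q : P, GT EP q} (he : R.IsSection e)
    (hs : R.IsSection s) (q : P) :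
    lie (R.adPart V e) (R.adPart V s) q
      = (R.adSec V (R.dorfman (R.adSec V e) (R.adSec V s)) q).1 := by
  have hae := hV.isSection_adSec he
  have has := hV.isSection_adSec hs
  have hd := hV.isSection_dorfman hae has
  have h1 : R.adPart V e = fun q => (R.adSec V e q).1 := funext fun q => (hV.adSec_fst he q).symm
  have h2 : R.adPart V s = fun q => (R.adSec V s q).1 := funext fun q => (hV.adSec_fst hs q).symm
  rw [hV.adSec_fst hd, h1, h2]
  change _ = (R.dorfman (R.adSec V e) (R.adSec V s) q).1 - (R.splitting V q (R.dp q _)).1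
  have h3 : R.dp q (R.dorfman (R.adSec V e) (R.adSec V s) q).1 = 0 := by
    refine (R.dp_lie hae has q).trans ?_
    rw [hV.anchor_adSec hs]
    exact congrFun (VectorField.mlieBracket_zero_right) _
  rw [h3, map_zero]
  exact (sub_zero _).symm

theorem IsAdmissible.chi0_mem_Kperp (e s : ∀ q : P, GT EP q) (q : P) :
    R.chi0 V e s q ∈ R.Kperp q :=
  add_mem (hV.le_Kperp q (hV.adLift_spec q _).1) (R.cotIncl_mem_Kperp q _)

/-- The tensor `χ⁰` is the negative of the torsion of `D'`. -/
theorem IsAdmissible.pairing_chi0 {e s u : ∀ q : P, GT EP q} (he : R.IsSection e)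
    (hs : R.IsSection s) (hu : R.IsSection u) (q : P) :
    pairing q (R.chi0 V e s q) (u q) = - R.torsionForm (R.Dprime V) e s u q := by
  have hD := hV.isGeneralizedConnection_Dprime
  have hX := R.smoothVF_anchor he
  have hY := R.smoothVF_anchor hs
  have hZ := R.smoothVF_anchor hu
  have hd := hV.isSection_dorfman (hV.isSection_lam hX) (hV.isSection_lam hY)
  have hd' := hV.isSection_dorfman (hV.isSection_adSec he) (hV.isSection_adSec hs)
  have h1 : adLift V q (- R.curvF V (R.anchor e) (R.anchor s) q
      + lie (R.adPart V e) (R.adPart V s) q)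
      = R.adSec V (R.dorfman (R.lam V (R.anchor e)) (R.lam V (R.anchor s))) q
        + R.adSec V (R.dorfman (R.adSec V e) (R.adSec V s)) q := by
    rw [hV.neg_curvF hX hY, hV.lie_adPart he hs]
    exact hV.adLift_eq (add_mem (hV.adSec_mem hd q) (hV.adSec_mem hd' q))
  -- The terms with `H` and `F` are the three brackets of `torsionForm_lam`. The factor `2`
  -- compensates for the `1/2` in `⟨p^* ζ, u⟩ = ζ(π u) / 2`.
  have h2 : ∀ Z, SmoothVF Z → R.threeH V (R.anchor e) (R.anchor s) Z q
      - 2 * R.cAd q (R.curvF V (R.anchor s) Z q) (R.adPart V e q)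
      + 2 * R.cAd q (R.curvF V (R.anchor e) Z q) (R.adPart V s q)
      = - 2 * R.torsionForm (R.Dprime V) e s (R.lam V Z) q := by
    intro Z hZ
    rw [hV.cAd_curvF hY hZ he, hV.cAd_curvF hX hZ hs, hV.torsionForm_lam he hs hZ, threeH]
    ring
  -- The functional behind `covectorOf` is linear over functions because, by `h2`, it is a value of
  -- the torsion.
  have h3 : covectorOf (R.p q) (fun Z => R.threeH V (R.anchor e) (R.anchor s) Z q
      - 2 * R.cAd q (R.curvF V (R.anchor s) Z q) (R.adPart V e q)
      + 2 * R.cAd q (R.curvF V (R.anchor e) Z q) (R.adPart V s q)) (R.anchor u (R.p q))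
      = - 2 * R.torsionForm (R.Dprime V) e s (R.lam V (R.anchor u)) q := by
    refine (covectorOf_apply (R.p q) (exists_covector (R.p q) _ ?_ ?_) hZ).trans (h2 _ hZ)
    · intro Z Z' hZ hZ'
      have hl : R.lam V (Z + Z') = R.lam V Z + R.lam V Z' :=
        funext fun q => map_add (R.splitting V q) _ _
      rw [h2 _ (hZ.add hZ'), h2 _ hZ, h2 _ hZ', hl,
        hD.torsionForm_add_right he (hV.isSection_lam hZ) (hV.isSection_lam hZ')]
      ring
    · intro f Z hf hZ
      have hl : R.lam V (fun x => f x • Z x) = fun q => f (R.p q) • R.lam V Z q :=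
        funext fun q => map_smul (R.splitting V q) _ _
      rw [h2 _ (hZ.smul hf), h2 _ hZ, hl, hD.torsionForm_smul_right hf he (hV.isSection_lam hZ)]
      ring
  -- The `T*` component of `u` contributes nothing to the torsion; nor does it pair with `χ⁰`, which
  -- has no component in `T`.
  have h4 : R.torsionForm (R.Dprime V) e s u q
      = R.torsionForm (R.Dprime V) e s (R.lam V (R.anchor u)) q
        + R.torsionForm (R.Dprime V) e s (R.adSec V u) q := by
    have hl := hV.isSection_lam hZ
    have ha := hV.isSection_adSec hu
    have hζ := hV.smoothOneForm_cotPart hu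
    conv_lhs => rw [R.eq_lam_add_adSec_add_cot V u]
    rw [hD.torsionForm_add_right he (hl.add ha) (R.isSection_cot hζ),
      hD.torsionForm_add_right he hl ha, hV.torsionForm_cot he hs hζ, add_zero]
  rw [chi0, h1, map_add, LinearMap.add_apply, map_add, LinearMap.add_apply, pairing_cotIncl,
    ← R.anchor_apply hu, h3, hV.pairing_adSec_left hd hu, hV.pairing_adSec_left hd' hu, h4,
    hV.torsionForm_adSec he hs hu]
  ring

theorem IsAdmissible.isSection_chi0 {e s : ∀ q : P, GT EP q} (he : R.IsSection e)
    (hs : R.IsSection s) : R.IsSection (R.chi0 V e s) := by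
  have hD := hV.isGeneralizedConnection_Dprime
  refine hV.isSection_of_forall (hV.chi0_mem_Kperp e s) (fun u hu => ?_) fun u hu g q => ?_
  · simp only [hV.pairing_chi0 he hs hu]
    exact (hV.contMDiff_torsionForm hD he hs hu).neg
  · rw [hV.pairing_chi0 he hs hu, hV.pairing_chi0 he hs hu, hV.torsionForm_act hD he hs hu]

theorem IsAdmissible.isSection_sharp {φ : ∀ q : P, Module.Dual ℝ (GT EP q)}
    (hφ : R.IsDualSection φ) : R.IsSection (R.sharp φ) := by
  refine hV.isSection_of_forall (fun q => (R.sharp_spec φ q).1) (fun u hu => ?_) fun u hu g q => ?_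
  · obtain ⟨f, hf, h⟩ := hφ u hu
    simp only [(R.sharp_spec φ _).2 _ (hu.mem_Kperp _), h]
    exact hf.comp R.contMDiff_proj
  · obtain ⟨f, hf, h⟩ := hφ u hu
    rw [(R.sharp_spec φ _).2 _ (hu.mem_Kperp _), (R.sharp_spec φ _).2 _ (hu.mem_Kperp _), h, h,
      R.principal.proj_act]

omit hV in
-- The trilinear form is visibly skew in `s` and `u`; this is why the Weyl term may be added without
-- losing the metric property.
theorem pairing_weyl (φ : ∀ q : P, Module.Dual ℝ (GT EP q)) (e s : ∀ q : P, GT EP q)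
    {u : ∀ q : P, GT EP q} (hu : R.IsSection u) (q : P) :
    pairing q (R.weyl φ e s q) (u q)
      = φ q (s q) * pairing q (e q) (u q) - pairing q (e q) (s q) * φ q (u q) := by
  rw [weyl, map_sub, LinearMap.sub_apply, map_smul, map_smul, LinearMap.smul_apply,
    LinearMap.smul_apply, (R.sharp_spec φ q).2 _ (hu.mem_Kperp q), smul_eq_mul, smul_eq_mul]

theorem IsAdmissible.isSection_weyl {φ : ∀ q : P, Module.Dual ℝ (GT EP q)}
    (hφ : R.IsDualSection φ) {e s : ∀ q : P, GT EP q} (he : R.IsSection e) (hs : R.IsSection s) :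
    R.IsSection (R.weyl φ e s) := by
  obtain ⟨f, hf, h⟩ := hφ s hs
  obtain ⟨k, hk, h'⟩ := R.exists_eq_comp_proj (he.contMDiff_pairing hs) (he.pairing_act hs)
  have : R.weyl φ e s = (fun q => f (R.p q) • e q) - fun q => k (R.p q) • R.sharp φ q := by
    funext q
    rw [weyl, h, h']
    rfl
  rw [this]
  exact (he.smul hf).sub ((hV.isSection_sharp hφ).smul hk)

omit hV in
theorem isDualSection_zero : R.IsDualSection 0 := fun _ _ =>
  ⟨fun _ => 0, contMDiff_const, fun _ => rfl⟩

omit hV in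
theorem isDualSection_oneFormDual {φ : ∀ x : M, Module.Dual ℝ (TangentSpace 𝓘(ℝ, EM) x)}
    (hφ : SmoothOneForm φ) : R.IsDualSection (R.oneFormDual φ) := fun e he =>
  ⟨fun x => φ x (R.anchor e x), hφ _ (R.smoothVF_anchor he), fun q =>
    congrArg (φ (R.p q)) (R.anchor_apply he q).symm⟩

omit hV in
theorem weyl_zero (e s : ∀ q : P, GT EP q) : R.weyl 0 e s = 0 := by
  funext q
  have h : R.sharp 0 q = 0 :=
    R.Kperp_nondegenerate (R.sharp_spec 0 q).1 fun b hb => (R.sharp_spec 0 q).2 b hb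
  rw [weyl, h, smul_zero, sub_zero]
  exact zero_smul ℝ (e q)

omit hV in
-- With this, `D⁰` needs no treatment of its own.
theorem Dzero_eq_Dphi : R.Dzero V = R.Dphi V 0 := by
  rw [Dzero, Dphi]
  congr 1
  funext e s
  rw [weyl_zero, add_zero]

/-- Both sides equal the pairing of the two projections. -/
theorem IsAdmissible.pairing_projPlus_comm (e s : ∀ q : P, GT EP q) (q : P) :
    pairing q (projPlus V e q) (s q) = pairing q (e q) (projPlus V s q) := by
  rw [← hV.pairing_projPlus e (hV.projPlus_mem s q), pairing_comm,
    ← hV.pairing_projPlus s (hV.projPlus_mem e q), pairing_comm]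

theorem IsAdmissible.pairing_projMinus_comm (e s : ∀ q : P, GT EP q) (q : P) :
    pairing q (projMinus V e q) (s q) = pairing q (e q) (projMinus V s q) := by
  simp only [projMinus, map_sub, LinearMap.sub_apply, hV.pairing_projPlus_comm e s]

theorem IsAdmissible.pairing_projMinus_projPlus (e s : ∀ q : P, GT EP q) (q : P) :
    pairing q (projMinus V e q) (projPlus V s q) = 0 :=
  hV.pairing_projMinus e (hV.projPlus_mem s q)

theorem IsAdmissible.projPlus_add (e s : ∀ q : P, GT EP q) :
    projPlus V (e + s) = projPlus V e + projPlus V s := by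
  funext q
  refine hV.projPlus_eq (add_mem (hV.projPlus_mem e q) (hV.projPlus_mem s q)) fun b hb => ?_
  simp only [Pi.add_apply, map_sub, map_add, LinearMap.sub_apply, LinearMap.add_apply,
    hV.pairing_projPlus _ hb, sub_self]

theorem IsAdmissible.projPlus_smul (f : P → ℝ) (e : ∀ q : P, GT EP q) :
    projPlus V (fun q => f q • e q) = fun q => f q • projPlus V e q := by
  funext q
  refine hV.projPlus_eq (Submodule.smul_mem _ _ (hV.projPlus_mem e q)) fun b hb => ?_
  simp only [map_sub, map_smul, LinearMap.sub_apply, LinearMap.smul_apply,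
    hV.pairing_projPlus _ hb, sub_self]

theorem IsAdmissible.projMinus_add (e s : ∀ q : P, GT EP q) :
    projMinus V (e + s) = projMinus V e + projMinus V s := by
  funext q
  simp only [projMinus, hV.projPlus_add, Pi.add_apply]
  abel

theorem IsAdmissible.projMinus_smul (f : P → ℝ) (e : ∀ q : P, GT EP q) :
    projMinus V (fun q => f q • e q) = fun q => f q • projMinus V e q := by
  funext q
  simp only [projMinus, hV.projPlus_smul, smul_sub]

theorem IsAdmissible.projPlus_projPlus (e : ∀ q : P, GT EP q) :
    projPlus V (projPlus V e) = projPlus V e := by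
  funext q
  exact hV.projPlus_eq (hV.projPlus_mem e q) fun b _ => by simp

theorem IsAdmissible.projMinus_projPlus (e : ∀ q : P, GT EP q) :
    projMinus V (projPlus V e) = 0 := by
  funext q
  simp only [projMinus, hV.projPlus_projPlus, sub_self, Pi.zero_apply]

theorem IsAdmissible.projPlus_projMinus (e : ∀ q : P, GT EP q) :
    projPlus V (projMinus V e) = 0 := by
  funext q
  exact hV.projPlus_eq (zero_mem _) fun b hb => by
    rw [Pi.zero_apply, sub_zero]; exact hV.pairing_projMinus e hb

omit hV in
theorem projPlus_add_projMinus (e : ∀ q : P, GT EP q) : projPlus V e + projMinus V e = e := by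
  funext q
  simp only [Pi.add_apply, projMinus]
  abel

end

/-! ### The connection `D^φ`: metric property, compatibility and torsion. -/

section

variable {R : CourantReduction EM M EG G EP P} {V : ∀ q : P, Submodule ℝ (GT EP q)}

/-- The trilinear form of the tensor `χ⁰ + χ^φ`. -/
def chiForm (R : CourantReduction EM M EG G EP P) (V : ∀ q : P, Submodule ℝ (GT EP q))
    (φ : ∀ q : P, Module.Dual ℝ (GT EP q)) (e s u : ∀ q : P, GT EP q) (q : P) : ℝ :=
  - R.torsionForm (R.Dprime V) e s u q
    + (φ q (s q) * pairing q (e q) (u q) - pairing q (e q) (s q) * φ q (u q))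

variable (hV : R.IsAdmissible V) (φ : ∀ q : P, Module.Dual ℝ (GT EP q))
include hV

/-- Skewness in the last two arguments makes the correction terms cancel in the metric property of
`D^φ`. -/
theorem IsAdmissible.chiForm_swap {e s u : ∀ q : P, GT EP q} (he : R.IsSection e)
    (hs : R.IsSection s) (hu : R.IsSection u) (q : P) :
    R.chiForm V φ e u s q = - R.chiForm V φ e s u q := by
  simp only [chiForm, hV.isGeneralizedConnection_Dprime.torsionForm_swap_right he hs hu]
  ring

theorem IsAdmissible.chiForm_add {e e' s u : ∀ q : P, GT EP q} (he : R.IsSection e)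
    (he' : R.IsSection e') (hs : R.IsSection s) (hu : R.IsSection u) (q : P) :
    R.chiForm V φ (e + e') s u q = R.chiForm V φ e s u q + R.chiForm V φ e' s u q := by
  simp only [chiForm, hV.isGeneralizedConnection_Dprime.torsionForm_add_left he he' hs hu,
    Pi.add_apply, map_add, LinearMap.add_apply]
  ring

theorem IsAdmissible.chiForm_smul {f : M → ℝ} (hf : ContMDiff 𝓘(ℝ, EM) 𝓘(ℝ, ℝ) ∞ f)
    {e s u : ∀ q : P, GT EP q} (he : R.IsSection e)
    (hs : R.IsSection s) (hu : R.IsSection u) (q : P) :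
    R.chiForm V φ (fun q => f (R.p q) • e q) s u q = f (R.p q) * R.chiForm V φ e s u q := by
  simp only [chiForm, hV.isGeneralizedConnection_Dprime.torsionForm_smul_left hf he hs hu,
    map_smul, LinearMap.smul_apply, smul_eq_mul]
  ring

theorem IsAdmissible.pairing_chi {e s u : ∀ q : P, GT EP q} (he : R.IsSection e)
    (hs : R.IsSection s) (hu : R.IsSection u) (q : P) :
    pairing q ((R.chi0 V e s + R.weyl φ e s) q) (u q) = R.chiForm V φ e s u q := by
  rw [Pi.add_apply, map_add, LinearMap.add_apply, hV.pairing_chi0 he hs hu, pairing_weyl φ e s hu]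
  rfl

theorem IsAdmissible.chiForm_zero {e s : ∀ q : P, GT EP q} (he : R.IsSection e)
    (hs : R.IsSection s) (q : P) : R.chiForm V φ e s 0 q = 0 := by
  rw [← hV.pairing_chi φ he hs IsSection.zero]
  exact map_zero _

/-- The projections are self-adjoint, so the outer one moves to `u`: each correction is a component
of one trilinear form, with equal signs in the last two places. -/
theorem IsAdmissible.pairing_Dphi {e s u : ∀ q : P, GT EP q} (he : R.IsSection e)
    (hs : R.IsSection s) (hu : R.IsSection u) (q : P) :
    pairing q (R.Dphi V φ e s q) (u q) = pairing q (R.Dprime V e s q) (u q)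
      + (1 / 3 : ℝ) * R.chiForm V φ (projPlus V e) (projPlus V s) (projPlus V u) q
      + (1 / 3 : ℝ) * R.chiForm V φ (projMinus V e) (projMinus V s) (projMinus V u) q
      + R.chiForm V φ (projMinus V e) (projPlus V s) (projPlus V u) q
      + R.chiForm V φ (projPlus V e) (projMinus V s) (projMinus V u) q := by
  have ep := hV.isSection_projPlus he
  have sp := hV.isSection_projPlus hs
  have up := hV.isSection_projPlus hu
  have em := hV.isSection_projMinus he
  have sm := hV.isSection_projMinus hs
  have um := hV.isSection_projMinus hu
  rw [Dphi, correct]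
  simp only [Pi.add_apply, Pi.smul_apply, map_add, map_smul, LinearMap.add_apply,
    LinearMap.smul_apply, smul_eq_mul, hV.pairing_projPlus_comm, hV.pairing_projMinus_comm]
  simp only [← hV.pairing_chi φ ep sp up, ← hV.pairing_chi φ em sm um, ← hV.pairing_chi φ em sp up,
    ← hV.pairing_chi φ ep sm um, Pi.add_apply, map_add, LinearMap.add_apply]

variable {φ} (hφ : R.IsDualSection φ)
include hφ

theorem IsAdmissible.isSection_Dphi {e s : ∀ q : P, GT EP q} (he : R.IsSection e)
    (hs : R.IsSection s) : R.IsSection (R.Dphi V φ e s) := by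
  have ep := hV.isSection_projPlus he
  have sp := hV.isSection_projPlus hs
  have em := hV.isSection_projMinus he
  have sm := hV.isSection_projMinus hs
  have h : ∀ {a b}, R.IsSection a → R.IsSection b →
      R.IsSection (R.chi0 V a b + R.weyl φ a b) := fun ha hb =>
    (hV.isSection_chi0 ha hb).add (hV.isSection_weyl hφ ha hb)
  exact ((((hV.isSection_Dprime he hs).add ((hV.isSection_projPlus (h ep sp)).const_smul _)).add
    ((hV.isSection_projMinus (h em sm)).const_smul _)).add (hV.isSection_projPlus (h em sp))).add
    (hV.isSection_projMinus (h ep sm))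

theorem IsAdmissible.isGeneralizedConnection_Dphi : R.IsGeneralizedConnection (R.Dphi V φ) := by
  have hD := hV.isGeneralizedConnection_Dprime
  refine hV.isGeneralizedConnection (fun e s he hs => hV.isSection_Dphi hφ he hs)
    (fun e e' s u he he' hs hu q => ?_) (fun f e s u hf he hs hu q => ?_)
    (fun e s u he hs hu q => ?_)
  · have ep := hV.isSection_projPlus he
    have ep' := hV.isSection_projPlus he'
    have sp := hV.isSection_projPlus hs
    have up := hV.isSection_projPlus hu
    have em := hV.isSection_projMinus he
    have em' := hV.isSection_projMinus he'
    have sm := hV.isSection_projMinus hs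
    have um := hV.isSection_projMinus hu
    rw [hV.pairing_Dphi φ (he.add he') hs hu, hV.pairing_Dphi φ he hs hu,
      hV.pairing_Dphi φ he' hs hu, hV.projPlus_add, hV.projMinus_add,
      hV.chiForm_add φ ep ep' sp up, hV.chiForm_add φ em em' sm um,
      hV.chiForm_add φ em em' sp up, hV.chiForm_add φ ep ep' sm um, hD.add_left e e' s he he' hs,
      Pi.add_apply, map_add, LinearMap.add_apply]
    ring
  · have ep := hV.isSection_projPlus he
    have sp := hV.isSection_projPlus hs
    have up := hV.isSection_projPlus hu
    have em := hV.isSection_projMinus he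
    have sm := hV.isSection_projMinus hs
    have um := hV.isSection_projMinus hu
    rw [hV.pairing_Dphi φ (he.smul hf) hs hu, hV.pairing_Dphi φ he hs hu,
      hV.projPlus_smul (fun q => f (R.p q)), hV.projMinus_smul (fun q => f (R.p q)),
      hV.chiForm_smul φ hf ep sp up, hV.chiForm_smul φ hf em sm um,
      hV.chiForm_smul φ hf em sp up, hV.chiForm_smul φ hf ep sm um, hD.smul_left f e s hf he hs,
      map_smul, LinearMap.smul_apply, smul_eq_mul]
    ring
  · have ep := hV.isSection_projPlus he
    have sp := hV.isSection_projPlus hs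
    have up := hV.isSection_projPlus hu
    have em := hV.isSection_projMinus he
    have sm := hV.isSection_projMinus hs
    have um := hV.isSection_projMinus hu
    rw [hD.metric e s u he hs hu, pairing_comm q (s q), pairing_comm q (s q),
      hV.pairing_Dphi φ he hs hu, hV.pairing_Dphi φ he hu hs, hV.chiForm_swap φ ep sp up,
      hV.chiForm_swap φ em sm um, hV.chiForm_swap φ em sp up, hV.chiForm_swap φ ep sm um]
    ring

/-- `D'` preserves `V₊`, and in every correction the last two arguments are projected with the same
sign, so for `Π₊ s` and `Π₋ u` one of them is zero. -/
theorem IsAdmissible.pairing_Dphi_projPlus_projMinus {e s u : ∀ q : P, GT EP q}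
    (he : R.IsSection e) (hs : R.IsSection s) (hu : R.IsSection u) (q : P) :
    pairing q (R.Dphi V φ e (projPlus V s) q) (projMinus V u q) = 0 := by
  have ep := hV.isSection_projPlus he
  have sp := hV.isSection_projPlus hs
  have em := hV.isSection_projMinus he
  have um := hV.isSection_projMinus hu
  have z := IsSection.zero (R := R)
  have h0 : ∀ {a b}, R.IsSection a → R.IsSection b → R.chiForm V φ a 0 b q = 0 := fun ha hb => by
    rw [hV.chiForm_swap φ ha hb z, hV.chiForm_zero φ ha hb, neg_zero]
  rw [hV.pairing_Dphi φ he sp um, hV.projPlus_projPlus, hV.projMinus_projPlus,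
    hV.projPlus_projMinus, hV.chiForm_zero φ ep sp, hV.chiForm_zero φ em sp,
    h0 em (hV.isSection_projMinus um), h0 ep (hV.isSection_projMinus um), pairing_comm,
    hV.pairing_projMinus u (hV.Dprime_mem he sp (fun q => hV.projPlus_mem s q) q)]
  ring

/-- A metric connection that preserves `V₊` preserves its orthogonal complement: differentiate the
zero pairing of `V₊` with `V₋`. -/
theorem IsAdmissible.pairing_Dphi_projMinus_projPlus {e s u : ∀ q : P, GT EP q}
    (he : R.IsSection e) (hs : R.IsSection s) (hu : R.IsSection u) (q : P) :
    pairing q (R.Dphi V φ e (projMinus V s) q) (projPlus V u q) = 0 := by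
  have h := (hV.isGeneralizedConnection_Dphi hφ).metric e _ _ he (hV.isSection_projMinus hs)
    (hV.isSection_projPlus hu) q
  have h0 : (fun q => pairing q (projMinus V s q) (projPlus V u q)) = fun _ => 0 :=
    funext (hV.pairing_projMinus_projPlus s u)
  rw [h0, dirDeriv_const, pairing_comm q (projMinus V s q),
    hV.pairing_Dphi_projPlus_projMinus hφ he hu hs, add_zero] at h
  exact h.symm

theorem IsAdmissible.isCompatible_Dphi : R.IsCompatible V (R.Dphi V φ) := by
  intro e s he hs
  have hD := hV.isGeneralizedConnection_Dphi hφ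
  have sp := hV.isSection_projPlus hs
  have sm := hV.isSection_projMinus hs
  have hg : ∀ {a}, R.IsSection a → R.IsSection (genG V a) := fun ha =>
    (hV.isSection_projPlus ha).sub (hV.isSection_projMinus ha)
  have h1 : R.Dphi V φ e s = R.Dphi V φ e (projPlus V s) + R.Dphi V φ e (projMinus V s) := by
    rw [← hD.add_right e _ _ he sp sm, projPlus_add_projMinus]
  -- The difference `Π₊ - Π₋` is rewritten as a sum, because additivity is the rule that a
  -- generalized connection provides.
  have h2 : R.Dphi V φ e (projPlus V s)
      = R.Dphi V φ e (genG V s) + R.Dphi V φ e (projMinus V s) := by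
    rw [← hD.add_right e _ _ he (hg hs) sm]
    congr 1
    funext q
    simp only [genG, Pi.add_apply]
    abel
  funext q
  refine hV.ext_pairing ((hD.isSection _ _ he (hg hs)).mem_Kperp q)
    ((hg (hD.isSection _ _ he hs)).mem_Kperp q) fun u hu => ?_
  have h3 : u q = projPlus V u q + projMinus V u q := (congrFun (projPlus_add_projMinus u) q).symm
  have h4 : pairing q (genG V (R.Dphi V φ e s) q) (u q)
      = pairing q (R.Dphi V φ e s q) (projPlus V u q)
        - pairing q (R.Dphi V φ e s q) (projMinus V u q) := by
    rw [genG, map_sub, LinearMap.sub_apply, hV.pairing_projPlus_comm, hV.pairing_projMinus_comm]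
  have h5 := congrFun h2 q
  rw [Pi.add_apply, ← sub_eq_iff_eq_add] at h5
  rw [h4, ← h5, h3, h1]
  simp only [Pi.add_apply, map_add, map_sub, LinearMap.add_apply, LinearMap.sub_apply,
    hV.pairing_Dphi_projPlus_projMinus hφ he hs hu, hV.pairing_Dphi_projMinus_projPlus hφ he hs hu]
  ring

omit hφ in
theorem IsAdmissible.torsionForm_add {a a' b b' c c' : ∀ q : P, GT EP q} (ha : R.IsSection a)
    (ha' : R.IsSection a') (hb : R.IsSection b) (hb' : R.IsSection b') (hc : R.IsSection c)
    (hc' : R.IsSection c') (q : P) :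
    R.torsionForm (R.Dprime V) (a + a') (b + b') (c + c') q
      = R.torsionForm (R.Dprime V) a b c q + R.torsionForm (R.Dprime V) a b c' q
        + R.torsionForm (R.Dprime V) a b' c q + R.torsionForm (R.Dprime V) a b' c' q
        + R.torsionForm (R.Dprime V) a' b c q + R.torsionForm (R.Dprime V) a' b c' q
        + R.torsionForm (R.Dprime V) a' b' c q + R.torsionForm (R.Dprime V) a' b' c' q := by
  have hD := hV.isGeneralizedConnection_Dprime
  rw [hD.torsionForm_add_left ha ha' (hb.add hb') (hc.add hc'),
    hD.torsionForm_add_middle ha hb hb' (hc.add hc'),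
    hD.torsionForm_add_middle ha' hb hb' (hc.add hc'), hD.torsionForm_add_right ha hc hc',
    hD.torsionForm_add_right ha hc hc', hD.torsionForm_add_right ha' hc hc',
    hD.torsionForm_add_right ha' hc hc']
  ring

omit hφ in
/-- The sum over the cyclic permutations of `χ⁰ + χ^φ`. -/
theorem IsAdmissible.chiForm_cycle {a b c : ∀ q : P, GT EP q} (ha : R.IsSection a)
    (hb : R.IsSection b) (hc : R.IsSection c) (q : P) :
    R.chiForm V φ a b c q - R.chiForm V φ b a c q + R.chiForm V φ c a b q
      = - 3 * R.torsionForm (R.Dprime V) a b c q := by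
  have hD := hV.isGeneralizedConnection_Dprime
  simp only [chiForm]
  -- By total skewness the three torsion terms coincide, while the six Weyl terms cancel in pairs by
  -- the symmetry of the pairing.
  rw [hD.torsionForm_swap_left ha hb hc, ← hD.torsionForm_cycle hc ha hb, pairing_comm q (b q) (a q),
    pairing_comm q (c q) (a q), pairing_comm q (c q) (b q)]
  ring

omit hV hφ in
-- Each summand of the Weyl term contains `⟨a, b⟩` or `⟨a, c⟩`, so on the mixed types only the part
-- of `χ⁰` is left.
theorem chiForm_of_orthogonal {a b c : ∀ q : P, GT EP q} {q : P} (hab : pairing q (a q) (b q) = 0)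
    (hac : pairing q (a q) (c q) = 0) :
    R.chiForm V φ a b c q = - R.torsionForm (R.Dprime V) a b c q := by
  simp only [chiForm]
  rw [hab, hac]
  ring

/-- The torsion is that of `D'` plus the alternating sum of the corrections over the three
positions. Expanding the torsion of `D'` into its eight types, `c₁` and `c₂` dispose of the two pure
ones, where the factor `1/3` meets the `3` of `chiForm_cycle`, and `d₁` to `d₆` of the six mixed
ones. -/
theorem IsAdmissible.isTorsionFree_Dphi : R.IsTorsionFree (R.Dphi V φ) := by
  intro e₁ e₂ e₃ h₁ h₂ h₃ q
  have hD := hV.isGeneralizedConnection_Dprime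
  rw [(hV.isGeneralizedConnection_Dphi hφ).torsion_eq_torsionForm h₁ h₂ h₃, torsionForm,
    hV.pairing_Dphi φ h₁ h₂ h₃, hV.pairing_Dphi φ h₂ h₁ h₃, hV.pairing_Dphi φ h₃ h₁ h₂]
  have p₁ := hV.isSection_projPlus h₁
  have p₂ := hV.isSection_projPlus h₂
  have p₃ := hV.isSection_projPlus h₃
  have m₁ := hV.isSection_projMinus h₁
  have m₂ := hV.isSection_projMinus h₂
  have m₃ := hV.isSection_projMinus h₃
  have mp : ∀ a b : ∀ q : P, GT EP q, pairing q (projMinus V a q) (projPlus V b q) = 0 :=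
    fun a b => hV.pairing_projMinus_projPlus a b q
  have pm : ∀ a b : ∀ q : P, GT EP q, pairing q (projPlus V a q) (projMinus V b q) = 0 :=
    fun a b => by rw [pairing_comm, mp]
  have c₁ := hV.chiForm_cycle (φ := φ) p₁ p₂ p₃ q
  have c₂ := hV.chiForm_cycle (φ := φ) m₁ m₂ m₃ q
  have t := hV.torsionForm_add p₁ m₁ p₂ m₂ p₃ m₃ q
  rw [projPlus_add_projMinus, projPlus_add_projMinus, projPlus_add_projMinus] at t
  -- One identity for each mixed type, with the argument of exceptional sign in first place. The
  -- rewrites below bring it back to its position; the signs they produce match those of the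
  -- alternating sum.
  have d₁ := chiForm_of_orthogonal (R := R) (V := V) (φ := φ) (mp e₁ e₂) (mp e₁ e₃)
  have d₂ := chiForm_of_orthogonal (R := R) (V := V) (φ := φ) (mp e₂ e₁) (mp e₂ e₃)
  have d₃ := chiForm_of_orthogonal (R := R) (V := V) (φ := φ) (mp e₃ e₁) (mp e₃ e₂)
  have d₄ := chiForm_of_orthogonal (R := R) (V := V) (φ := φ) (pm e₁ e₂) (pm e₁ e₃)
  have d₅ := chiForm_of_orthogonal (R := R) (V := V) (φ := φ) (pm e₂ e₁) (pm e₂ e₃)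
  have d₆ := chiForm_of_orthogonal (R := R) (V := V) (φ := φ) (pm e₃ e₁) (pm e₃ e₂)
  rw [hD.torsionForm_swap_left p₁ m₂ p₃] at d₂
  rw [← hD.torsionForm_cycle m₃ p₁ p₂] at d₃
  rw [hD.torsionForm_swap_left m₁ p₂ m₃] at d₅
  rw [← hD.torsionForm_cycle p₃ m₁ m₂] at d₆
  have t' : R.torsionForm (R.Dprime V) e₁ e₂ e₃ q = pairing q (R.Dprime V e₁ e₂ q) (e₃ q)
    - pairing q (R.Dprime V e₂ e₁ q) (e₃ q) + pairing q (R.Dprime V e₃ e₁ q) (e₂ q)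
    - pairing q (R.dorfman e₁ e₂ q) (e₃ q) := rfl
  linarith

end

end CourantReduction

end Principal

end GenGeom

end

theorem mainTheorem5
    {EM : Type*} [NormedAddCommGroup EM] [NormedSpace ℝ EM] [FiniteDimensional ℝ EM]
    {M : Type*} [TopologicalSpace M] [T2Space M] [ChartedSpace EM M] [IsManifold 𝓘(ℝ, EM) ∞ M]
    {EG : Type*} [NormedAddCommGroup EG] [NormedSpace ℝ EG] [FiniteDimensional ℝ EG]
    {G : Type*} [TopologicalSpace G] [ChartedSpace EG G] [Group G] [LieGroup 𝓘(ℝ, EG) ∞ G]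
    {EP : Type*} [NormedAddCommGroup EP] [NormedSpace ℝ EP] [FiniteDimensional ℝ EP]
    {P : Type*} [TopologicalSpace P] [T2Space P] [ChartedSpace EP P] [IsManifold 𝓘(ℝ, EP) ∞ P]
    [MulAction Gᵐᵒᵖ P]
    (R : GenGeom.CourantReduction EM M EG G EP P)
    (V : ∀ q : P, Submodule ℝ (GenGeom.GT EP q)) (hV : R.IsAdmissible V) :
    (R.IsGeneralizedConnection (R.Dzero V) ∧ R.IsCompatible V (R.Dzero V) ∧
      R.IsTorsionFree (R.Dzero V)) ∧
    (∀ φ : ∀ x : M, Module.Dual ℝ (TangentSpace 𝓘(ℝ, EM) x), GenGeom.SmoothOneForm φ →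
      R.IsGeneralizedConnection (R.Dphi V (R.oneFormDual φ)) ∧
      R.IsCompatible V (R.Dphi V (R.oneFormDual φ)) ∧
      R.IsTorsionFree (R.Dphi V (R.oneFormDual φ))) ∧
    (∀ φ : ∀ q : P, Module.Dual ℝ (GenGeom.GT EP q), R.IsDualSection φ →
      R.IsGeneralizedConnection (R.Dphi V φ) ∧ R.IsCompatible V (R.Dphi V φ) ∧
      R.IsTorsionFree (R.Dphi V φ)) := by
  have key : ∀ φ : ∀ q : P, Module.Dual ℝ (GenGeom.GT EP q), R.IsDualSection φ →
      R.IsGeneralizedConnection (R.Dphi V φ) ∧ R.IsCompatible V (R.Dphi V φ) ∧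
      R.IsTorsionFree (R.Dphi V φ) := fun φ hφ =>
    ⟨hV.isGeneralizedConnection_Dphi hφ, hV.isCompatible_Dphi hφ, hV.isTorsionFree_Dphi hφ⟩
  refine ⟨?_, fun φ hφ => key _ (GenGeom.CourantReduction.isDualSection_oneFormDual hφ), key⟩
  rw [GenGeom.CourantReduction.Dzero_eq_Dphi]
  exact key 0 GenGeom.CourantReduction.isDualSection_zero
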